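/- **Setting.** An adaptive Clifford+$T$ circuit $\mathcal A$ acts on $n$ input qubits and $a\ge 0$ ancilla qubits initialised to $|0^a\rangle$. It performs Clifford gates, $T$ gates ($T=\mathrm{diag}(1,e^{i\pi/4})$) and single-qubit measurements in the computational basis on any of the $n+a$ qubits. Each operation may depend on the earlier measurement outcomes, the number of measurements need not be bounded, and the computation stops with probability one on every input. For each complete string $r\in\{0,1\}^*$ of measurement outcomes let $K_r$ be the corresponding Kraus operator (the product of the gates applied and of the projectors on the outcomes) and let $\mathcal T_r$ be the number of $T$ gates applied. Then $\mathcal A$ defines the channel $$\mathcal A(\rho)=\sum_r K_r\,(\rho\otimes|0^a\rangle\langle 0^a|)\,K_r^\dagger ,$$ and its expected $T$-count for the worst-case input is $$\mathcal T(\mathcal A)=\sup_\rho\sum_r p_r(\rho)\,\mathcal T_r\in[0,\infty],\qquad p_r(\rho)=\mathrm{Tr}\big(K_r^\dagger K_r(\rho\otimes|0^a\rangle\langle 0^a|)\big),$$ the supremum being over all $n$-qubit mixed states $\rho$. We say that $\mathcal A$ implements an $n$-qubit unitary $U$ up to error $\varepsilon$ in diamond distance if $\|\mathcal A-\mathcal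 U\|_\diamond\le\varepsilon$, where $\mathcal U(\rho)=U\rho U^\dagger\otimes|0^a\rangle\langle 0^a|$. **Theorem.** There are universal constants $c>0$ and $\varepsilon_0\in(0,1)$ such that for every $n\ge 1$ there is an $n$-qubit unitary $U$ with the following property. For every $0<\varepsilon\le\varepsilon_0$, every adaptive Clifford+$T$ circuit $\mathcal A$ (with any number of ancillas) that implements $U$ up to error $\varepsilon$ in diamond distance satisfies $$\mathcal T(\mathcal A)\ \ge\ c\left(2^n\sqrt{\log(1/\varepsilon)}+\log(1/\varepsilon)\right).$$ -/

import Mathlib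

open Matrix
open scoped ENNReal ComplexOrder

noncomputable section

namespace CliffordT

/-! ### Qubits, Paulis, Cliffords

A register is a finite type `Q` of qubits; its computational basis is `Q → Fin 2`. -/

/-- Operators on the Hilbert space of the register `Q`, in the computational basis. -/
abbrev Op (Q : Type) : Type := Matrix (Q → Fin 2) (Q → Fin 2) ℂ

/-- The tensor product over all qubits `q` of the one-qubit operators `g q`. -/
def tensorOp {Q : Type} [Fintype Q] (g : Q → Matrix (Fin 2) (Fin 2) ℂ) : Op Q :=
  Matrix.of fun x y => ∏ q, g q (x q) (y q)

/-- The one-qubit operator `g` applied to the qubit `q`, the identity on all other qubits. -/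
def onQubit {Q : Type} [Fintype Q] [DecidableEq Q] (q : Q) (g : Matrix (Fin 2) (Fin 2) ℂ) :
    Op Q :=
  tensorOp (Function.update (fun _ => 1) q g)

/-- The one-qubit Pauli matrices `I, X, Y, Z`. -/
def pauliMatrix : Fin 4 → Matrix (Fin 2) (Fin 2) ℂ :=
  ![1, !![0, 1; 1, 0], !![0, -Complex.I; Complex.I, 0], !![1, 0; 0, -1]]

/-- `P` is a Pauli operator: `P = i ^ b • P'` with `P'` a tensor product of `I, X, Y, Z`. -/
def IsPauli {Q : Type} [Fintype Q] (P : Op Q) : Prop :=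
  ∃ (b : Fin 4) (p : Q → Fin 4),
    P = Complex.I ^ (b : ℕ) • tensorOp (fun q => pauliMatrix (p q))

/-- `C` is a Clifford unitary: it maps Pauli operators to Pauli operators by conjugation. -/
def IsClifford {Q : Type} [Fintype Q] [DecidableEq Q] (C : Op Q) : Prop :=
  C ∈ Matrix.unitaryGroup (Q → Fin 2) ℂ ∧ ∀ P : Op Q, IsPauli P → IsPauli (C * P * Cᴴ)

/-- The one-qubit gate `T = diag(1, e^{iπ/4})`. -/
def tMatrix : Matrix (Fin 2) (Fin 2) ℂ :=
  !![1, 0; 0, Complex.exp (Complex.I * (Real.pi / 4))]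

/-- A gate on the register `Q`: an arbitrary Clifford unitary, or a `T` gate on one qubit. -/
inductive Gate (Q : Type) [Fintype Q] [DecidableEq Q] : Type
  | clifford (C : Op Q) (hC : IsClifford C) : Gate Q
  | t (q : Q) : Gate Q

/-- The unitary that a gate performs. -/
def Gate.op {Q : Type} [Fintype Q] [DecidableEq Q] : Gate Q → Op Q
  | .clifford C _ => C
  | .t q => onQubit q tMatrix

/-- The number of `T` gates, `0` or `1`, in a single gate. -/
def Gate.tCount {Q : Type} [Fintype Q] [DecidableEq Q] : Gate Q → ℕ
  | .clifford _ _ => 0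
  | .t _ => 1

/-- The unitary performed by a list of gates, the head of the list being applied first. -/
def gatesOp {Q : Type} [Fintype Q] [DecidableEq Q] : List (Gate Q) → Op Q
  | [] => 1
  | g :: gs => gatesOp gs * g.op

/-- The projector `|b⟩⟨b|` on the qubit `q`. -/
def measProj {Q : Type} [Fintype Q] [DecidableEq Q] (q : Q) (b : Fin 2) : Op Q :=
  onQubit q (Matrix.single b b 1)

/-! ### Adaptive Clifford+T circuits -/

/-- The isometry `|ψ⟩ ↦ |ψ⟩|0^a⟩` that appends `a` ancillas in the all-zero state. The register
has the input qubits `Sum.inl i` and the ancilla qubits `Sum.inr j`. -/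
def appendZeros (n a : ℕ) : Matrix (Fin n ⊕ Fin a → Fin 2) (Fin n → Fin 2) ℂ :=
  Matrix.of fun x y => if (∀ i, x (Sum.inl i) = y i) ∧ (∀ j, x (Sum.inr j) = 0) then 1 else 0

/-- The instructions of an adaptive Clifford+T computation on `n` input and `a` ancilla qubits.
A *history* is the finite string of the measurement outcomes obtained so far, the **most recent
outcome first**. After the history `h`, the computation applies the gates `gates h` and then
measures the qubit `q` in the computational basis if `measure h = some q`, or stops if
`measure h = none`. The number of measurements need not be bounded. -/
structure Program (n a : ℕ) where
  gates : List (Fin 2) → List (Gate (Fin n ⊕ Fin a))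
  measure : List (Fin 2) → Option (Fin n ⊕ Fin a)

namespace Program

variable {n a : ℕ} (A : Program n a)

/-- The history `h` can arise: a measurement is performed after each of its proper initial
parts. -/
def Reachable : List (Fin 2) → Prop
  | [] => True
  | _ :: h => Reachable h ∧ A.measure h ≠ none

/-- The complete outcome strings `r`, after which the computation stops. -/
def Outcome : Type := {r : List (Fin 2) // A.Reachable r ∧ A.measure r = none}

/-- The Kraus operator of a history: the product, in the order of execution, of the gates and of
the projectors on the measured outcomes. -/
def kraus : List (Fin 2) → Op (Fin n ⊕ Fin a)
  | [] => gatesOp (A.gates [])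
  | b :: h =>
      gatesOp (A.gates (b :: h)) * (A.measure h).elim 0 (fun q => measProj q b) * kraus h

/-- The number of `T` gates applied along a history. -/
def tCount : List (Fin 2) → ℕ
  | [] => ((A.gates []).map Gate.tCount).sum
  | b :: h => ((A.gates (b :: h)).map Gate.tCount).sum + tCount h

end Program

/-- An adaptive Clifford+T circuit with `n` input qubits and `a` ancillas initialised to zero: a
program that, on every input, stops with probability one, which says that its Kraus operators
define a (trace-preserving) quantum channel on the input register. -/
structure AdaptiveCircuit (n a : ℕ) extends Program n a where
  terminates : HasSum
    (fun r : toProgram.Outcome =>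
      (toProgram.kraus r.1 * appendZeros n a)ᴴ * (toProgram.kraus r.1 * appendZeros n a)) 1

namespace AdaptiveCircuit

variable {n a : ℕ} (A : AdaptiveCircuit n a)

/-- The channel `ρ ↦ ∑_r K_r (ρ ⊗ |0^a⟩⟨0^a|) K_r†` from `n` to `n + a` qubits. -/
def channel (ρ : Op (Fin n)) : Op (Fin n ⊕ Fin a) :=
  ∑' r : A.toProgram.Outcome,
    A.kraus r.1 * (appendZeros n a * ρ * (appendZeros n a)ᴴ) * (A.kraus r.1)ᴴ

/-- The probability `Tr(K_r† K_r (ρ ⊗ |0^a⟩⟨0^a|))` of the outcome string `r` on input `ρ`. -/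
def prob (ρ : Op (Fin n)) (r : A.toProgram.Outcome) : ℝ :=
  (((A.kraus r.1)ᴴ * A.kraus r.1 * (appendZeros n a * ρ * (appendZeros n a)ᴴ)).trace).re

/-- The expected `T`-count for the worst-case input,
`sup_ρ ∑_r p_r(ρ) T_r` over all `n`-qubit mixed states `ρ`; it may be infinite. -/
def expectedTCount : ℝ≥0∞ :=
  ⨆ (ρ : Op (Fin n)) (_ : ρ.PosSemidef ∧ ρ.trace = 1),
    ∑' r : A.toProgram.Outcome, ENNReal.ofReal (A.prob ρ r) * (A.tCount r.1 : ℝ≥0∞)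

end AdaptiveCircuit

/-! ### Trace norm, diamond norm, approximate implementation -/

/-- The trace norm `‖X‖₁`: the sum of the singular values of `X`, which are the square roots of the
eigenvalues of `X† X`. -/
def traceNorm {d : Type} [Fintype d] [DecidableEq d] (X : Matrix d d ℂ) : ℝ :=
  ∑ i, √((Matrix.isHermitian_conjTranspose_mul_self X).eigenvalues i)

/-- The map `id_k ⊗ Φ` for a (linear) map `Φ` on matrices: `Φ` is applied to each of the
`k × k` blocks. -/
def ampliation {d e : Type} (k : ℕ) (Φ : Matrix d d ℂ → Matrix e e ℂ)
    (X : Matrix (Fin k × d) (Fin k × d) ℂ) : Matrix (Fin k × e) (Fin k × e) ℂ :=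
  Matrix.of fun u v => Φ (Matrix.of fun i j => X (u.1, i) (v.1, j)) u.2 v.2

/-- The diamond norm of a (linear) map `Φ` on matrices: the supremum of `‖(id_k ⊗ Φ)(X)‖₁` over
all `k` and all `X` with `‖X‖₁ ≤ 1`. -/
def diamondNorm {d e : Type} [Fintype d] [DecidableEq d] [Fintype e] [DecidableEq e]
    (Φ : Matrix d d ℂ → Matrix e e ℂ) : ℝ≥0∞ :=
  ⨆ (k : ℕ) (X : Matrix (Fin k × d) (Fin k × d) ℂ) (_ : traceNorm X ≤ 1),
    ENNReal.ofReal (traceNorm (ampliation k Φ X))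

/-- The channel `ρ ↦ U ρ U† ⊗ |0^a⟩⟨0^a|`. -/
def idealChannel {n : ℕ} (a : ℕ) (U : Op (Fin n)) (ρ : Op (Fin n)) : Op (Fin n ⊕ Fin a) :=
  appendZeros n a * (U * ρ * Uᴴ) * (appendZeros n a)ᴴ

/-- `A` implements the `n`-qubit unitary `U` to within error `ε` in the diamond distance. -/
def AdaptiveCircuit.Implements {n a : ℕ} (A : AdaptiveCircuit n a) (U : Op (Fin n)) (ε : ℝ) :
    Prop :=
  diamondNorm (fun ρ => A.channel ρ - idealChannel a U ρ) ≤ ENNReal.ofReal ε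

end CliffordT

end

noncomputable section

namespace CliffordT

/-! ### Tensor products and Pauli operators -/

section Tensor

variable {Q : Type} [Fintype Q]

/-! Write d = 2^n. The proof plays the small number of operators that few `T` gates can produce
against a large family of well-separated unitaries.

From circuits to operators. Let G_r be the Kraus operator of the outcome string r, compressed to
ancillas that are zero before and after. Testing the diamond distance on a maximally entangled state
gives ∑_r |tr(U†G_r)|² ≥ d²(1-ε) (`Implements.le_tsum`). A Markov-type averaging, with the outcome
probabilities of the maximally mixed input, then yields one r whose `T`-count is at most twice a
strict upper bound for the expected one and whose G_r is nearly proportional to U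
(`Implements.exists_isClose`).

Counting. Since `T` is a combination of 1 and Z, each `T` gate can be traded for a magic state: G_r
is a stabilizer matrix applied to t magic states (`represents_reducedKraus`), and the ancillas have
disappeared. Up to scalars there are 2^O((n+t+1)²) such operators, because a stabilizer matrix is
fixed by few Pauli generators (`exists_finset_represents`), and also 2^O(d²(t+1)), because suitably
scaled entries lie in ℤ[e^{iπ/4}] with coefficients at most 4^t
(`exists_finset_represents_cyclotomic`). The first count leads to the term 2^n √log(1/ε), the second
to the term log(1/ε).

Packing. Random sign matrices give a finite set P of antisymmetric matrices of norm at most 1, with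
log₂|P| ≥ d²/32, at mutual Frobenius distance of order √d. Infinite words over P are read as
base-200 expansions, and the Cayley transform turns the sums into orthogonal matrices. Two of these
that are close to the same operator at scale 40000⁻ᵏ come from words with the same first k letters
(`exists_unitary_family`).

One U for every ε. At scale k at most 2^(d²k/50) operators are cheap, so at most that many of the
|P|^k ≥ 2^(d²k/32) words of length k are spoiled. The spoiled fractions sum to less than 1 over k ≥
10000, so some infinite word avoids all of them (`exists_unitary_forall_not_isClose`). Its unitary
serves every ε, once ε is rounded to a scale k with log(1/ε) ≤ 32k. -/

theorem tensorOp_apply (g : Q → Matrix (Fin 2) (Fin 2) ℂ) (x y : Q → Fin 2) :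
    tensorOp g x y = ∏ q, g q (x q) (y q) := rfl

theorem tensorOp_mul [DecidableEq Q] (g h : Q → Matrix (Fin 2) (Fin 2) ℂ) :
    tensorOp g * tensorOp h = tensorOp fun q => g q * h q := by
  ext x y
  simp only [Matrix.mul_apply, tensorOp_apply, ← Finset.prod_mul_distrib]
  rw [Finset.prod_univ_sum, Fintype.piFinset_univ]

theorem tensorOp_smul (c : Q → ℂ) (g : Q → Matrix (Fin 2) (Fin 2) ℂ) :
    (tensorOp fun q => c q • g q) = (∏ q, c q) • tensorOp g := by
  ext x y
  simp [tensorOp_apply, Finset.prod_mul_distrib]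

theorem tensorOp_one [DecidableEq Q] : tensorOp (fun _ : Q => 1) = 1 := by
  ext x y
  simp only [tensorOp_apply, Matrix.one_apply, Finset.prod_ite_zero, Finset.prod_const_one,
    Finset.mem_univ, true_imp_iff, funext_iff]

variable [DecidableEq Q]

theorem onQubit_one (q : Q) : onQubit q (1 : Matrix (Fin 2) (Fin 2) ℂ) = 1 := by
  rw [onQubit, Function.update_eq_self_iff.2 rfl, tensorOp_one]

theorem onQubit_apply (q : Q) (g : Matrix (Fin 2) (Fin 2) ℂ) (x y : Q → Fin 2) :
    onQubit q g x y = g (x q) (y q) *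
      ∏ p ∈ Finset.univ.erase q, (1 : Matrix (Fin 2) (Fin 2) ℂ) (x p) (y p) := by
  rw [onQubit, tensorOp_apply, ← Finset.mul_prod_erase _ _ (Finset.mem_univ q)]
  congr 1
  · simp
  · refine Finset.prod_congr rfl fun p hp => ?_
    rw [Function.update_of_ne (Finset.ne_of_mem_erase hp)]

theorem onQubit_add (q : Q) (g h : Matrix (Fin 2) (Fin 2) ℂ) :
    onQubit q (g + h) = onQubit q g + onQubit q h := by
  ext x y
  simp [onQubit_apply, add_mul]

theorem onQubit_smul (q : Q) (c : ℂ) (g : Matrix (Fin 2) (Fin 2) ℂ) :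
    onQubit q (c • g) = c • onQubit q g := by
  ext x y
  simp [onQubit_apply, mul_assoc]

theorem onQubit_mul (q : Q) (g h : Matrix (Fin 2) (Fin 2) ℂ) :
    onQubit q g * onQubit q h = onQubit q (g * h) := by
  rw [onQubit, onQubit, tensorOp_mul, onQubit]
  congr 1
  ext1 p
  by_cases hp : p = q
  · subst hp; simp
  · simp [hp]

end Tensor

/-! ### Multiplication, commutation and matrix entries of Pauli operators. -/

section Pauli

theorem pauliMatrix_mul (a b : Fin 4) :
    ∃ (k : ℕ) (c : Fin 4), pauliMatrix a * pauliMatrix b = Complex.I ^ k • pauliMatrix c := by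
  fin_cases a <;> fin_cases b
  · exact ⟨0, 0, by simp [pauliMatrix]⟩
  · exact ⟨0, 1, by simp [pauliMatrix]⟩
  · exact ⟨0, 2, by simp [pauliMatrix]⟩
  · exact ⟨0, 3, by simp [pauliMatrix]⟩
  · exact ⟨0, 1, by simp [pauliMatrix]⟩
  · exact ⟨0, 0, by simp [pauliMatrix, Matrix.one_fin_two]⟩
  · exact ⟨1, 3, by simp [pauliMatrix]⟩
  · exact ⟨3, 2, by simp [pauliMatrix, pow_succ]⟩
  · exact ⟨0, 2, by simp [pauliMatrix]⟩
  · exact ⟨3, 3, by simp [pauliMatrix, pow_succ]⟩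
  · exact ⟨0, 0, by simp [pauliMatrix, Matrix.one_fin_two]⟩
  · exact ⟨1, 1, by simp [pauliMatrix]⟩
  · exact ⟨0, 3, by simp [pauliMatrix]⟩
  · exact ⟨1, 2, by simp [pauliMatrix]⟩
  · exact ⟨3, 1, by simp [pauliMatrix, pow_succ]⟩
  · exact ⟨0, 0, by simp [pauliMatrix, Matrix.one_fin_two]⟩

theorem pauliMatrix_comm (a b : Fin 4) :
    ∃ k : ℕ, pauliMatrix a * pauliMatrix b =
      (-1 : ℂ) ^ k • (pauliMatrix b * pauliMatrix a) := by
  by_cases h : a = 0 ∨ b = 0 ∨ a = b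
  · refine ⟨0, ?_⟩
    rcases h with rfl | rfl | rfl <;> simp [pauliMatrix]
  · refine ⟨1, ?_⟩
    push Not at h
    obtain ⟨h0, h1, h2⟩ := h
    fin_cases a <;> fin_cases b <;> simp [pauliMatrix] at h0 h1 h2 ⊢

theorem pauliMatrix_mul_self (a : Fin 4) : pauliMatrix a * pauliMatrix a = 1 := by
  fin_cases a <;> simp [pauliMatrix, Matrix.one_fin_two]

/-- The bit flip performed by a Pauli matrix. -/
def pauliFlip : Fin 4 → Fin 2 := ![0, 1, 1, 0]

theorem pauliMatrix_apply (a : Fin 4) (i : Fin 2) :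
    ∃ k : ℕ, ∀ j, pauliMatrix a i j = if j = i + pauliFlip a then Complex.I ^ k else 0 := by
  fin_cases a <;> fin_cases i
  · exact ⟨0, fun j => by fin_cases j <;> simp [pauliMatrix, pauliFlip]⟩
  · exact ⟨0, fun j => by fin_cases j <;> simp [pauliMatrix, pauliFlip]⟩
  · exact ⟨0, fun j => by fin_cases j <;> simp [pauliMatrix, pauliFlip]⟩
  · exact ⟨0, fun j => by fin_cases j <;> simp [pauliMatrix, pauliFlip]⟩
  · exact ⟨3, fun j => by fin_cases j <;> simp [pauliMatrix, pauliFlip, pow_succ]⟩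
  · exact ⟨1, fun j => by fin_cases j <;> simp [pauliMatrix, pauliFlip]⟩
  · exact ⟨0, fun j => by fin_cases j <;> simp [pauliMatrix, pauliFlip]⟩
  · exact ⟨2, fun j => by fin_cases j <;> simp [pauliMatrix, pauliFlip]⟩

variable {Q : Type} [Fintype Q]

theorem isPauli_I_pow_smul (k : ℕ) (p : Q → Fin 4) :
    IsPauli (Complex.I ^ k • tensorOp fun q => pauliMatrix (p q)) :=
  ⟨⟨k % 4, Nat.mod_lt _ (by norm_num)⟩, p, by rw [Complex.I_pow_eq_pow_mod]⟩

theorem IsPauli.I_pow_smul {P : Op Q} (hP : IsPauli P) (k : ℕ) :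
    IsPauli (Complex.I ^ k • P) := by
  obtain ⟨b, p, rfl⟩ := hP
  rw [smul_smul, ← pow_add]
  exact isPauli_I_pow_smul _ p

theorem IsPauli.neg {P : Op Q} (hP : IsPauli P) : IsPauli (-P) := by
  simpa using hP.I_pow_smul 2

/-- A Pauli operator is a monomial matrix: the shift `a` is common to all rows, and only the power
of i depends on the row. -/
theorem IsPauli.exists_flip {P : Op Q} (hP : IsPauli P) :
    ∃ a : Q → Fin 2, ∀ x, ∃ k : ℕ, ∀ y, P x y = if y = x + a then Complex.I ^ k else 0 := by
  obtain ⟨b, p, rfl⟩ := hP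
  refine ⟨fun q => pauliFlip (p q), fun x => ?_⟩
  choose k hk using fun q => pauliMatrix_apply (p q) (x q)
  refine ⟨b + ∑ q, k q, fun y => ?_⟩
  simp only [Matrix.smul_apply, tensorOp_apply, hk, Finset.prod_ite_zero, Finset.mem_univ,
    true_imp_iff, funext_iff, Pi.add_apply, smul_eq_mul, mul_ite, mul_zero, pow_add,
    Finset.prod_pow_eq_pow_sum]

variable [DecidableEq Q]

theorem IsPauli.mul {P R : Op Q} (hP : IsPauli P) (hR : IsPauli R) : IsPauli (P * R) := by
  obtain ⟨b, p, rfl⟩ := hP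
  obtain ⟨b', p', rfl⟩ := hR
  choose k c hkc using fun q => pauliMatrix_mul (p q) (p' q)
  rw [smul_mul_smul_comm, tensorOp_mul]
  simp only [hkc]
  rw [tensorOp_smul, smul_smul, Finset.prod_pow_eq_pow_sum, ← pow_add, ← pow_add]
  exact isPauli_I_pow_smul _ c

theorem isPauli_one : IsPauli (1 : Op Q) :=
  ⟨0, fun _ => 0, by simp [pauliMatrix, tensorOp_one]⟩

theorem IsPauli.comm_or {P R : Op Q} (hP : IsPauli P) (hR : IsPauli R) :
    P * R = R * P ∨ P * R = -(R * P) := by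
  obtain ⟨b, p, rfl⟩ := hP
  obtain ⟨b', p', rfl⟩ := hR
  choose k hk using fun q => pauliMatrix_comm (p q) (p' q)
  have h : tensorOp (fun q => pauliMatrix (p q)) * tensorOp (fun q => pauliMatrix (p' q)) =
      (-1 : ℂ) ^ (∑ q, k q) •
        (tensorOp (fun q => pauliMatrix (p' q)) * tensorOp (fun q => pauliMatrix (p q))) := by
    rw [tensorOp_mul, tensorOp_mul]
    simp only [hk]
    rw [tensorOp_smul, Finset.prod_pow_eq_pow_sum]
  rw [smul_mul_smul_comm, h, smul_mul_smul_comm, mul_comm (Complex.I ^ (b' : ℕ)),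
    smul_comm]
  rcases neg_one_pow_eq_or ℂ (∑ q, k q) with h | h <;> simp [h]

theorem IsPauli.mul_self_or {P : Op Q} (hP : IsPauli P) : P * P = 1 ∨ P * P = -1 := by
  obtain ⟨b, p, rfl⟩ := hP
  rw [smul_mul_smul_comm, tensorOp_mul]
  simp only [pauliMatrix_mul_self]
  rw [tensorOp_one, ← mul_pow, Complex.I_mul_I]
  rcases neg_one_pow_eq_or ℂ (b : ℕ) with h | h <;> simp [h]

theorem isPauli_onQubit_Z (q : Q) : IsPauli (onQubit q (pauliMatrix 3)) := by
  refine ⟨0, Function.update (fun _ => 0) q 3, ?_⟩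
  rw [onQubit]
  simp only [Fin.val_zero, pow_zero, one_smul]
  congr 1
  ext1 p
  by_cases hp : p = q
  · subst hp; simp
  · simp [hp, pauliMatrix]

theorem onQubit_Z_mul_self (q : Q) :
    onQubit q (pauliMatrix 3) * onQubit q (pauliMatrix 3) = 1 := by
  rw [onQubit_mul, pauliMatrix_mul_self, onQubit_one]

end Pauli

/-! ### Stabilizer matrices -/

section Stab

variable {Q₁ Q₂ : Type} [Fintype Q₁] [DecidableEq Q₁] [Fintype Q₂] [DecidableEq Q₂]

/-- `M` is determined, up to a scalar, by the Pauli operators that stabilize it, when Pauli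
operators act both on the left and on the right. -/
def IsStab (M : Matrix (Q₂ → Fin 2) (Q₁ → Fin 2) ℂ) : Prop :=
  ∀ N : Matrix (Q₂ → Fin 2) (Q₁ → Fin 2) ℂ,
    (∀ (P₂ : Op Q₂) (P₁ : Op Q₁), IsPauli P₂ → IsPauli P₁ → P₂ * M * P₁ = M → P₂ * N * P₁ = N) →
      ∃ c : ℂ, N = c • M

variable {M : Matrix (Q₂ → Fin 2) (Q₁ → Fin 2) ℂ}

theorem IsStab.smul (hM : IsStab M) {c : ℂ} (hc : c ≠ 0) : IsStab (c • M) := by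
  intro N hN
  obtain ⟨a, ha⟩ := hM N fun P₂ P₁ h₂ h₁ h => hN P₂ P₁ h₂ h₁ (by simp [h])
  exact ⟨a * c⁻¹, by rw [ha, smul_smul, mul_assoc, inv_mul_cancel₀ hc, mul_one]⟩

omit [Fintype Q₁] [DecidableEq Q₁] [Fintype Q₂] [DecidableEq Q₂] in
theorem eq_zero_of_eq_neg {N : Matrix (Q₂ → Fin 2) (Q₁ → Fin 2) ℂ} (h : N = -N) : N = 0 := by
  ext x y
  exact self_eq_neg.1 (congr_fun (congr_fun h x) y)

/-- The pair (-1, 1) stabilizes the zero matrix, and it fixes nothing else. So zero counts as a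
stabilizer matrix, which covers outcomes that cannot occur. -/
theorem eq_zero_of_stab_zero {N : Matrix (Q₂ → Fin 2) (Q₁ → Fin 2) ℂ}
    (hN : ∀ (P₂ : Op Q₂) (P₁ : Op Q₁), IsPauli P₂ → IsPauli P₁ →
      P₂ * (0 : Matrix (Q₂ → Fin 2) (Q₁ → Fin 2) ℂ) * P₁ = 0 → P₂ * N * P₁ = N) :
    N = 0 := by
  have h := hN (-1) 1 isPauli_one.neg isPauli_one (by simp)
  simp only [Matrix.neg_mul, Matrix.one_mul, Matrix.mul_one] at h
  exact eq_zero_of_eq_neg h.symm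

theorem isStab_zero : IsStab (0 : Matrix (Q₂ → Fin 2) (Q₁ → Fin 2) ℂ) := fun _ hN =>
  ⟨0, by rw [eq_zero_of_stab_zero hN, smul_zero]⟩

/-- Conjugation by `C` carries the stabilizers of `M` to stabilizers of `C * M`. -/
theorem IsStab.clifford_mul (hM : IsStab M) {C : Op Q₂} (hC : IsClifford C) :
    IsStab (C * M) := by
  have hu : Cᴴ * C = 1 := (Matrix.mem_unitaryGroup_iff').1 hC.1
  have hu' : C * Cᴴ = 1 := (Matrix.mem_unitaryGroup_iff).1 hC.1
  intro N hN
  obtain ⟨a, ha⟩ := hM (Cᴴ * N) fun P₂ P₁ h₂ h₁ h => by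
    have := hN (C * P₂ * Cᴴ) P₁ (hC.2 _ h₂) h₁ (by
      calc C * P₂ * Cᴴ * (C * M) * P₁ = C * P₂ * (Cᴴ * C) * M * P₁ := by
            simp only [Matrix.mul_assoc]
        _ = C * (P₂ * M * P₁) := by rw [hu, Matrix.mul_one]; simp only [Matrix.mul_assoc]
        _ = C * M := by rw [h])
    calc P₂ * (Cᴴ * N) * P₁ = Cᴴ * C * P₂ * (Cᴴ * N) * P₁ := by rw [hu, Matrix.one_mul]
      _ = Cᴴ * (C * P₂ * Cᴴ * N * P₁) := by simp only [Matrix.mul_assoc]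
      _ = Cᴴ * N := by rw [this]
  refine ⟨a, ?_⟩
  rw [← Matrix.mul_smul, ← ha, ← Matrix.mul_assoc, hu', Matrix.one_mul]

/-- The maps N ↦ P₂NP₁ and N ↦ R₂NR₁ commute up to a sign. Both fix `M ≠ 0`, so the sign is +1. -/
theorem IsPauli.stab_comm (hM0 : M ≠ 0) {P₂ R₂ : Op Q₂} {P₁ R₁ : Op Q₁}
    (hP₂ : IsPauli P₂) (hP₁ : IsPauli P₁) (hR₂ : IsPauli R₂) (hR₁ : IsPauli R₁)
    (hP : P₂ * M * P₁ = M) (hR : R₂ * M * R₁ = M)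
    (N : Matrix (Q₂ → Fin 2) (Q₁ → Fin 2) ℂ) :
    P₂ * (R₂ * N * R₁) * P₁ = R₂ * (P₂ * N * P₁) * R₁ := by
  have hne : M ≠ -M := fun h => hM0 (eq_zero_of_eq_neg h)
  rcases hP₂.comm_or hR₂ with h | h <;> rcases hP₁.comm_or hR₁ with h' | h'
  · simp only [← Matrix.mul_assoc, h]
    simp only [Matrix.mul_assoc, h']
  · exfalso
    apply hne
    calc M = P₂ * (R₂ * M * R₁) * P₁ := by rw [hR, hP]
      _ = (P₂ * R₂) * M * (R₁ * P₁) := by simp only [Matrix.mul_assoc]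
      _ = -(R₂ * (P₂ * M * P₁) * R₁) := by
        rw [h, ← neg_eq_iff_eq_neg.2 h']
        simp [Matrix.mul_assoc]
      _ = -M := by rw [hP, hR]
  · exfalso
    apply hne
    calc M = P₂ * (R₂ * M * R₁) * P₁ := by rw [hR, hP]
      _ = (P₂ * R₂) * M * (R₁ * P₁) := by simp only [Matrix.mul_assoc]
      _ = -(R₂ * (P₂ * M * P₁) * R₁) := by
        rw [h, ← h']
        simp [Matrix.mul_assoc]
      _ = -M := by rw [hP, hR]
  · rw [show P₂ * (R₂ * N * R₁) * P₁ = (P₂ * R₂) * N * (R₁ * P₁) by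
      simp only [Matrix.mul_assoc], h, ← neg_eq_iff_eq_neg.2 h']
    simp [Matrix.mul_assoc]

/-- A Pauli measurement maps stabilizer matrices to stabilizer matrices. -/
theorem IsStab.add_mul (hM : IsStab M) {W : Op Q₂} (hW : IsPauli W) (hWW : W * W = 1) :
    IsStab (M + W * M) := by
  intro N hN
  have hWM : W * (M + W * M) = M + W * M := by
    rw [Matrix.mul_add, ← Matrix.mul_assoc, hWW, Matrix.one_mul, add_comm]
  have hWN : W * N = N := by
    simpa using hN W 1 hW isPauli_one (by simpa using hWM)
  have hcomm : ∀ (P₂ : Op Q₂) (P₁ : Op Q₁), IsPauli P₂ → IsPauli P₁ → P₂ * M * P₁ = M →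
      P₂ * W = W * P₂ →
      P₂ * N * P₁ = N := by
    intro P₂ P₁ h₂ h₁ h hc
    refine hN P₂ P₁ h₂ h₁ ?_
    rw [Matrix.mul_add, Matrix.add_mul, h, ← Matrix.mul_assoc, hc, Matrix.mul_assoc,
      Matrix.mul_assoc, ← Matrix.mul_assoc P₂, h]
  by_cases hM0 : M = 0
  · subst hM0
    exact ⟨0, by simpa using eq_zero_of_stab_zero (by simpa using hN)⟩
  by_cases hall : ∀ (P₂ : Op Q₂) (P₁ : Op Q₁), IsPauli P₂ → IsPauli P₁ → P₂ * M * P₁ = M →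
      P₂ * W = W * P₂
  -- Every stabilizer of `M` survives the measurement, so `N` is already a multiple of `M`;
  -- averaging with `W * N = N` rewrites it as a multiple of `M + W * M`.
  · obtain ⟨c, hc⟩ := hM N fun P₂ P₁ h₂ h₁ h => hcomm P₂ P₁ h₂ h₁ h (hall P₂ P₁ h₂ h₁ h)
    refine ⟨c / 2, ?_⟩
    have : c • (W * M) = c • M := by rw [← Matrix.mul_smul, ← hc, hWN]
    rw [smul_add, div_eq_mul_inv, mul_comm, mul_smul, mul_smul, this, ← hc, ← smul_add,
      ← two_smul ℂ N,
      smul_smul]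
    norm_num
  push Not at hall
  obtain ⟨R₂, R₁, hR₂, hR₁, hR, hRW⟩ := hall
  replace hRW := (hR₂.comm_or hW).resolve_left hRW
  -- Some stabilizer R anticommutes with `W` on the left. Symmetrizing `N` over R restores
  -- invariance under all stabilizers of `M`.
  have hNN : ∀ (P₂ : Op Q₂) (P₁ : Op Q₁), IsPauli P₂ → IsPauli P₁ → P₂ * M * P₁ = M →
      P₂ * (N + R₂ * N * R₁) * P₁ = N + R₂ * N * R₁ := by
    intro P₂ P₁ h₂ h₁ h
    have hsw := IsPauli.stab_comm hM0 h₂ h₁ hR₂ hR₁ h hR N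
    rw [Matrix.mul_add, Matrix.add_mul, hsw]
    rcases h₂.comm_or hW with hc | hc
    · rw [hcomm P₂ P₁ h₂ h₁ h hc]
    -- If P₂ anticommutes with `W`, the product of R and P commutes with it and so fixes `N`; as R
    -- acts as an involution, P exchanges the two summands.
    · have h1 : R₂ * (P₂ * N * P₁) * R₁ = N := by
        have := hcomm (R₂ * P₂) (P₁ * R₁) (hR₂.mul h₂) (h₁.mul hR₁) (by
          rw [show R₂ * P₂ * M * (P₁ * R₁) = R₂ * (P₂ * M * P₁) * R₁ by
            simp only [Matrix.mul_assoc], h, hR]) (by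
          rw [Matrix.mul_assoc, hc, Matrix.mul_neg, ← Matrix.mul_assoc, hRW, Matrix.neg_mul,
            neg_neg, Matrix.mul_assoc])
        rwa [show R₂ * P₂ * N * (P₁ * R₁) = R₂ * (P₂ * N * P₁) * R₁ by
          simp only [Matrix.mul_assoc]] at this
      have h2 : ∀ K : Matrix (Q₂ → Fin 2) (Q₁ → Fin 2) ℂ, R₂ * (R₂ * K * R₁) * R₁ = K := by
        have e : ∀ K : Matrix (Q₂ → Fin 2) (Q₁ → Fin 2) ℂ,
            R₂ * (R₂ * K * R₁) * R₁ = (R₂ * R₂) * K * (R₁ * R₁) := fun K => by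
          simp only [Matrix.mul_assoc]
        have hM2 : (R₂ * R₂) * M * (R₁ * R₁) = M := by rw [← e, hR, hR]
        have hne : -M ≠ M := fun h => hM0 (eq_zero_of_eq_neg h.symm)
        intro K
        rw [e]
        rcases hR₂.mul_self_or with h | h <;> rcases hR₁.mul_self_or with h' | h' <;>
          rw [h, h'] at hM2 ⊢ <;> simp at hM2 ⊢ <;> exact absurd hM2 hne
      have h3 : P₂ * N * P₁ = R₂ * N * R₁ := by
        rw [← h2 (P₂ * N * P₁), h1]
      rw [h1, h3, add_comm]
  obtain ⟨c, hc⟩ := hM _ hNN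
  refine ⟨c / 2, ?_⟩
  -- The added summand lies in the -1 eigenspace of `W`, so multiplying by 1 + W removes it and
  -- leaves 2N.
  have h1 : W * (R₂ * N * R₁) = -(R₂ * N * R₁) := by
    rw [← Matrix.mul_assoc, ← Matrix.mul_assoc, ← neg_eq_iff_eq_neg.2 hRW, Matrix.neg_mul,
      Matrix.mul_assoc R₂, hWN, Matrix.neg_mul]
  have h2 : c • (M + W * M) = N + N := by
    rw [smul_add, ← Matrix.mul_smul, ← hc, Matrix.mul_add, hWN, h1]
    abel
  rw [div_eq_mul_inv, mul_comm, mul_smul, h2, ← two_smul ℂ N, smul_smul]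
  norm_num

theorem pauliMatrix_three : pauliMatrix 3 = !![1, 0; 0, -1] := rfl

theorem measProj_eq (q : Q₂) (b : Fin 2) :
    measProj q b = (1 / 2 : ℂ) • (1 + (-1 : ℂ) ^ (b : ℕ) • onQubit q (pauliMatrix 3)) := by
  rw [measProj, ← onQubit_one q, ← onQubit_smul, ← onQubit_add, ← onQubit_smul]
  congr 1
  ext i j
  fin_cases b <;> fin_cases i <;> fin_cases j <;> norm_num [pauliMatrix_three, Matrix.single]

theorem IsStab.measProj_mul (hM : IsStab M) (q : Q₂) (b : Fin 2) :
    IsStab (measProj q b * M) := by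
  rw [measProj_eq, Matrix.smul_mul, Matrix.add_mul, Matrix.one_mul]
  refine IsStab.smul (hM.add_mul ?_ ?_) (by norm_num)
  · fin_cases b
    · simpa using isPauli_onQubit_Z q
    · simpa using (isPauli_onQubit_Z q).neg
  · rw [smul_mul_smul_comm, onQubit_Z_mul_self]
    fin_cases b <;> simp

end Stab

/-! ### Adding a column qubit, initial ancillas, removing ancillas -/

section Gadget

variable {Q₁ Q₂ : Type} [Fintype Q₁] [DecidableEq Q₁] [Fintype Q₂] [DecidableEq Q₂]

/-- The operator `g ⊗ P` on the register `Option Q`. -/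
def optionOp {Q : Type} (g : Matrix (Fin 2) (Fin 2) ℂ) (P : Op Q) : Op (Option Q) :=
  Matrix.of fun c c' => g (c none) (c' none) * P (fun q => c (some q)) fun q => c' (some q)

/-- The basis state of `Option Q` with value `j` at the new qubit. -/
def optionCons {Q : Type} (j : Fin 2) (y : Q → Fin 2) : Option Q → Fin 2 :=
  fun o => o.elim j y

omit [Fintype Q₁] [DecidableEq Q₁] in
theorem optionCons_eta (c : Option Q₁ → Fin 2) :
    optionCons (c none) (fun q => c (some q)) = c := by
  funext o
  cases o <;> rfl

theorem sum_option (f : (Option Q₁ → Fin 2) → ℂ) :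
    ∑ c, f c = ∑ j, ∑ y : Q₁ → Fin 2, f (optionCons j y) := by
  rw [← Fintype.sum_prod_type' fun j y => f (optionCons j y)]
  refine Fintype.sum_equiv Equiv.piOptionEquivProd _ _ fun c => ?_
  congr 1
  exact (optionCons_eta c).symm

omit [DecidableEq Q₁] in
theorem IsPauli.optionOp (a : Fin 4) {P : Op Q₁} (hP : IsPauli P) :
    IsPauli (optionOp (pauliMatrix a) P) := by
  obtain ⟨b, p, rfl⟩ := hP
  refine ⟨b, fun o => o.elim a p, ?_⟩
  ext c c'
  simp [CliffordT.optionOp, tensorOp_apply, Fintype.prod_option]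
  ring

/-- The slice of `N` at the value `j` of the additional column qubit. -/
def slice (N : Matrix (Q₂ → Fin 2) (Option Q₁ → Fin 2) ℂ) (j : Fin 2) :
    Matrix (Q₂ → Fin 2) (Q₁ → Fin 2) ℂ :=
  N.submatrix id (optionCons j)

theorem slice_mul_optionOp (P₂ : Op Q₂) (N : Matrix (Q₂ → Fin 2) (Option Q₁ → Fin 2) ℂ)
    (g : Matrix (Fin 2) (Fin 2) ℂ) (P : Op Q₁) (j : Fin 2) :
    slice (P₂ * N * optionOp g P) j = ∑ i, g i j • (P₂ * slice N i * P) := by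
  ext x y
  simp only [slice, Matrix.submatrix_apply, id, Matrix.mul_apply (M := P₂ * N), sum_option,
    Matrix.sum_apply, Matrix.smul_apply, optionOp, Matrix.of_apply, optionCons, Option.elim_none,
    Option.elim_some, smul_eq_mul, Matrix.mul_apply (N := P), Finset.mul_sum]
  refine Finset.sum_congr rfl fun i _ => Finset.sum_congr rfl fun z _ => ?_
  rw [Matrix.mul_apply, Matrix.mul_apply]
  simp only [Matrix.submatrix_apply, id]
  ring

/-- The matrix with slices `M` and `W * M`, from which postselection of the additional qubit
makes any combination of `M` and `W * M`. -/
def gadget (W : Op Q₂) (M : Matrix (Q₂ → Fin 2) (Q₁ → Fin 2) ℂ) :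
    Matrix (Q₂ → Fin 2) (Option Q₁ → Fin 2) ℂ :=
  Matrix.of fun x c => (if c none = 0 then M else W * M) x fun q => c (some q)

omit [Fintype Q₁] [DecidableEq Q₁] [Fintype Q₂] [DecidableEq Q₂] in
theorem ext_slice {N N' : Matrix (Q₂ → Fin 2) (Option Q₁ → Fin 2) ℂ}
    (h0 : slice N 0 = slice N' 0) (h1 : slice N 1 = slice N' 1) : N = N' := by
  ext x c
  rw [← optionCons_eta c]
  generalize c none = j
  fin_cases j
  · exact congr_fun (congr_fun h0 x) _
  · exact congr_fun (congr_fun h1 x) _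

omit [Fintype Q₁] [DecidableEq Q₁] in
theorem slice_gadget_zero (W : Op Q₂) (M : Matrix (Q₂ → Fin 2) (Q₁ → Fin 2) ℂ) :
    slice (gadget W M) 0 = M := by
  ext x y
  simp [slice, gadget, optionCons]

omit [Fintype Q₁] [DecidableEq Q₁] in
theorem slice_gadget_one (W : Op Q₂) (M : Matrix (Q₂ → Fin 2) (Q₁ → Fin 2) ℂ) :
    slice (gadget W M) 1 = W * M := by
  ext x y
  simp [slice, gadget, optionCons]

/-- The stabilizer (W, X) ties the second slice to the first. Each stabilizer (P₂, P₁) of `M`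
extends by I or Z on the new qubit, according to whether P₂ commutes or anticommutes with `W`, and
these fix the first slice up to a scalar. -/
theorem IsStab.gadget {M : Matrix (Q₂ → Fin 2) (Q₁ → Fin 2) ℂ} (hM : IsStab M) {W : Op Q₂}
    (hW : IsPauli W) (hWW : W * W = 1) : IsStab (gadget W M) := by
  intro N hN
  have h1 : W * slice N 0 = slice N 1 := by
    have := hN W (optionOp (pauliMatrix 1) 1) hW (isPauli_one.optionOp 1) (by
      apply ext_slice <;> rw [slice_mul_optionOp] <;>
        simp [slice_gadget_zero, slice_gadget_one, pauliMatrix, ← Matrix.mul_assoc, hWW])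
    have := congr_arg (slice · 1) this
    simpa [slice_mul_optionOp, pauliMatrix] using this
  obtain ⟨c, hc⟩ := hM (slice N 0) fun P₂ P₁ h₂ h₁ h => by
    rcases h₂.comm_or hW with hW' | hW'
    · have := hN P₂ (optionOp (pauliMatrix 0) P₁) h₂ (h₁.optionOp 0) (by
        apply ext_slice <;> rw [slice_mul_optionOp]
        · simp [slice_gadget_zero, pauliMatrix, h]
        · simp only [slice_gadget_one, slice_gadget_zero, pauliMatrix, Fin.sum_univ_two]
          simp only [← Matrix.mul_assoc, hW']
          rw [Matrix.mul_assoc W, Matrix.mul_assoc W, h]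
          simp)
      have := congr_arg (slice · 0) this
      simpa [slice_mul_optionOp, pauliMatrix] using this
    · have := hN P₂ (optionOp (pauliMatrix 3) P₁) h₂ (h₁.optionOp 3) (by
        apply ext_slice <;> rw [slice_mul_optionOp]
        · simp [slice_gadget_zero, pauliMatrix_three, h]
        · simp only [slice_gadget_one, slice_gadget_zero, pauliMatrix_three, Fin.sum_univ_two]
          simp only [← Matrix.mul_assoc, hW']
          rw [Matrix.neg_mul, Matrix.neg_mul, Matrix.mul_assoc W, Matrix.mul_assoc W, h]
          simp)
      have := congr_arg (slice · 0) this
      simpa [slice_mul_optionOp, pauliMatrix_three] using this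
  refine ⟨c, ext_slice ?_ ?_⟩
  · rw [hc]
    conv_lhs => rw [← slice_gadget_zero W M]
    rfl
  · rw [← h1, hc, Matrix.mul_smul, ← slice_gadget_one W M]
    rfl

end Gadget

/-! ### Appending zero ancillas and projecting them out again. -/

section Ancilla

/-- The tensor product of the Pauli matrices `X` on the qubits with `s q = 1`. -/
def xPauli {Q : Type} [Fintype Q] (s : Q → Fin 2) : Op Q :=
  tensorOp fun q => pauliMatrix (![0, 1] (s q))

/-- The tensor product of the Pauli matrices `Z` on the qubits with `s q = 1`. -/
def zPauli {Q : Type} [Fintype Q] (s : Q → Fin 2) : Op Q :=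
  tensorOp fun q => pauliMatrix (![0, 3] (s q))

section XZ

variable {Q : Type} [Fintype Q] (s : Q → Fin 2)

theorem isPauli_xPauli : IsPauli (xPauli s) := ⟨0, fun q => ![0, 1] (s q), by simp [xPauli]⟩

theorem isPauli_zPauli : IsPauli (zPauli s) := ⟨0, fun q => ![0, 3] (s q), by simp [zPauli]⟩

theorem xPauli_apply (x y : Q → Fin 2) : xPauli s x y = if y = x + s then 1 else 0 := by
  have h : ∀ q, pauliMatrix (![0, 1] (s q)) (x q) (y q) = if y q = x q + s q then 1 else 0 := by
    intro q
    generalize s q = u, x q = v, y q = w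
    fin_cases u <;> fin_cases v <;> fin_cases w <;> simp [pauliMatrix]
  simp only [xPauli, tensorOp_apply, h, Finset.prod_ite_zero, Finset.prod_const_one,
    Finset.mem_univ, true_imp_iff, funext_iff, Pi.add_apply]

theorem zPauli_apply (x y : Q → Fin 2) :
    zPauli s x y = if x = y then (-1) ^ (∑ q, (s q : ℕ) * x q) else 0 := by
  have h : ∀ q, pauliMatrix (![0, 3] (s q)) (x q) (y q) =
      if x q = y q then (-1) ^ ((s q : ℕ) * x q) else 0 := by
    intro q
    generalize s q = u, x q = v, y q = w
    fin_cases u <;> fin_cases v <;> fin_cases w <;> simp [pauliMatrix]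
  simp only [zPauli, tensorOp_apply, h, Finset.prod_ite_zero, Finset.mem_univ, true_imp_iff,
    funext_iff, Finset.prod_pow_eq_pow_sum]

variable [DecidableEq Q] {κ : Type}

theorem xPauli_mul_apply (N : Matrix (Q → Fin 2) κ ℂ) (x : Q → Fin 2) (y : κ) :
    (xPauli s * N) x y = N (x + s) y := by
  simp [Matrix.mul_apply, xPauli_apply]

theorem mul_xPauli_apply (N : Matrix κ (Q → Fin 2) ℂ) (x : κ) (y : Q → Fin 2) :
    (N * xPauli s) x y = N x (y + s) := by
  have h : ∀ z, y = z + s ↔ z = y + s := fun z => by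
    have hs : s + s = 0 := by
      funext q
      simp only [Pi.add_apply, Pi.zero_apply]
      generalize s q = u
      fin_cases u <;> rfl
    constructor <;> rintro rfl <;> rw [add_assoc, hs, add_zero]
  simp [Matrix.mul_apply, xPauli_apply, h]

theorem zPauli_mul_apply (N : Matrix (Q → Fin 2) κ ℂ) (x : Q → Fin 2) (y : κ) :
    (zPauli s * N) x y = (-1) ^ (∑ q, (s q : ℕ) * x q) * N x y := by
  simp [Matrix.mul_apply, zPauli_apply]

theorem mul_zPauli_apply (N : Matrix κ (Q → Fin 2) ℂ) (x : κ) (y : Q → Fin 2) :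
    (N * zPauli s) x y = N x y * (-1) ^ (∑ q, (s q : ℕ) * y q) := by
  simp [Matrix.mul_apply, zPauli_apply]

end XZ

theorem conjTranspose_appendZeros_mul_apply {n a : ℕ} {κ : Type}
    (M : Matrix (Fin n ⊕ Fin a → Fin 2) κ ℂ) (y : Fin n → Fin 2) (z : κ) :
    ((appendZeros n a)ᴴ * M) y z = M (Sum.elim y 0) z := by
  rw [Matrix.mul_apply, Finset.sum_eq_single (Sum.elim y 0)]
  · simp [appendZeros]
  · intro x _ hx
    rw [Matrix.conjTranspose_apply, appendZeros, Matrix.of_apply, if_neg, star_zero, zero_mul]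
    rintro ⟨h1, h2⟩
    exact hx (funext fun q => by rcases q with i | j; exacts [h1 i, h2 j])
  · simp

theorem mul_appendZeros_apply {n a : ℕ} {κ : Type}
    (M : Matrix κ (Fin n ⊕ Fin a → Fin 2) ℂ) (z : κ) (y : Fin n → Fin 2) :
    (M * appendZeros n a) z y = M z (Sum.elim y 0) := by
  rw [Matrix.mul_apply, Finset.sum_eq_single (Sum.elim y 0)]
  · simp [appendZeros]
  · intro x _ hx
    rw [appendZeros, Matrix.of_apply, if_neg, mul_zero]
    rintro ⟨h1, h2⟩
    exact hx (funext fun q => by rcases q with i | j; exacts [h1 i, h2 j])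
  · simp

theorem conjTranspose_appendZeros_mul_self (n a : ℕ) :
    (appendZeros n a)ᴴ * appendZeros n a = 1 := by
  ext y z
  rw [conjTranspose_appendZeros_mul_apply]
  simp [appendZeros, Matrix.one_apply, funext_iff]

/-- The projector onto the states that vanish on the qubits in `S`. -/
def zeroProj {Q : Type} [Fintype Q] [DecidableEq Q] (S : Finset Q) : Op Q :=
  tensorOp fun q => if q ∈ S then Matrix.single 0 0 1 else 1

theorem zeroProj_insert {Q : Type} [Fintype Q] [DecidableEq Q] {S : Finset Q} {q : Q}
    (hq : q ∉ S) : zeroProj (insert q S) = measProj q 0 * zeroProj S := by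
  rw [zeroProj, zeroProj, measProj, onQubit, tensorOp_mul]
  congr 1
  funext p
  by_cases hp : p = q
  · subst hp; simp [hq]
  · simp [hp]

theorem IsStab.zeroProj_mul {Q₁ Q₂ : Type} [Fintype Q₁] [DecidableEq Q₁] [Fintype Q₂]
    [DecidableEq Q₂] {M : Matrix (Q₂ → Fin 2) (Q₁ → Fin 2) ℂ} (hM : IsStab M) (S : Finset Q₂) :
    IsStab (zeroProj S * M) := by
  induction S using Finset.induction_on with
  | empty => simpa [zeroProj, tensorOp_one] using hM
  | insert q S hq ih =>
    rw [zeroProj_insert hq, Matrix.mul_assoc]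
    exact ih.measProj_mul q 0

theorem zeroProj_ancillas (n a : ℕ) :
    zeroProj (Finset.univ.image Sum.inr) = appendZeros n a * (appendZeros n a)ᴴ := by
  ext x y
  have h : (appendZeros n a * (appendZeros n a)ᴴ) x y =
      if (∀ i, x (Sum.inl i) = y (Sum.inl i)) ∧ (∀ j, x (Sum.inr j) = 0) ∧
        ∀ j, y (Sum.inr j) = 0 then 1 else 0 := by
    rw [Matrix.mul_apply, Finset.sum_eq_single fun i => x (Sum.inl i)]
    · have h3 : (∀ i, y (Sum.inl i) = x (Sum.inl i)) ↔ ∀ i, x (Sum.inl i) = y (Sum.inl i) :=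
        forall_congr' fun _ => eq_comm
      simp only [appendZeros, Matrix.conjTranspose_apply, Matrix.of_apply, h3]
      by_cases h0 : ∀ j, x (Sum.inr j) = 0 <;> by_cases h1 : ∀ j, y (Sum.inr j) = 0 <;>
        by_cases h2 : ∀ i, x (Sum.inl i) = y (Sum.inl i) <;>
        simp only [h0, h1, h2, and_true, and_false, implies_true, if_true,
          if_false, star_one, star_zero, mul_one, mul_zero]
    · intro z _ hz
      rw [appendZeros, Matrix.of_apply, if_neg, zero_mul]
      exact fun h => hz (funext fun i => (h.1 i).symm)
    · simp
  rw [h, zeroProj, tensorOp_apply, Fintype.prod_sum_type]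
  have h1 : ∀ j : Fin a, Matrix.single (0 : Fin 2) (0 : Fin 2) (1 : ℂ) (x (Sum.inr j))
      (y (Sum.inr j)) = if x (Sum.inr j) = 0 ∧ y (Sum.inr j) = 0 then 1 else 0 := fun j => by
    simp [Matrix.single, eq_comm]
  simp only [Finset.mem_image, Finset.mem_univ, true_and, reduceCtorEq, exists_false, if_false,
    Sum.inr.injEq, exists_eq, if_true, h1, Matrix.one_apply, Finset.prod_ite_zero,
    Finset.prod_const_one, true_imp_iff, ← forall_and]
  by_cases h2 : ∀ i, x (Sum.inl i) = y (Sum.inl i) <;> simp [h2]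

variable {n a : ℕ} {Q₁ : Type} [Fintype Q₁] [DecidableEq Q₁]

/-- Postselecting all ancillas on `0` and removing them maps stabilizer matrices to stabilizer
matrices. -/
theorem IsStab.drop {M : Matrix (Fin n ⊕ Fin a → Fin 2) (Q₁ → Fin 2) ℂ} (hM : IsStab M) :
    IsStab ((appendZeros n a)ᴴ * M) := by
  have hP := hM.zeroProj_mul (Finset.univ.image Sum.inr)
  rw [zeroProj_ancillas, Matrix.mul_assoc] at hP
  have hV := conjTranspose_appendZeros_mul_self n a
  generalize (appendZeros n a)ᴴ * M = G at hP ⊢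
  obtain ⟨V, hVdef⟩ : ∃ V, V = appendZeros n a := ⟨_, rfl⟩
  rw [← hVdef] at hP hV
  intro N hN
  obtain ⟨c, hc⟩ := hP (V * N) fun P₂ P₁ h₂ h₁ h => by
    obtain ⟨b, p, hp⟩ := h₂
    -- If P₂ flips no ancilla, it acts on the range of V as a Pauli operator on the other qubits,
    -- since Z fixes |0⟩. If it flips one, it moves the range of V to an orthogonal space, which
    -- forces `G = 0`.
    by_cases hp0 : ∀ j, pauliFlip (p (Sum.inr j)) = 0
    · have hPV : P₂ * V = V * (Complex.I ^ (b : ℕ) •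
          tensorOp fun i => pauliMatrix (p (Sum.inl i))) := by
        have hz : ∀ j (u : Fin 2), pauliMatrix (p (Sum.inr j)) u 0 = if u = 0 then 1 else 0 := by
          intro j u
          have := hp0 j
          generalize p (Sum.inr j) = l at this
          fin_cases l <;> fin_cases u <;> simp [pauliFlip, pauliMatrix] at this ⊢
        ext x y
        rw [hVdef, mul_appendZeros_apply, hp, Matrix.mul_apply,
          Finset.sum_eq_single fun i => x (Sum.inl i)]
        · simp [tensorOp_apply, hz, appendZeros, Finset.prod_ite_zero]
        · intro z _ hz
          rw [appendZeros, Matrix.of_apply, if_neg, zero_mul]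
          exact fun h => hz (funext fun i => (h.1 i).symm)
        · simp
      have h3 := hN (Complex.I ^ (b : ℕ) • tensorOp fun i => pauliMatrix (p (Sum.inl i))) P₁
        ⟨b, _, rfl⟩ h₁ (by
          have := congr_arg (Vᴴ * ·) h
          simp only [← Matrix.mul_assoc, hV] at this
          rw [Matrix.mul_assoc Vᴴ, hPV, ← Matrix.mul_assoc, hV] at this
          simpa only [Matrix.one_mul] using this)
      rw [← Matrix.mul_assoc, hPV, Matrix.mul_assoc V, Matrix.mul_assoc V, h3]
    · have hG : G = 0 := by
        have h0 : Vᴴ * (P₂ * V) = 0 := by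
          push Not at hp0
          obtain ⟨j, hj⟩ := hp0
          ext x y
          rw [hVdef, conjTranspose_appendZeros_mul_apply, mul_appendZeros_apply, hp,
            Matrix.smul_apply, tensorOp_apply,
            Finset.prod_eq_zero (i := Sum.inr j) (Finset.mem_univ _), smul_zero, Matrix.zero_apply]
          generalize p (Sum.inr j) = l at hj
          fin_cases l <;> simp [pauliFlip, pauliMatrix] at hj ⊢
        have := congr_arg (Vᴴ * ·) h
        simp only [← Matrix.mul_assoc] at this
        rw [Matrix.mul_assoc Vᴴ, h0, hV] at this
        simpa using this.symm
      have hN0 : N = 0 := eq_zero_of_stab_zero (by simpa [hG] using hN)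
      simp [hN0]
  refine ⟨c, ?_⟩
  have := congr_arg (Vᴴ * ·) hc
  simpa [← Matrix.mul_assoc, hV] using this

/-- Stabilizers of Z type kill every entry off the support, and stabilizers of X type make all
entries on the support equal. -/
theorem isStab_appendZeros (n a : ℕ) : IsStab (appendZeros n a) := by
  intro N hN
  have hZ : ∀ (s : Fin n ⊕ Fin a → Fin 2) x y, N x y ≠ 0 →
      (-1 : ℂ) ^ (∑ q, (s q : ℕ) * x q + ∑ i, (s (Sum.inl i) : ℕ) * y i) = 1 := by
    intro s x y hxy
    have h := hN (zPauli s) (zPauli fun i => s (Sum.inl i)) (isPauli_zPauli _) (isPauli_zPauli _)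
      (by
        ext x y
        rw [mul_zPauli_apply, zPauli_mul_apply, appendZeros, Matrix.of_apply]
        split_ifs with h
        · simp [Fintype.sum_sum_type, h.1, h.2, ← mul_pow]
        · simp)
    have h' := congr_fun (congr_fun h x) y
    rw [mul_zPauli_apply, zPauli_mul_apply, mul_right_comm] at h'
    rw [pow_add]
    exact mul_right_cancel₀ hxy (by rw [h', one_mul])
  have hX : ∀ y, N (Sum.elim y 0) y = N 0 0 := by
    intro z
    have h := hN (xPauli (Sum.elim z 0)) (xPauli z) (isPauli_xPauli _) (isPauli_xPauli _) (by
      ext x y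
      rw [mul_xPauli_apply, xPauli_mul_apply]
      simp [appendZeros])
    have h' := congr_fun (congr_fun h 0) 0
    rw [mul_xPauli_apply, xPauli_mul_apply, zero_add, zero_add] at h'
    exact h'
  have key : ∀ u v : Fin 2, (-1 : ℂ) ^ ((u : ℕ) + v) = 1 → u = v := by
    intro u v
    fin_cases u <;> fin_cases v <;> norm_num
  refine ⟨N 0 0, ?_⟩
  ext x y
  rw [Matrix.smul_apply, appendZeros, Matrix.of_apply]
  split_ifs with h
  · obtain rfl : x = Sum.elim y 0 :=
      funext fun q => by rcases q with i | j; exacts [h.1 i, h.2 j]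
    simp [hX]
  · rw [smul_zero]
    by_contra hxy
    refine h ⟨fun i => key _ _ ?_, fun j => key _ _ ?_⟩
    · simpa [Pi.single_apply, apply_ite Fin.val, ite_mul] using
        hZ (Pi.single (Sum.inl i) 1) x y hxy
    · simpa [Pi.single_apply, apply_ite Fin.val, ite_mul] using
        hZ (Pi.single (Sum.inr j) 1) x y hxy

end Ancilla

/-! ### Entries and number of stabilizer matrices -/

section Count

variable {Q₁ Q₂ : Type} [Fintype Q₁] [DecidableEq Q₁] [Fintype Q₂] [DecidableEq Q₂]

/-- Acting by Paulis on both sides relocates the entries and multiplies them by powers of i, in the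
same way for every `N`. -/
theorem IsPauli.mul_mul_apply {P₂ : Op Q₂} {P₁ : Op Q₁} (h₂ : IsPauli P₂) (h₁ : IsPauli P₁) :
    ∃ σ : (Q₂ → Fin 2) → (Q₁ → Fin 2) → (Q₂ → Fin 2) × (Q₁ → Fin 2), ∀ x y, ∃ k : ℕ,
      ∀ N : Matrix (Q₂ → Fin 2) (Q₁ → Fin 2) ℂ,
        (P₂ * N * P₁) x y = Complex.I ^ k * N (σ x y).1 (σ x y).2 := by
  obtain ⟨a, ha⟩ := h₂.exists_flip
  obtain ⟨b, hb⟩ := h₁.exists_flip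
  refine ⟨fun x y => (x + a, y - b), fun x y => ?_⟩
  obtain ⟨k, hk⟩ := ha x
  obtain ⟨l, hl⟩ := hb (y - b)
  refine ⟨k + l, fun N => ?_⟩
  rw [Matrix.mul_apply, Finset.sum_eq_single (y - b), hl, Matrix.mul_apply,
    Finset.sum_eq_single (x + a), hk]
  · simp [pow_add]; ring
  · intro z _ hz
    rw [hk, if_neg hz, zero_mul]
  · simp
  · intro z _ hz
    obtain ⟨m, hm⟩ := hb z
    rw [hm, if_neg, mul_zero]
    rintro rfl
    exact hz (by simp)
  · simp

/-- All nonzero entries of a stabilizer matrix agree up to powers of `i`. -/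
theorem IsStab.apply_eq {M : Matrix (Q₂ → Fin 2) (Q₁ → Fin 2) ℂ} (hM : IsStab M)
    {x₀ : Q₂ → Fin 2} {y₀ : Q₁ → Fin 2} (h0 : M x₀ y₀ ≠ 0) (x : Q₂ → Fin 2) (y : Q₁ → Fin 2)
    (hxy : M x y ≠ 0) : ∃ k : ℕ, M x y = Complex.I ^ k * M x₀ y₀ := by
  classical
  by_contra hne
  -- Keep only the entries of `M` in the class of `M x₀ y₀` modulo powers of i. Stabilizers respect
  -- these classes, so the truncation is a multiple of `M`, nonzero at (x₀, y₀) but zero at (x, y).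
  obtain ⟨c, hc⟩ := hM (Matrix.of fun x y =>
      if ∃ k : ℕ, M x y = Complex.I ^ k * M x₀ y₀ then M x y else 0) fun P₂ P₁ h₂ h₁ h => by
    obtain ⟨σ, hσ⟩ := h₂.mul_mul_apply h₁
    ext x y
    obtain ⟨k, hk⟩ := hσ x y
    have hMk := hk M
    rw [h] at hMk
    have hiff : (∃ k : ℕ, M x y = Complex.I ^ k * M x₀ y₀) ↔
        ∃ k : ℕ, M (σ x y).1 (σ x y).2 = Complex.I ^ k * M x₀ y₀ := by
      rw [hMk]
      constructor
      · rintro ⟨l, hl⟩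
        refine ⟨3 * k + l, ?_⟩
        rw [pow_add, mul_assoc, ← hl, ← mul_assoc, ← pow_add, show 3 * k + k = 4 * k by ring,
          pow_mul, Complex.I_pow_four, one_pow, one_mul]
      · rintro ⟨l, hl⟩
        exact ⟨k + l, by rw [hl, pow_add, mul_assoc]⟩
    rw [hk, Matrix.of_apply, Matrix.of_apply, hMk]
    rw [hMk] at hiff
    simp only [hiff, mul_ite, mul_zero]
  have e0 := congr_fun (congr_fun hc x₀) y₀
  have e1 := congr_fun (congr_fun hc x) y
  rw [Matrix.of_apply, Matrix.smul_apply, if_pos ⟨0, by simp⟩, smul_eq_mul] at e0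
  rw [Matrix.of_apply, Matrix.smul_apply, if_neg hne, smul_eq_mul] at e1
  have hc0 : c ≠ 0 := by
    rintro rfl
    exact h0 (by simpa using e0)
  exact mul_ne_zero hc0 hxy e1.symm

/-- A finite subgroup is generated by logarithmically many elements. -/
theorem exists_generators {G : Type*} [Group G] (H : Subgroup G) [Finite H] :
    ∃ s : Finset G, Subgroup.closure (s : Set G) = H ∧ 2 ^ s.card ≤ Nat.card H := by
  classical
  -- A set of maximal size whose generated subgroup has order at least 2^size must generate `H`: by
  -- Lagrange, one more element outside the subgroup at least doubles the order.
  let A : Set ℕ := {k | ∃ s : Finset G, s.card = k ∧ (s : Set G) ⊆ H ∧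
    2 ^ s.card ≤ Nat.card (Subgroup.closure (s : Set G))}
  have hle : ∀ s : Finset G, (s : Set G) ⊆ H →
      Nat.card (Subgroup.closure (s : Set G)) ≤ Nat.card H := fun s hs =>
    Subgroup.card_le_of_le ((Subgroup.closure_le H).2 hs)
  have hbdd : BddAbove A := by
    refine ⟨Nat.card H, ?_⟩
    rintro k ⟨s, rfl, hs, hk⟩
    exact (Nat.lt_two_pow_self.le.trans hk).trans (hle s hs)
  have hne : A.Nonempty := ⟨0, ∅, by simp⟩
  obtain ⟨s, hcard, hs, hk⟩ := Nat.sSup_mem hne hbdd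
  have hsH := (Subgroup.closure_le H).2 hs
  refine ⟨s, ?_, hk.trans (hle s hs)⟩
  refine le_antisymm hsH fun g hg => ?_
  by_contra hgs
  have hg' : g ∉ s := fun h => hgs (Subgroup.subset_closure h)
  have hs' : ((insert g s : Finset G) : Set G) ⊆ H := by
    rw [Finset.coe_insert]
    exact Set.insert_subset hg hs
  have hle' : Subgroup.closure (s : Set G) ≤ Subgroup.closure ((insert g s : Finset G) : Set G) :=
    Subgroup.closure_mono (by simp)
  have : Finite (Subgroup.closure ((insert g s : Finset G) : Set G)) :=
    Finite.of_injective _ (Subgroup.inclusion_injective ((Subgroup.closure_le H).2 hs'))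
  have hmem : (insert g s).card ∈ A := by
    refine ⟨insert g s, rfl, hs', ?_⟩
    rw [Finset.card_insert_of_notMem hg', pow_succ]
    obtain ⟨m, hm⟩ := Subgroup.card_dvd_of_le hle'
    have hpos : 0 < Nat.card (Subgroup.closure ((insert g s : Finset G) : Set G)) := Nat.card_pos
    have hm2 : 2 ≤ m := by
      by_contra hlt
      have hm1 : m = 1 := by
        have : m ≠ 0 := by rintro rfl; omega
        omega
      rw [hm1, mul_one] at hm
      have heq := Subgroup.eq_of_le_of_card_ge hle' hm.le
      exact hgs (heq ▸ Subgroup.subset_closure (by simp))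
    rw [hm]
    exact Nat.mul_le_mul hk hm2
  have := le_csSup hbdd hmem
  rw [Finset.card_insert_of_notMem hg'] at this
  omega

/-- The Pauli operator with label `l`. -/
def pauliOf {Q : Type} [Fintype Q] (l : Fin 4 × (Q → Fin 4)) : Op Q :=
  Complex.I ^ (l.1 : ℕ) • tensorOp fun q => pauliMatrix (l.2 q)

/-- The pairs of invertible operators that intertwine with `N`. -/
def intertwiners (N : Matrix (Q₂ → Fin 2) (Q₁ → Fin 2) ℂ) :
    Subgroup ((Op Q₂)ˣ × (Op Q₁)ˣ) where
  carrier := {u | (u.1 : Op Q₂) * N = N * (u.2 : Op Q₁)}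
  mul_mem' := fun {u v} (hu : _ = _) (hv : _ = _) => by
    simp only [Set.mem_ofPred_eq, Prod.fst_mul, Prod.snd_mul, Units.val_mul]
    rw [Matrix.mul_assoc, hv, ← Matrix.mul_assoc, hu, Matrix.mul_assoc]
  one_mem' := by simp
  inv_mem' := fun {u} (hu : _ = _) => by
    simp only [Set.mem_ofPred_eq, Prod.fst_inv, Prod.snd_inv]
    calc ((u.1⁻¹ : (Op Q₂)ˣ) : Op Q₂) * N
        = ((u.1⁻¹ : (Op Q₂)ˣ) : Op Q₂) * (N * (u.2 : Op Q₁)) *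
            ((u.2⁻¹ : (Op Q₁)ˣ) : Op Q₁) := by
          rw [Matrix.mul_assoc, Matrix.mul_assoc N, Units.mul_inv, Matrix.mul_one]
      _ = N * ((u.2⁻¹ : (Op Q₁)ˣ) : Op Q₁) := by
          rw [← hu, ← Matrix.mul_assoc, Units.inv_mul, Matrix.one_mul]

/-- The group of Pauli operators. -/
def pauliGroup (Q : Type) [Fintype Q] [DecidableEq Q] : Subgroup (Op Q)ˣ where
  carrier := {u | IsPauli (u : Op Q)}
  mul_mem' := fun {_ _} hu hv => hu.mul hv
  one_mem' := isPauli_one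
  inv_mem' := fun {u} (hu : IsPauli (u : Op Q)) => by
    rcases hu.mul_self_or with h | h
    · rwa [Set.mem_ofPred_eq, Units.inv_eq_of_mul_eq_one_left h]
    · rw [Set.mem_ofPred_eq,
        Units.inv_eq_of_mul_eq_one_left (a := -(u : Op Q)) (by rw [neg_mul, h, neg_neg])]
      exact hu.neg

/-- The pairs of Pauli operators that intertwine with `M`, as a group. -/
def stabGroup (M : Matrix (Q₂ → Fin 2) (Q₁ → Fin 2) ℂ) : Subgroup ((Op Q₂)ˣ × (Op Q₁)ˣ) :=
  (pauliGroup Q₂).prod (pauliGroup Q₁) ⊓ intertwiners M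

/-- A label of `m` pairs of Pauli operators, the generators of a group. -/
abbrev GenLabel (Q₁ Q₂ : Type) (m : ℕ) : Type :=
  Fin m → (Fin 4 × (Q₂ → Fin 4)) × (Fin 4 × (Q₁ → Fin 4))

/-- `V` spans the space of the matrices that intertwine with all pairs in the list `τ`. -/
def Spans {m : ℕ} (τ : GenLabel Q₁ Q₂ m)
    (V : Matrix (Q₂ → Fin 2) (Q₁ → Fin 2) ℂ) : Prop :=
  ∀ N : Matrix (Q₂ → Fin 2) (Q₁ → Fin 2) ℂ,
    (∀ i, pauliOf (τ i).1 * N = N * pauliOf (τ i).2) ↔ ∃ c : ℂ, N = c • V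

theorem card_pauliLabel (Q : Type) [Fintype Q] [DecidableEq Q] :
    Fintype.card (Fin 4 × (Q → Fin 4)) = 2 ^ (2 * Fintype.card Q + 2) := by
  simp only [Fintype.card_prod, Fintype.card_fin, Fintype.card_fun]
  rw [pow_add, pow_mul]
  ring

/-- Replacing P₁ by its inverse turns the stabilizer condition into an intertwining relation, whose
solutions form a group. Its order is at most the number of pairs of labels, so a logarithmic number
of generators suffices. -/
theorem IsStab.exists_spans {M : Matrix (Q₂ → Fin 2) (Q₁ → Fin 2) ℂ} (hM : IsStab M) :
    ∃ τ : GenLabel Q₁ Q₂ (2 * (Fintype.card Q₁ + Fintype.card Q₂ + 2)), Spans τ M := by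
  classical
  let lab : (Fin 4 × (Q₂ → Fin 4)) × (Fin 4 × (Q₁ → Fin 4)) → Op Q₂ × Op Q₁ :=
    fun l => (pauliOf l.1, pauliOf l.2)
  have hlab : ∀ u ∈ stabGroup M, ∃ l, lab l = ((u.1 : Op Q₂), (u.2 : Op Q₁)) := by
    rintro u ⟨⟨⟨b, p, h⟩, ⟨b', p', h'⟩⟩, -⟩
    exact ⟨((b, p), (b', p')), by rw [h, h']; rfl⟩
  choose! L hL using hlab
  have hinj : Function.Injective fun u : stabGroup M => L u.1 := by
    intro u v huv
    have := (hL u.1 u.2).symm.trans ((congr_arg lab huv).trans (hL v.1 v.2))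
    simp only [Prod.mk.injEq, Units.val_inj] at this
    exact Subtype.ext (Prod.ext this.1 this.2)
  have : Finite (stabGroup M) := Finite.of_injective _ hinj
  have hcard : Nat.card (stabGroup M) ≤ 2 ^ (2 * (Fintype.card Q₁ + Fintype.card Q₂ + 2)) := by
    refine (Nat.card_le_card_of_injective _ hinj).trans ?_
    rw [Nat.card_eq_fintype_card, Fintype.card_prod, card_pauliLabel, card_pauliLabel, ← pow_add]
    exact (congr_arg _ (by ring)).le
  obtain ⟨s, hs, hsc⟩ := exists_generators (stabGroup M)
  have hsm : s.card ≤ 2 * (Fintype.card Q₁ + Fintype.card Q₂ + 2) :=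
    (Nat.pow_le_pow_iff_right (by norm_num)).1 (hsc.trans hcard)
  have hsub : ∀ u ∈ s, u ∈ stabGroup M := fun u hu => hs ▸ Subgroup.subset_closure hu
  -- Surplus positions carry the label of the identity pair, which imposes no condition.
  refine ⟨fun i => if h : i.1 < s.card then L (s.equivFin.symm ⟨i.1, h⟩).1
    else ((0, fun _ => 0), (0, fun _ => 0)), fun N => ⟨fun hN => ?_, ?_⟩⟩
  · have hgen : ∀ u ∈ s, (u.1 : Op Q₂) * N = N * (u.2 : Op Q₁) := by
      intro u hu
      have h := hN ⟨(s.equivFin ⟨u, hu⟩).1, (s.equivFin ⟨u, hu⟩).2.trans_le hsm⟩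
      simp only [Fin.is_lt, dif_pos, Fin.eta, Equiv.symm_apply_apply] at h
      have hLu := hL u (hsub u hu)
      simp only [lab, Prod.mk.injEq] at hLu
      rwa [hLu.1, hLu.2] at h
    have hall : stabGroup M ≤ intertwiners N := by
      rw [← hs, Subgroup.closure_le]
      exact hgen
    refine hM N fun P₂ P₁ h₂ h₁ h => ?_
    have hunit : ∀ {Q : Type} [Fintype Q] [DecidableEq Q] (P : Op Q), IsPauli P →
        ∃ R : Op Q, IsPauli R ∧ P * R = 1 := by
      intro Q _ _ P hP
      rcases hP.mul_self_or with h | h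
      · exact ⟨P, hP, h⟩
      · exact ⟨-P, hP.neg, by rw [mul_neg, h, neg_neg]⟩
    obtain ⟨R₂, -, hR₂⟩ := hunit P₂ h₂
    obtain ⟨R₁, hR₁P, hR₁⟩ := hunit P₁ h₁
    have hR₁' : R₁ * P₁ = 1 := mul_eq_one_comm.1 hR₁
    have hmem : ((⟨P₂, R₂, hR₂, mul_eq_one_comm.1 hR₂⟩, ⟨R₁, P₁, hR₁', hR₁⟩) :
        (Op Q₂)ˣ × (Op Q₁)ˣ) ∈ stabGroup M := by
      refine ⟨⟨h₂, hR₁P⟩, ?_⟩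
      change P₂ * M = M * R₁
      calc P₂ * M = P₂ * M * (P₁ * R₁) := by rw [hR₁, Matrix.mul_one]
        _ = M * R₁ := by rw [← Matrix.mul_assoc, h]
    have hN' : P₂ * N = N * R₁ := hall hmem
    rw [hN', Matrix.mul_assoc, hR₁', Matrix.mul_one]
  · rintro ⟨c, rfl⟩ i
    rw [Matrix.mul_smul, Matrix.smul_mul]
    congr 1
    by_cases h : i.1 < s.card
    · simp only [dif_pos h]
      have hu := hsub _ (s.equivFin.symm ⟨i.1, h⟩).2
      have hLu := hL _ hu
      simp only [lab, Prod.mk.injEq] at hLu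
      rw [hLu.1, hLu.2]
      exact hu.2
    · simp [h, pauliOf, pauliMatrix, tensorOp_one]

/-- There are only finitely many stabilizer matrices up to scalars. -/
theorem exists_finset_isStab (Q₁ Q₂ : Type) [Fintype Q₁] [DecidableEq Q₁] [Fintype Q₂]
    [DecidableEq Q₂] :
    ∃ S : Finset (Matrix (Q₂ → Fin 2) (Q₁ → Fin 2) ℂ),
      S.card ≤ 2 ^ (4 * (Fintype.card Q₁ + Fintype.card Q₂ + 2) ^ 2) ∧
      ∀ M, IsStab M → ∃ V ∈ S, ∃ c : ℂ, M = c • V := by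
  classical
  let m := 2 * (Fintype.card Q₁ + Fintype.card Q₂ + 2)
  let f : GenLabel Q₁ Q₂ m → Matrix (Q₂ → Fin 2) (Q₁ → Fin 2) ℂ := fun τ =>
    if h : ∃ V, Spans τ V then h.choose else 0
  refine ⟨Finset.univ.image f, Finset.card_image_le.trans ?_, fun M hM => ?_⟩
  · rw [Finset.card_univ, Fintype.card_fun, Fintype.card_fin, Fintype.card_prod, card_pauliLabel,
      card_pauliLabel, ← pow_add, ← pow_mul]
    exact (congr_arg _ (by simp only [m]; ring)).le
  · obtain ⟨τ, hτ⟩ := hM.exists_spans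
    refine ⟨f τ, by simp, ?_⟩
    have h : ∃ V, Spans τ V := ⟨M, hτ⟩
    simp only [f, dif_pos h]
    exact (h.choose_spec M).1 ((hτ M).2 ⟨1, by simp⟩)

end Count

/-! ### The Kraus operators of a circuit -/

section Represent

/-- The phase `e^{iπ/4}` of the `T` gate. -/
def omega : ℂ := Complex.exp (Complex.I * (Real.pi / 4))

theorem omega_pow_four : omega ^ 4 = -1 := by
  rw [omega, ← Complex.exp_nat_mul, ← Complex.exp_pi_mul_I]
  congr 1
  push_cast
  ring

/-- The two weights are the amplitudes used in `magic`. Hence contracting the extra column qubit of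
`gadget Z M` with a magic state applies `T` to `M`. -/
theorem onQubit_tMatrix {Q : Type} [Fintype Q] [DecidableEq Q] (q : Q) :
    onQubit q tMatrix =
      ((1 + omega) / 2) • 1 + ((1 - omega) / 2) • onQubit q (pauliMatrix 3) := by
  rw [← onQubit_one q, ← onQubit_smul, ← onQubit_smul, ← onQubit_add]
  congr 1
  ext i j
  fin_cases i <;> fin_cases j <;> simp [pauliMatrix_three, tMatrix, omega] <;> ring

/-- A register of `n + t` qubits. -/
def Col (n : ℕ) : ℕ → Type
  | 0 => Fin n
  | t + 1 => Option (Col n t)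

instance Col.instFintype (n : ℕ) : ∀ t, Fintype (Col n t)
  | 0 => inferInstanceAs (Fintype (Fin n))
  | t + 1 => @instFintypeOption _ (Col.instFintype n t)

instance Col.instDecidableEq (n : ℕ) : ∀ t, DecidableEq (Col n t)
  | 0 => inferInstanceAs (DecidableEq (Fin n))
  | t + 1 => @Option.instDecidableEq _ (Col.instDecidableEq n t)

theorem Col.card (n : ℕ) : ∀ t, Fintype.card (Col n t) = n + t
  | 0 => Fintype.card_fin n
  | t + 1 => by
    have : Fintype.card (Col n (t + 1)) = Fintype.card (Option (Col n t)) := rfl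
    rw [this, Fintype.card_option, Col.card n t, add_assoc]

/-- The isometry (up to normalization) that appends `t` magic states to `n` qubits. -/
def magic (n : ℕ) : ∀ t, Matrix (Col n t → Fin 2) (Fin n → Fin 2) ℂ
  | 0 => (1 : Matrix (Fin n → Fin 2) (Fin n → Fin 2) ℂ)
  | t + 1 => Matrix.of fun (c : Option (Col n t) → Fin 2) y =>
      ![(1 + omega) / 2, (1 - omega) / 2] (c none) * magic n t (fun q => c (some q)) y

theorem magic_succ_apply (n t : ℕ) (j : Fin 2) (z : Col n t → Fin 2) (y : Fin n → Fin 2) :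
    magic n (t + 1) (optionCons j z) y =
      ![(1 + omega) / 2, (1 - omega) / 2] j * magic n t z y := rfl

theorem mul_magic_succ {n t : ℕ} {κ : Type} [Fintype κ] [DecidableEq κ]
    (N : Matrix (κ → Fin 2) (Option (Col n t) → Fin 2) ℂ) :
    N * (show Matrix (Option (Col n t) → Fin 2) (Fin n → Fin 2) ℂ from magic n (t + 1)) =
      ((1 + omega) / 2) • (slice N 0 * magic n t) +
        ((1 - omega) / 2) • (slice N 1 * magic n t) := by
  ext x y
  rw [Matrix.mul_apply, sum_option, Fin.sum_univ_two, Matrix.add_apply, Matrix.smul_apply,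
    Matrix.smul_apply, Matrix.mul_apply, Matrix.mul_apply, smul_eq_mul, smul_eq_mul,
    Finset.mul_sum, Finset.mul_sum]
  congr 1 <;> refine Finset.sum_congr rfl fun z _ => ?_ <;>
    erw [magic_succ_apply] <;> simp [slice] <;> ring

/-- `V` is obtained by a stabilizer operation from `t` magic states. -/
def Represents {Q : Type} [Fintype Q] [DecidableEq Q] {n : ℕ}
    (V : Matrix (Q → Fin 2) (Fin n → Fin 2) ℂ) (t : ℕ) : Prop :=
  ∃ M : Matrix (Q → Fin 2) (Col n t → Fin 2) ℂ, IsStab M ∧ V = M * magic n t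

variable {Q : Type} [Fintype Q] [DecidableEq Q] {n : ℕ}
  {V : Matrix (Q → Fin 2) (Fin n → Fin 2) ℂ} {t : ℕ}

theorem Represents.gate_mul (h : Represents V t) (g : Gate Q) :
    Represents (g.op * V) (g.tCount + t) := by
  obtain ⟨M, hM, rfl⟩ := h
  cases g with
  | clifford C hC =>
    rw [Gate.tCount, zero_add]
    exact ⟨C * M, hM.clifford_mul hC, by rw [Gate.op, Matrix.mul_assoc]⟩
  | t q =>
    rw [Gate.tCount, add_comm]
    refine ⟨_, hM.gadget (isPauli_onQubit_Z q) (onQubit_Z_mul_self q), ?_⟩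
    refine Eq.trans ?_ (mul_magic_succ _).symm
    rw [slice_gadget_zero, slice_gadget_one, Gate.op, onQubit_tMatrix, Matrix.add_mul,
      Matrix.smul_mul, Matrix.smul_mul, Matrix.one_mul, Matrix.mul_assoc]

theorem Represents.gatesOp_mul (h : Represents V t) (gs : List (Gate Q)) :
    Represents (gatesOp gs * V) ((gs.map Gate.tCount).sum + t) := by
  induction gs generalizing V t with
  | nil => simpa [gatesOp] using h
  | cons g gs ih =>
    have := ih (h.gate_mul g)
    rwa [← Matrix.mul_assoc, ← add_assoc, add_comm _ g.tCount] at this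

theorem represents_kraus {n a : ℕ} (A : Program n a) (h : List (Fin 2)) :
    Represents (A.kraus h * appendZeros n a) (A.tCount h) := by
  induction h with
  | nil =>
    have h0 : Represents (appendZeros n a) 0 :=
      ⟨_, isStab_appendZeros n a, (Matrix.mul_one (appendZeros n a)).symm⟩
    exact h0.gatesOp_mul _
  | cons b h ih =>
    rw [Program.kraus, Program.tCount, Matrix.mul_assoc, Matrix.mul_assoc]
    refine Represents.gatesOp_mul ?_ _
    obtain ⟨M, hM, hV⟩ := ih
    cases A.measure h with
    -- A history that continues past a stop has Kraus operator zero.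
    | none => exact ⟨0, isStab_zero, by simp⟩
    | some q => exact ⟨_, hM.measProj_mul q b, by simp [hV, Matrix.mul_assoc]⟩

/-- The part of a Kraus operator that returns the ancillas to the zero state. -/
def reducedKraus {n a : ℕ} (A : Program n a) (h : List (Fin 2)) : Op (Fin n) :=
  (appendZeros n a)ᴴ * (A.kraus h * appendZeros n a)

/-- After this compression the ancillas are gone, so the counts below depend only on n and t. -/
theorem represents_reducedKraus {n a : ℕ} (A : Program n a) (h : List (Fin 2)) :
    Represents (reducedKraus A h) (A.tCount h) := by
  obtain ⟨M, hM, hV⟩ := represents_kraus A h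
  exact ⟨_, hM.drop, by rw [reducedKraus, hV, Matrix.mul_assoc]⟩

theorem exists_finset_represents (n t : ℕ) :
    ∃ S : Finset (Op (Fin n)), S.card ≤ 2 ^ (4 * (2 * n + t + 2) ^ 2) ∧
      ∀ G : Op (Fin n), Represents G t → ∃ V ∈ S, ∃ c : ℂ, G = c • V := by
  classical
  obtain ⟨S, hS, h⟩ := exists_finset_isStab (Col n t) (Fin n)
  refine ⟨S.image (· * magic n t), Finset.card_image_le.trans (hS.trans ?_), ?_⟩
  · rw [Col.card, Fintype.card_fin]
    exact (congr_arg _ (by ring)).le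
  · rintro G ⟨M, hM, rfl⟩
    obtain ⟨V, hV, c, rfl⟩ := h M hM
    exact ⟨_, Finset.mem_image_of_mem _ hV, c, Matrix.smul_mul _ _ _⟩

/-- `z` is an integral combination of `1, ω, ω², ω³` with coefficients of size at most `B`. -/
def IsCyclotomicBounded (B : ℕ) (z : ℂ) : Prop :=
  ∃ a : Fin 4 → ℤ, (∀ j, |a j| ≤ B) ∧ z = ∑ j, (a j : ℂ) * omega ^ (j : ℕ)

theorem IsCyclotomicBounded.add {B B' : ℕ} {z w : ℂ} (hz : IsCyclotomicBounded B z)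
    (hw : IsCyclotomicBounded B' w) : IsCyclotomicBounded (B + B') (z + w) := by
  obtain ⟨a, ha, rfl⟩ := hz
  obtain ⟨b, hb, rfl⟩ := hw
  refine ⟨a + b, fun j => ?_, ?_⟩
  · push_cast
    exact (abs_add_le _ _).trans (add_le_add (ha j) (hb j))
  · simp [add_mul, Finset.sum_add_distrib]

theorem IsCyclotomicBounded.neg {B : ℕ} {z : ℂ} (hz : IsCyclotomicBounded B z) :
    IsCyclotomicBounded B (-z) := by
  obtain ⟨a, ha, rfl⟩ := hz
  exact ⟨-a, fun j => by simpa using ha j, by simp⟩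

theorem IsCyclotomicBounded.omega_mul {B : ℕ} {z : ℂ} (hz : IsCyclotomicBounded B z) :
    IsCyclotomicBounded B (omega * z) := by
  obtain ⟨a, ha, rfl⟩ := hz
  -- Multiplication by ω rotates the coefficients, with a sign because ω⁴ = -1.
  refine ⟨![-a 3, a 0, a 1, a 2], fun j => ?_, ?_⟩
  · fin_cases j
    · simpa using ha 3
    · exact ha 0
    · exact ha 1
    · exact ha 2
  · have h4 := omega_pow_four
    simp only [Fin.sum_univ_four]
    simp
    linear_combination (a 3 : ℂ) * h4

theorem isCyclotomicBounded_I_pow (k : ℕ) : IsCyclotomicBounded 1 (Complex.I ^ k) := by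
  have h1 : IsCyclotomicBounded 1 1 :=
    ⟨![1, 0, 0, 0], fun j => by fin_cases j <;> simp, by simp [Fin.sum_univ_four]⟩
  have hI : Complex.I = omega * omega := by
    rw [omega, ← Complex.exp_add, show Complex.I * (Real.pi / 4) + Complex.I * (Real.pi / 4) =
      Real.pi / 2 * Complex.I by ring, Complex.exp_pi_div_two_mul_I]
  induction k with
  | zero => simpa using h1
  | succ k ih =>
    rw [pow_succ', hI, mul_assoc, ← hI]
    exact ih.omega_mul.omega_mul

/-- Each magic state has weights (1 ± ω)/2. One factor 2 clears the denominator, and the four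
resulting terms multiply the coefficient bound by 4. -/
theorem isCyclotomicBounded_sum_magic (n t : ℕ) (m : (Col n t → Fin 2) → ℂ)
    (hm : ∀ c, m c = 0 ∨ ∃ k : ℕ, m c = Complex.I ^ k) (y : Fin n → Fin 2) :
    IsCyclotomicBounded (4 ^ t) (2 ^ t * ∑ c, m c * magic n t c y) := by
  induction t with
  | zero =>
    have h : ∑ c, m c * magic n 0 c y = m y :=
      (Finset.sum_eq_single (M := ℂ) (s := (Finset.univ : Finset (Fin n → Fin 2))) y
        (fun c _ hc => by simp [magic, hc]) (by simp)).trans (by simp [magic])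
    rw [h, pow_zero, pow_zero, one_mul]
    rcases hm y with h | ⟨k, h⟩
    · exact ⟨0, by simp, by simp [h]⟩
    · rw [h]
      exact isCyclotomicBounded_I_pow k
  | succ t ih =>
    have h : ∑ c, m c * magic n (t + 1) c y =
        (1 + omega) / 2 * ∑ z, m (optionCons 0 z) * magic n t z y +
          (1 - omega) / 2 * ∑ z, m (optionCons 1 z) * magic n t z y := by
      refine (sum_option (Q₁ := Col n t) _).trans ?_
      rw [Fin.sum_univ_two, Finset.mul_sum, Finset.mul_sum]
      congr 1 <;> refine Finset.sum_congr rfl fun z _ => ?_ <;>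
        erw [magic_succ_apply] <;> simp <;> ring
    have h0 := ih (fun z => m (optionCons 0 z)) fun z => hm _
    have h1 := ih (fun z => m (optionCons 1 z)) fun z => hm _
    have := (h0.add h0.omega_mul).add (h1.add h1.omega_mul.neg)
    rw [h]
    convert this using 1
    · ring
    · ring

/-- Divided by one nonzero entry, `M` has only the entries 0 and powers of i. This exponent is
linear in t, whereas that of `exists_finset_represents` is quadratic, so it is the better count for
large t. -/
theorem exists_finset_represents_cyclotomic (n t : ℕ) :
    ∃ S : Finset (Op (Fin n)), S.card ≤ ((2 * 4 ^ t + 1) ^ 4) ^ (2 ^ n * 2 ^ n) ∧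
      ∀ G : Op (Fin n), Represents G t → ∃ V ∈ S, ∃ c : ℂ, G = c • V := by
  classical
  -- Coefficients between -4^t and 4^t are stored as naturals, shifted by 4^t.
  let f : ((Fin n → Fin 2) × (Fin n → Fin 2) → Fin 4 → Fin (2 * 4 ^ t + 1)) → Op (Fin n) :=
    fun a => Matrix.of fun x y =>
      ∑ j, (((a (x, y) j : ℕ) : ℤ) - (4 ^ t : ℕ) : ℤ) * omega ^ (j : ℕ)
  refine ⟨Finset.univ.image f, Finset.card_image_le.trans ?_, ?_⟩
  · simp
  · rintro G ⟨M, hM, rfl⟩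
    by_cases hM0 : M = 0
    · exact ⟨f 0, by simp, 0, by simp [hM0]⟩
    obtain ⟨x₀, y₀, h0⟩ : ∃ x₀ y₀, M x₀ y₀ ≠ 0 := by
      by_contra h
      push Not at h
      exact hM0 (Matrix.ext h)
    have hent : ∀ p : (Fin n → Fin 2) × (Fin n → Fin 2), IsCyclotomicBounded (4 ^ t)
        (2 ^ t * ((M x₀ y₀)⁻¹ * (M * magic n t) p.1 p.2)) := by
      intro p
      have := isCyclotomicBounded_sum_magic n t (fun c => (M x₀ y₀)⁻¹ * M p.1 c) (fun c => by
        by_cases hc : M p.1 c = 0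
        · exact Or.inl (by rw [hc, mul_zero])
        · obtain ⟨k, hk⟩ := hM.apply_eq h0 _ _ hc
          refine Or.inr ⟨k, ?_⟩
          rw [hk]
          field_simp) p.2
      convert this using 2
      rw [Matrix.mul_apply, Finset.mul_sum]
      exact Finset.sum_congr rfl fun c _ => (mul_assoc _ _ _).symm
    choose a ha hae using hent
    refine ⟨f fun p j => ⟨(a p j + (4 ^ t : ℕ)).toNat, ?_⟩, by simp, M x₀ y₀ / 2 ^ t, ?_⟩
    · have := abs_le.1 (ha p j)
      omega
    · ext x y
      have hx := hae (x, y)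
      rw [Matrix.smul_apply, smul_eq_mul]
      have hs : ∀ j, ((((a (x, y) j + (4 ^ t : ℕ)).toNat : ℕ) : ℤ) - (4 ^ t : ℕ) : ℤ) =
          a (x, y) j := fun j => by
        have := abs_le.1 (ha (x, y) j)
        omega
      simp only [f, Matrix.of_apply, hs]
      rw [← hx]
      field_simp

end Represent

/-! ### Trace norm and Frobenius norm -/

section TraceNorm

/-- The square of the Frobenius norm. -/
def frobSq {m n : Type} [Fintype m] [Fintype n] (X : Matrix m n ℂ) : ℝ := ∑ i, ∑ j, ‖X i j‖ ^ 2

variable {m n d : Type} [Fintype m] [Fintype n] [Fintype d] [DecidableEq d]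

theorem trace_conjTranspose_mul_self (X : Matrix m n ℂ) : (Xᴴ * X).trace = (frobSq X : ℂ) := by
  rw [frobSq, Finset.sum_comm, Matrix.trace]
  push_cast
  refine Finset.sum_congr rfl fun j _ => ?_
  rw [Matrix.diag_apply, Matrix.mul_apply]
  exact Finset.sum_congr rfl fun i _ => Complex.conj_mul' (X i j)

theorem frobSq_nonneg (X : Matrix m n ℂ) : 0 ≤ frobSq X := by
  unfold frobSq; positivity

theorem norm_apply_sq_le_frobSq (X : Matrix m n ℂ) (i : m) (j : n) : ‖X i j‖ ^ 2 ≤ frobSq X :=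
  (Finset.single_le_sum (f := fun j => ‖X i j‖ ^ 2) (fun _ _ => by positivity)
    (Finset.mem_univ j)).trans
  (Finset.single_le_sum (f := fun i => ∑ j, ‖X i j‖ ^ 2) (fun _ _ => by positivity)
    (Finset.mem_univ i))

theorem norm_sum_star_mul_sq_le {ι : Type} [Fintype ι] (f g : ι → ℂ) :
    ‖∑ i, star (f i) * g i‖ ^ 2 ≤ (∑ i, ‖f i‖ ^ 2) * ∑ i, ‖g i‖ ^ 2 := by
  have h := norm_inner_le_norm (𝕜 := ℂ) (WithLp.toLp 2 f) (WithLp.toLp 2 g)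
  have h2 := pow_le_pow_left₀ (norm_nonneg _) h 2
  rw [mul_pow, EuclideanSpace.norm_sq_eq, EuclideanSpace.norm_sq_eq] at h2
  simpa [PiLp.inner_apply, mul_comm] using h2

theorem trace_conjTranspose_mul (X Y : Matrix m n ℂ) :
    (Xᴴ * Y).trace = ∑ p : m × n, star (X p.1 p.2) * Y p.1 p.2 := by
  rw [Fintype.sum_prod_type, Finset.sum_comm, Matrix.trace]
  exact Finset.sum_congr rfl fun j _ => by simp [Matrix.mul_apply]

theorem frobSq_eq_sum_prod (X : Matrix m n ℂ) : frobSq X = ∑ p : m × n, ‖X p.1 p.2‖ ^ 2 := by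
  rw [Fintype.sum_prod_type, frobSq]

theorem norm_trace_conjTranspose_mul_sq_le (X Y : Matrix m n ℂ) :
    ‖(Xᴴ * Y).trace‖ ^ 2 ≤ frobSq X * frobSq Y := by
  rw [trace_conjTranspose_mul, frobSq_eq_sum_prod, frobSq_eq_sum_prod]
  exact norm_sum_star_mul_sq_le _ _

theorem sum_eigenvalues_conjTranspose_mul_self (X : Matrix d d ℂ) :
    ∑ i, (Matrix.isHermitian_conjTranspose_mul_self X).eigenvalues i = frobSq X := by
  have h := (Matrix.isHermitian_conjTranspose_mul_self X).trace_eq_sum_eigenvalues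
  rw [trace_conjTranspose_mul_self] at h
  simpa using congr_arg Complex.re h.symm

theorem frobSq_le_traceNorm_sq (X : Matrix d d ℂ) : frobSq X ≤ traceNorm X ^ 2 := by
  rw [← sum_eigenvalues_conjTranspose_mul_self, traceNorm]
  refine le_trans (le_of_eq ?_) (Finset.sum_sq_le_sq_sum_of_nonneg fun i _ => Real.sqrt_nonneg _)
  exact Finset.sum_congr rfl fun i _ => (Real.sq_sqrt
    ((Matrix.posSemidef_conjTranspose_mul_self X).eigenvalues_nonneg i)).symm

theorem traceNorm_nonneg (X : Matrix d d ℂ) : 0 ≤ traceNorm X :=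
  Finset.sum_nonneg fun _ _ => Real.sqrt_nonneg _

/-- The eigenvalues of X†X satisfy λ² = λ, so the square roots change nothing. -/
theorem traceNorm_of_projection {X : Matrix d d ℂ} (hX : Xᴴ = X) (hXX : X * X = X) :
    traceNorm X = frobSq X := by
  rw [← sum_eigenvalues_conjTranspose_mul_self, traceNorm]
  refine Finset.sum_congr rfl fun i _ => ?_
  set hA := Matrix.isHermitian_conjTranspose_mul_self X
  have hP : (Xᴴ * X) * (Xᴴ * X) = Xᴴ * X := by rw [hX, hXX, hXX]
  have h := hA.mulVec_eigenvectorBasis i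
  have h2 := congr_arg ((Xᴴ * X) *ᵥ ·) h
  simp only [Matrix.mulVec_mulVec, hP, Matrix.mulVec_smul] at h2
  rw [h] at h2
  have hne : hA.eigenvectorBasis i ≠ 0 := fun h0 => by
    have := hA.eigenvectorBasis.orthonormal.1 i
    rw [h0, norm_zero] at this
    exact zero_ne_one this
  obtain ⟨j, hj⟩ : ∃ j, hA.eigenvectorBasis i j ≠ 0 := by
    by_contra hcon
    push Not at hcon
    exact hne (PiLp.ext hcon)
  have h3 := congr_fun h2 j
  simp only [Pi.smul_apply, Complex.real_smul] at h3
  have h4 : (hA.eigenvalues i : ℂ) = (hA.eigenvalues i : ℂ) * (hA.eigenvalues i : ℂ) := by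
    apply mul_right_cancel₀ hj
    rw [mul_assoc]
    exact h3
  have h5 : hA.eigenvalues i = hA.eigenvalues i * hA.eigenvalues i := by exact_mod_cast h4
  rw [Real.sqrt_eq_iff_mul_self_eq, ← h5]
  · exact (Matrix.posSemidef_conjTranspose_mul_self X).eigenvalues_nonneg i
  · exact (Matrix.posSemidef_conjTranspose_mul_self X).eigenvalues_nonneg i

end TraceNorm

/-! ### From the diamond distance to a single Kraus operator -/

section Diamond

variable {n a : ℕ}

/-- The Kraus operator of `r` as a map from the input register. -/
def isoKraus (A : Program n a) (r : List (Fin 2)) :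
    Matrix (Fin n ⊕ Fin a → Fin 2) (Fin n → Fin 2) ℂ :=
  A.kraus r * appendZeros n a

theorem hasSum_frobSq (A : AdaptiveCircuit n a) :
    HasSum (fun r : A.toProgram.Outcome => frobSq (isoKraus A.toProgram r.1)) (2 ^ n) := by
  have h := A.terminates.map (Matrix.traceAddMonoidHom (Fin n → Fin 2) ℂ)
    (continuous_id.matrix_trace)
  have h2 := h.mapL Complex.reCLM
  convert h2 using 1
  · funext r
    simp only [Function.comp, Matrix.traceAddMonoidHom_apply]
    change _ = ((isoKraus A.toProgram r.1)ᴴ * isoKraus A.toProgram r.1).trace.re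
    rw [trace_conjTranspose_mul_self, Complex.ofReal_re]
  · simp only [Matrix.traceAddMonoidHom_apply, Matrix.trace_one, Fintype.card_fun, Fintype.card_fin,
      Complex.reCLM_apply]
    exact_mod_cast (Complex.ofReal_re (2 ^ n)).symm

theorem mul_single_mul_apply {m d : Type} [Fintype d] [DecidableEq d] (V : Matrix m d ℂ) (c : ℂ)
    (i j : d) (x x' : m) :
    (V * Matrix.single i j c * Vᴴ) x x' = V x i * c * star (V x' j) := by
  rw [Matrix.mul_apply, Finset.sum_eq_single j]
  · rw [Matrix.mul_single_apply_same, Matrix.conjTranspose_apply]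
  · intro k _ hk
    rw [Matrix.mul_single_apply_of_ne _ _ _ _ _ hk, zero_mul]
  · simp

theorem hasSum_channel_single (A : AdaptiveCircuit n a) (c : ℂ) (i j : Fin n → Fin 2)
    (x x' : Fin n ⊕ Fin a → Fin 2) :
    HasSum (fun r : A.toProgram.Outcome =>
      isoKraus A.toProgram r.1 x i * c * star (isoKraus A.toProgram r.1 x' j))
      (A.channel (Matrix.single i j c) x x') := by
  have hterm : ∀ r : A.toProgram.Outcome, A.kraus r.1 *
      (appendZeros n a * (Matrix.single i j c) * (appendZeros n a)ᴴ) * (A.kraus r.1)ᴴ =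
      isoKraus A.toProgram r.1 * Matrix.single i j c * (isoKraus A.toProgram r.1)ᴴ := by
    intro r
    simp only [isoKraus, Matrix.conjTranspose_mul, Matrix.mul_assoc]
  have hsum : HasSum (fun r : A.toProgram.Outcome => isoKraus A.toProgram r.1 *
      Matrix.single i j c * (isoKraus A.toProgram r.1)ᴴ) (A.channel (Matrix.single i j c)) := by
    rw [AdaptiveCircuit.channel]
    simp only [hterm]
    refine Summable.hasSum (Pi.summable.2 fun x => Pi.summable.2 fun x' => ?_)
    refine Summable.of_norm_bounded (((hasSum_frobSq A).summable).mul_left ‖c‖) fun r => ?_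
    rw [mul_single_mul_apply, norm_mul, norm_mul, norm_star]
    have h1 := norm_apply_sq_le_frobSq (isoKraus A.toProgram r.1) x i
    have h2 := norm_apply_sq_le_frobSq (isoKraus A.toProgram r.1) x' j
    have h3 : ‖isoKraus A.toProgram r.1 x i‖ * ‖isoKraus A.toProgram r.1 x' j‖ ≤
        frobSq (isoKraus A.toProgram r.1) := by
      nlinarith [sq_nonneg (‖isoKraus A.toProgram r.1 x i‖ - ‖isoKraus A.toProgram r.1 x' j‖)]
    calc _ = ‖c‖ * (‖isoKraus A.toProgram r.1 x i‖ * ‖isoKraus A.toProgram r.1 x' j‖) := by ring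
      _ ≤ _ := by gcongr
  have := Pi.hasSum.1 (Pi.hasSum.1 hsum x) x'
  simpa only [mul_single_mul_apply] using this

/-- The maximally entangled state of the input register and a reference. -/
def maxEntangled {k : ℕ} {d : Type} [DecidableEq d] (e : Fin k ≃ d) :
    Matrix (Fin k × d) (Fin k × d) ℂ :=
  Matrix.of fun p q => if e p.1 = p.2 ∧ e q.1 = q.2 then (k : ℂ)⁻¹ else 0

theorem traceNorm_maxEntangled {k : ℕ} {d : Type} [Fintype d] [DecidableEq d] (hk : 0 < k)
    (e : Fin k ≃ d) : traceNorm (maxEntangled e) = 1 := by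
  have hk' : (k : ℂ) ≠ 0 := by exact_mod_cast hk.ne'
  have hk'' : (k : ℝ) ≠ 0 := by exact_mod_cast hk.ne'
  rw [traceNorm_of_projection]
  · rw [frobSq_eq_sum_prod]
    have : ∀ p : (Fin k × d) × (Fin k × d), ‖maxEntangled e p.1 p.2‖ ^ 2 =
        (if e p.1.1 = p.1.2 then (k : ℝ)⁻¹ else 0) *
          (if e p.2.1 = p.2.2 then (k : ℝ)⁻¹ else 0) := by
      intro p
      by_cases h1 : e p.1.1 = p.1.2 <;> by_cases h2 : e p.2.1 = p.2.2 <;>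
        simp [maxEntangled, h1, h2, sq]
    simp only [this]
    rw [Fintype.sum_prod_type]
    simp [Fintype.sum_prod_type, hk'']
  · ext p q
    rw [Matrix.conjTranspose_apply]
    by_cases h1 : e p.1 = p.2 <;> by_cases h2 : e q.1 = q.2 <;> simp [maxEntangled, h1, h2]
  · ext p q
    rw [Matrix.mul_apply, Fintype.sum_prod_type]
    by_cases h1 : e p.1 = p.2 <;> by_cases h2 : e q.1 = q.2 <;>
      simp [maxEntangled, h1, h2, hk']

/-- Apply id ⊗ (𝒜 - 𝒰) to the maximally entangled state and take the expectation in the vectorized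
target isometry. The result is 2⁻ⁿ ∑|tr(U†G_r)|² - 2ⁿ, and Cauchy–Schwarz bounds it by 2ⁿ ε, as the
Frobenius norm is at most the trace norm. -/
theorem Implements.le_tsum {A : AdaptiveCircuit n a} {U : Op (Fin n)}
    (hU : U ∈ Matrix.unitaryGroup (Fin n → Fin 2) ℂ) {ε : ℝ} (hε : 0 ≤ ε)
    (hA : A.Implements U ε) :
    ∃ s : ℝ, HasSum (fun r : A.toProgram.Outcome =>
      ‖(Uᴴ * reducedKraus A.toProgram r.1).trace‖ ^ 2) s ∧ (2 ^ n) ^ 2 * (1 - ε) ≤ s := by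
  have hk : (0 : ℝ) < 2 ^ n := by positivity
  have hkC : (2 ^ n : ℂ) ≠ 0 := by positivity
  obtain ⟨e⟩ : Nonempty (Fin (2 ^ n) ≃ (Fin n → Fin 2)) :=
    ⟨(Fintype.equivFinOfCardEq (by simp)).symm⟩
  set Φ : Op (Fin n) → Op (Fin n ⊕ Fin a) := fun ρ => A.channel ρ - idealChannel a U ρ
  set Y := ampliation (2 ^ n) Φ (maxEntangled e)
  have hY : traceNorm Y ≤ ε := by
    have h1 : ENNReal.ofReal (traceNorm Y) ≤ diamondNorm Φ :=
      le_iSup₂_of_le (f := fun (k : ℕ) (X : Matrix (Fin k × (Fin n → Fin 2))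
        (Fin k × (Fin n → Fin 2)) ℂ) => ⨆ (_ : traceNorm X ≤ 1),
          ENNReal.ofReal (traceNorm (ampliation k Φ X))) (2 ^ n) (maxEntangled e)
        (le_iSup_of_le (traceNorm_maxEntangled (by positivity) e).le le_rfl)
    exact (ENNReal.ofReal_le_ofReal_iff hε).1 (h1.trans hA)
  set W := appendZeros n a * U
  have hWW : Wᴴ * W = 1 := by
    rw [Matrix.conjTranspose_mul, Matrix.mul_assoc, ← Matrix.mul_assoc (appendZeros n a)ᴴ,
      conjTranspose_appendZeros_mul_self, Matrix.one_mul]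
    exact (Matrix.mem_unitaryGroup_iff').1 hU
  have hWf : frobSq W = 2 ^ n := by
    have := trace_conjTranspose_mul_self W
    rw [hWW, Matrix.trace_one] at this
    have h2 := congr_arg Complex.re this
    rw [Complex.ofReal_re] at h2
    rw [← h2]
    simp only [Fintype.card_fun, Fintype.card_fin]
    exact_mod_cast Complex.ofReal_re (2 ^ n)
  -- This is `W` as an unnormalized vector, of squared norm 2ⁿ.
  set ψ : Fin (2 ^ n) × (Fin n ⊕ Fin a → Fin 2) → ℂ := fun p => W p.2 (e p.1)
  have hψ : ∑ p, ‖ψ p‖ ^ 2 = 2 ^ n := by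
    rw [← hWf, frobSq_eq_sum_prod, Fintype.sum_prod_type, Fintype.sum_prod_type_right]
    exact e.sum_comp fun i => ∑ x, ‖W x i‖ ^ 2
  have htr : ∀ V : Matrix (Fin n ⊕ Fin a → Fin 2) (Fin n → Fin 2) ℂ,
      ∑ p, star (ψ p) * V p.2 (e p.1) = (Wᴴ * V).trace := by
    intro V
    rw [trace_conjTranspose_mul, Fintype.sum_prod_type, Fintype.sum_prod_type_right]
    exact e.sum_comp fun i => ∑ x, star (W x i) * V x i
  have hblock : ∀ u v, (Matrix.of fun i j => maxEntangled e (u, i) (v, j)) =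
      Matrix.single (e u) (e v) (2 ^ n : ℂ)⁻¹ := by
    intro u v
    ext i j
    simp [maxEntangled, Matrix.single]
  have hid : ∀ u v x x', idealChannel a U (Matrix.single u v (2 ^ n : ℂ)⁻¹) x x' =
      W x u * (2 ^ n : ℂ)⁻¹ * star (W x' v) := by
    intro u v x x'
    rw [← mul_single_mul_apply]
    simp only [idealChannel, W, Matrix.conjTranspose_mul, Matrix.mul_assoc]
  have hYapp : ∀ p q, Y p q = A.channel (Matrix.single (e p.1) (e q.1) (2 ^ n : ℂ)⁻¹) p.2 q.2 -
      W p.2 (e p.1) * (2 ^ n : ℂ)⁻¹ * star (W q.2 (e q.1)) := by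
    intro p q
    rw [← hid]
    simp only [Y, ampliation, Matrix.of_apply, Φ, Matrix.sub_apply]
    rw [hblock]
  have hquad : ∀ V : Matrix (Fin n ⊕ Fin a → Fin 2) (Fin n → Fin 2) ℂ,
      ∑ p, ∑ q, star (ψ p) * (V p.2 (e p.1) * (2 ^ n : ℂ)⁻¹ * star (V q.2 (e q.1))) * ψ q =
        (2 ^ n : ℂ)⁻¹ * ((‖(Wᴴ * V).trace‖ ^ 2 : ℝ) : ℂ) := by
    intro V
    rw [Complex.ofReal_pow, ← Complex.mul_conj', ← htr, map_sum, Finset.sum_mul_sum,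
      Finset.mul_sum]
    refine Finset.sum_congr rfl fun p _ => ?_
    rw [Finset.mul_sum]
    refine Finset.sum_congr rfl fun q _ => ?_
    simp only [map_mul, ← starRingEnd_apply, Complex.conj_conj]
    ring
  set S := ∑ p, ∑ q, star (ψ p) * Y p q * ψ q
  have hS : ‖S‖ ≤ 2 ^ n * ε := by
    have h1 : S = ∑ p : (Fin (2 ^ n) × (Fin n ⊕ Fin a → Fin 2)) ×
        (Fin (2 ^ n) × (Fin n ⊕ Fin a → Fin 2)), star (ψ p.1 * star (ψ p.2)) * Y p.1 p.2 := by
      rw [Fintype.sum_prod_type]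
      refine Finset.sum_congr rfl fun p _ => Finset.sum_congr rfl fun q _ => ?_
      rw [star_mul', star_star]
      ring
    have h2 := norm_sum_star_mul_sq_le (fun p : (Fin (2 ^ n) × (Fin n ⊕ Fin a → Fin 2)) ×
        (Fin (2 ^ n) × (Fin n ⊕ Fin a → Fin 2)) => ψ p.1 * star (ψ p.2)) fun p => Y p.1 p.2
    rw [← h1, ← frobSq_eq_sum_prod] at h2
    have h3 : ∑ p : (Fin (2 ^ n) × (Fin n ⊕ Fin a → Fin 2)) ×
        (Fin (2 ^ n) × (Fin n ⊕ Fin a → Fin 2)), ‖ψ p.1 * star (ψ p.2)‖ ^ 2 = (2 ^ n) ^ 2 := by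
      simp only [norm_mul, norm_star, mul_pow]
      rw [Fintype.sum_prod_type, sq, ← hψ, Finset.sum_mul_sum]
    rw [h3] at h2
    have h4 : frobSq Y ≤ ε ^ 2 := (frobSq_le_traceNorm_sq Y).trans
      (pow_le_pow_left₀ (traceNorm_nonneg Y) hY 2)
    refine le_of_sq_le_sq ?_ (by positivity)
    rw [mul_pow]
    exact h2.trans (by gcongr)
  have hhas : HasSum (fun r : A.toProgram.Outcome => (2 ^ n : ℂ)⁻¹ *
      ((‖(Wᴴ * isoKraus A.toProgram r.1).trace‖ ^ 2 : ℝ) : ℂ)) (S + 2 ^ n) := by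
    have h1 : S + 2 ^ n = ∑ p, ∑ q, star (ψ p) *
        A.channel (Matrix.single (e p.1) (e q.1) (2 ^ n : ℂ)⁻¹) p.2 q.2 * ψ q := by
      have h2 : (2 ^ n : ℂ) = ∑ p, ∑ q, star (ψ p) *
          (W p.2 (e p.1) * (2 ^ n : ℂ)⁻¹ * star (W q.2 (e q.1))) * ψ q := by
        rw [hquad, hWW, Matrix.trace_one]
        simp only [Fintype.card_fun, Fintype.card_fin]
        push_cast
        rw [norm_pow, Complex.norm_ofNat]
        push_cast
        field_simp
      refine (congr_arg (S + ·) h2).trans ?_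
      rw [← Finset.sum_add_distrib]
      refine Finset.sum_congr rfl fun p _ => ?_
      rw [← Finset.sum_add_distrib]
      refine Finset.sum_congr rfl fun q _ => ?_
      rw [hYapp]
      ring
    rw [h1]
    simp only [← hquad]
    refine hasSum_sum fun p _ => hasSum_sum fun q _ => ?_
    exact ((hasSum_channel_single A _ _ _ _ _).mul_left _).mul_right _
  have hre := (hhas.mapL Complex.reCLM).mul_left (2 ^ n : ℝ)
  refine ⟨2 ^ n * (S + 2 ^ n).re, ?_, ?_⟩
  · refine Eq.mp (congr_arg (HasSum · _) (funext fun r => ?_)) hre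
    have hW' : Wᴴ * isoKraus A.toProgram r.1 = Uᴴ * reducedKraus A.toProgram r.1 := by
      simp only [W, Matrix.conjTranspose_mul, reducedKraus, isoKraus, Matrix.mul_assoc]
    rw [hW', show ((2 : ℂ) ^ n)⁻¹ = (((2 : ℝ) ^ n)⁻¹ : ℝ) by push_cast; rfl,
      ← Complex.ofReal_mul, Complex.reCLM_apply, Complex.ofReal_re]
    field_simp
  · have h1 : (S + 2 ^ n).re = S.re + 2 ^ n := by
      rw [Complex.add_re, show (2 : ℂ) ^ n = ((2 ^ n : ℝ) : ℂ) by push_cast; rfl,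
        Complex.ofReal_re]
    have h2 := (abs_le.1 ((Complex.abs_re_le_norm S).trans hS)).1
    rw [h1]
    nlinarith

theorem frobSq_reducedKraus_le (A : Program n a) (r : List (Fin 2)) :
    frobSq (reducedKraus A r) ≤ frobSq (isoKraus A r) := by
  have h : ∀ y, ∑ z, ‖reducedKraus A r y z‖ ^ 2 = ∑ z, ‖isoKraus A r (Sum.elim y 0) z‖ ^ 2 :=
    fun y => by simp only [reducedKraus, conjTranspose_appendZeros_mul_apply, isoKraus]
  have hinj : Function.Injective fun y : Fin n → Fin 2 =>
      (Sum.elim y 0 : Fin n ⊕ Fin a → Fin 2) := fun y y' hy =>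
    funext fun i => congr_fun hy (Sum.inl i)
  unfold frobSq
  simp only [h]
  rw [← Finset.sum_image (f := fun x => ∑ z, ‖isoKraus A r x z‖ ^ 2) hinj.injOn]
  exact Finset.sum_le_sum_of_subset_of_nonneg (Finset.subset_univ _) fun _ _ _ => by positivity

/-- The worst-case count is at least the count for the maximally mixed input, whose outcome
probabilities are squared Frobenius norms. -/
theorem prob_maximallyMixed (A : AdaptiveCircuit n a) (r : A.toProgram.Outcome) :
    A.prob ((2 ^ n : ℂ)⁻¹ • 1) r = frobSq (isoKraus A.toProgram r.1) / 2 ^ n := by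
  have h : (A.kraus r.1)ᴴ * A.kraus r.1 *
      (appendZeros n a * ((2 ^ n : ℂ)⁻¹ • (1 : Op (Fin n))) * (appendZeros n a)ᴴ) =
      (2 ^ n : ℂ)⁻¹ • ((A.kraus r.1)ᴴ * isoKraus A.toProgram r.1 * (appendZeros n a)ᴴ) := by
    simp only [isoKraus, Matrix.mul_smul, Matrix.smul_mul, Matrix.mul_one, Matrix.mul_assoc]
  rw [AdaptiveCircuit.prob, h, Matrix.trace_smul, Matrix.trace_mul_comm, ← Matrix.mul_assoc,
    ← Matrix.conjTranspose_mul]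
  change ((2 ^ n : ℂ)⁻¹ • ((isoKraus A.toProgram r.1)ᴴ * isoKraus A.toProgram r.1).trace).re = _
  rw [trace_conjTranspose_mul_self, show ((2 : ℂ) ^ n)⁻¹ = (((2 : ℝ) ^ n)⁻¹ : ℝ) by push_cast; rfl,
    smul_eq_mul, ← Complex.ofReal_mul, Complex.ofReal_re]
  field_simp

theorem tsum_prob_le_expectedTCount (A : AdaptiveCircuit n a) :
    ∑' r : A.toProgram.Outcome, ENNReal.ofReal (frobSq (isoKraus A.toProgram r.1) / 2 ^ n) *
      (A.tCount r.1 : ℝ≥0∞) ≤ A.expectedTCount := by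
  simp only [← prob_maximallyMixed]
  refine le_iSup₂_of_le (f := fun (ρ : Op (Fin n)) (_ : ρ.PosSemidef ∧ ρ.trace = 1) =>
    ∑' r : A.toProgram.Outcome, ENNReal.ofReal (A.prob ρ r) * (A.tCount r.1 : ℝ≥0∞))
    ((2 ^ n : ℂ)⁻¹ • 1) ⟨?_, ?_⟩ le_rfl
  · exact Matrix.PosSemidef.one.smul (by positivity)
  · rw [Matrix.trace_smul, Matrix.trace_one]
    simp

/-- `G` is, up to a scalar and up to a relative error `2 ε`, the operator `U`. -/
def IsClose (U G : Op (Fin n)) (ε : ℝ) : Prop :=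
  (1 - 2 * ε) * 2 ^ n * frobSq G < ‖(Uᴴ * G).trace‖ ^ 2

/-- A circuit with small expected `T`-count has a Kraus operator with small `T`-count that is
close to the target. -/
theorem Implements.exists_isClose {A : AdaptiveCircuit n a} {U : Op (Fin n)}
    (hU : U ∈ Matrix.unitaryGroup (Fin n → Fin 2) ℂ) {ε : ℝ} (hε : 0 < ε) (hε' : ε ≤ 1 / 2)
    (hA : A.Implements U ε) {L : ℝ} (hT : A.expectedTCount < ENNReal.ofReal L) :
    ∃ r : List (Fin 2), (A.tCount r : ℝ) ≤ 2 * L ∧ IsClose U (reducedKraus A.toProgram r) ε := by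
  have hL : 0 < L := by
    by_contra h
    rw [ENNReal.ofReal_of_nonpos (not_lt.1 h)] at hT
    exact not_lt_zero hT
  by_contra hcon
  push Not at hcon
  obtain ⟨s, hs, hs'⟩ := Implements.le_tsum hU hε.le hA
  have hk : (0 : ℝ) < 2 ^ n := by positivity
  set p : A.toProgram.Outcome → ℝ := fun r => frobSq (isoKraus A.toProgram r.1) / 2 ^ n
  have hp0 : ∀ r, 0 ≤ p r := fun r => div_nonneg (frobSq_nonneg _) hk.le
  have hp : HasSum p 1 := by
    have := (hasSum_frobSq A).div_const (2 ^ n)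
    rwa [div_self hk.ne'] at this
  have hlt := (tsum_prob_le_expectedTCount A).trans_lt hT
  have hterm : ∀ r : A.toProgram.Outcome, ENNReal.ofReal (p r) * (A.tCount r.1 : ℝ≥0∞) =
      ENNReal.ofReal (p r * A.tCount r.1) := fun r => by
    rw [ENNReal.ofReal_mul (hp0 r), ENNReal.ofReal_natCast]
  change ∑' r : A.toProgram.Outcome, ENNReal.ofReal (p r) * (A.tCount r.1 : ℝ≥0∞) < _ at hlt
  simp only [hterm] at hlt
  have hpT0 : ∀ r : A.toProgram.Outcome, 0 ≤ p r * A.tCount r.1 := fun r =>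
    mul_nonneg (hp0 r) (Nat.cast_nonneg _)
  have hsum : Summable fun r : A.toProgram.Outcome => p r * A.tCount r.1 := by
    have := ENNReal.summable_toReal (hlt.trans_le le_top).ne
    simpa only [ENNReal.toReal_ofReal (hpT0 _)] using this
  rw [← ENNReal.ofReal_tsum_of_nonneg hpT0 hsum, ENNReal.ofReal_lt_ofReal_iff hL] at hlt
  -- For T_r ≤ 2L this is the failure of closeness. For T_r > 2L it is Cauchy–Schwarz, the missing
  -- 2ε being paid by εT_r/L. Summed over r, the right side stays below 4ⁿ(1-ε) because the mean of
  -- T_r is below L.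
  have hbound : ∀ r : A.toProgram.Outcome,
      ‖(Uᴴ * reducedKraus A.toProgram r.1).trace‖ ^ 2 ≤
        (2 ^ n) ^ 2 * ((1 - 2 * ε) * p r + ε / L * (p r * A.tCount r.1)) := by
    intro r
    have hfr := frobSq_reducedKraus_le A.toProgram r.1
    have hpr : frobSq (isoKraus A.toProgram r.1) = 2 ^ n * p r := by
      simp only [p]; field_simp
    rw [hpr] at hfr
    rcases le_or_gt (A.tCount r.1 : ℝ) (2 * L) with h | h
    · have h1 := hcon r.1 h
      rw [IsClose, not_lt] at h1
      calc _ ≤ (1 - 2 * ε) * 2 ^ n * frobSq (reducedKraus A.toProgram r.1) := h1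
        _ ≤ (1 - 2 * ε) * 2 ^ n * (2 ^ n * p r) :=
          mul_le_mul_of_nonneg_left hfr (mul_nonneg (by linarith) hk.le)
        _ = (2 ^ n) ^ 2 * ((1 - 2 * ε) * p r) := by ring
        _ ≤ _ := by
          gcongr
          have := hpT0 r
          have : 0 ≤ ε / L * (p r * A.tCount r.1) := by positivity
          linarith
    · have hUf : frobSq U = 2 ^ n := by
        have := trace_conjTranspose_mul_self U
        rw [show Uᴴ * U = 1 from (Matrix.mem_unitaryGroup_iff').1 hU, Matrix.trace_one] at this
        have h2 := congr_arg Complex.re this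
        rw [Complex.ofReal_re] at h2
        rw [← h2]
        simp only [Fintype.card_fun, Fintype.card_fin]
        exact_mod_cast Complex.ofReal_re (2 ^ n)
      have h1 := norm_trace_conjTranspose_mul_sq_le U (reducedKraus A.toProgram r.1)
      rw [hUf] at h1
      have h2 : 2 * ε ≤ ε / L * A.tCount r.1 := by
        rw [div_mul_eq_mul_div, le_div_iff₀ hL]
        nlinarith
      calc _ ≤ 2 ^ n * (2 ^ n * p r) := h1.trans (by gcongr)
        _ = (2 ^ n) ^ 2 * ((1 - 2 * ε) * p r + 2 * ε * p r) := by ring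
        _ ≤ _ := by
          gcongr ?_ * (?_ + ?_)
          · exact le_rfl
          · linarith [mul_le_mul_of_nonneg_right h2 (hp0 r)]
  have htot := hasSum_le hbound hs (((hp.mul_left (1 - 2 * ε)).add
    (hsum.hasSum.mul_left (ε / L))).mul_left ((2 ^ n) ^ 2))
  have h1 : ε / L * ∑' r : A.toProgram.Outcome, p r * A.tCount r.1 < ε := by
    rw [div_mul_eq_mul_div, div_lt_iff₀ hL]
    exact mul_lt_mul_of_pos_left hlt hε
  have h2 : (2 ^ n) ^ 2 * (1 - ε) ≤ (2 ^ n) ^ 2 *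
      ((1 - 2 * ε) * 1 + ε / L * ∑' r : A.toProgram.Outcome, p r * A.tCount r.1) :=
    hs'.trans htot
  have h3 := le_of_mul_le_mul_left h2 (by positivity)
  linarith

end Diamond

/-! ### Sign matrices of small operator norm -/

section Net

variable {E : Type*} [NormedAddCommGroup E] [InnerProductSpace ℝ E] [FiniteDimensional ℝ E]

open scoped InnerProductSpace

-- A maximal 1-separated subset of the ball of radius 2 is a 1-net of it; its size is bounded by
-- packing balls of radius 1/2 into one of radius 5/2.
variable (E) in
theorem exists_net : ∃ T : Finset E, (∀ c ∈ T, ‖c‖ ≤ 2) ∧ T.card ≤ 5 ^ Module.finrank ℝ E ∧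
    ∀ x : E, ‖x‖ ≤ 2 → ∃ c ∈ T, ‖x - c‖ ≤ 1 := by
  classical
  let K : Set ℕ := {k | ∃ T : Finset E, T.card = k ∧ (∀ c ∈ T, ‖c‖ ≤ 2) ∧
    ∀ c ∈ T, ∀ d ∈ T, c ≠ d → 1 ≤ ‖c - d‖}
  have hbdd : BddAbove K := by
    refine ⟨5 ^ Module.finrank ℝ E, ?_⟩
    rintro k ⟨T, rfl, h1, h2⟩
    exact Besicovitch.card_le_of_separated T h1 h2
  obtain ⟨T, hT, h1, h2⟩ := Nat.sSup_mem (s := K) ⟨0, ∅, by simp⟩ hbdd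
  refine ⟨T, h1, Besicovitch.card_le_of_separated T h1 h2, fun x hx => ?_⟩
  by_contra! hcon
  have hxT : x ∉ T := fun h => by
    have := hcon x h
    norm_num at this
  have hmem : (insert x T).card ∈ K := by
    refine ⟨insert x T, rfl, ?_, ?_⟩
    · simpa using ⟨hx, h1⟩
    · intro c hc d hd hcd
      rw [Finset.mem_insert] at hc hd
      rcases hc with rfl | hc <;> rcases hd with rfl | hd
      · exact absurd rfl hcd
      · exact (hcon d hd).le
      · rw [norm_sub_rev]; exact (hcon c hc).le
      · exact h2 c hc d hd hcd
  have := le_csSup hbdd hmem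
  rw [Finset.card_insert_of_notMem hxT] at this
  omega

-- Vectors of length 2 are approximated within 1. Hence 2‖v‖ ≤ τ + ‖v‖ for the vectors v = f d, and
-- then 2‖f‖ ≤ τ + ‖f‖.
omit [FiniteDimensional ℝ E] in
theorem norm_le_of_net {T : Finset E} (hT : ∀ x : E, ‖x‖ ≤ 2 → ∃ c ∈ T, ‖x - c‖ ≤ 1)
    (f : E →L[ℝ] E) {τ : ℝ} (hτ : 0 ≤ τ) (h : ∀ c ∈ T, ∀ d ∈ T, ⟪c, f d⟫_ℝ ≤ τ) : ‖f‖ ≤ τ := by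
  have h1 : ∀ v : E, (∀ c ∈ T, ⟪c, v⟫_ℝ ≤ τ) → ‖v‖ ≤ τ := by
    intro v hv
    rcases eq_or_ne v 0 with rfl | hv0
    · simpa using hτ
    have hpos := norm_pos_iff.2 hv0
    obtain ⟨c, hc, hxc⟩ := hT ((2 / ‖v‖) • v) (by
      rw [norm_smul, norm_div, norm_norm, Real.norm_ofNat, div_mul_cancel₀ _ hpos.ne'])
    have e1 : ⟪(2 / ‖v‖) • v, v⟫_ℝ = 2 * ‖v‖ := by
      rw [real_inner_smul_left, real_inner_self_eq_norm_sq]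
      field_simp
    have e2 : ⟪(2 / ‖v‖) • v - c, v⟫_ℝ ≤ ‖v‖ :=
      (real_inner_le_norm _ _).trans (mul_le_of_le_one_left (norm_nonneg v) hxc)
    rw [inner_sub_left, e1] at e2
    linarith [hv c hc]
  have h2 : ‖f‖ ≤ (τ + ‖f‖) / 2 := by
    refine f.opNorm_le_bound (by positivity) fun x => ?_
    rcases eq_or_ne x 0 with rfl | hx0
    · simp
    have hpos := norm_pos_iff.2 hx0
    obtain ⟨d, hd, hxd⟩ := hT ((2 / ‖x‖) • x) (by
      rw [norm_smul, norm_div, norm_norm, Real.norm_ofNat, div_mul_cancel₀ _ hpos.ne'])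
    have e1 : ‖f ((2 / ‖x‖) • x)‖ ≤ τ + ‖f‖ := by
      have : f ((2 / ‖x‖) • x) = f d + f ((2 / ‖x‖) • x - d) := by
        rw [← map_add]; congr 1; abel
      rw [this]
      refine (norm_add_le _ _).trans (add_le_add (h1 _ fun c hc => h c hc d hd) ?_)
      exact (f.le_opNorm _).trans (mul_le_of_le_one_right (norm_nonneg f) hxd)
    rw [map_smul, norm_smul, norm_div, norm_norm, Real.norm_ofNat, div_mul_eq_mul_div,
      div_le_iff₀ hpos] at e1
    linarith
  linarith

end Net

/-! ### Random sign matrices: operator norm and Hamming packing. -/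

section Signs

/-- The sign `±1` of a bit. -/
def bsign (b : Bool) : ℝ := if b then 1 else -1

/-- Hoeffding's inequality for random signs. -/
theorem card_signs_le {J : Type} [Fintype J] [DecidableEq J] (w : J → ℝ) {V τ : ℝ} (hV : 0 < V)
    (hw : ∑ p, w p ^ 2 ≤ V) (hτ : 0 ≤ τ) :
    ((Finset.univ.filter fun s : J → Bool => τ ≤ ∑ p, bsign (s p) * w p).card : ℝ) ≤
      2 ^ Fintype.card J * Real.exp (-(τ ^ 2 / (2 * V))) := by
  -- The optimal parameter in the exponential Markov inequality.
  set t := τ / V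
  have ht : 0 ≤ t := by positivity
  have h1 : ∑ s : J → Bool, Real.exp (t * ∑ p, bsign (s p) * w p) ≤
      2 ^ Fintype.card J * Real.exp (t ^ 2 * V / 2) := by
    have e1 : ∀ s : J → Bool, Real.exp (t * ∑ p, bsign (s p) * w p) =
        ∏ p, Real.exp (t * (bsign (s p) * w p)) := fun s => by
      rw [Finset.mul_sum, Real.exp_sum]
    have e2 : ∑ s : J → Bool, ∏ p, Real.exp (t * (bsign (s p) * w p)) =
        ∏ p, ∑ b : Bool, Real.exp (t * (bsign b * w p)) := by
      rw [Finset.prod_univ_sum, Fintype.piFinset_univ]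
    have e3 : ∀ p, ∑ b : Bool, Real.exp (t * (bsign b * w p)) ≤
        2 * Real.exp ((t * w p) ^ 2 / 2) := fun p => by
      have := Real.cosh_le_exp_half_sq (t * w p)
      rw [Real.cosh_eq] at this
      rw [Fintype.sum_bool]
      simp only [bsign, if_true, Bool.false_eq_true, if_false, one_mul, neg_mul, mul_neg]
      linarith
    simp only [e1]
    rw [e2]
    refine (Finset.prod_le_prod (fun p _ => Finset.sum_nonneg fun _ _ => (Real.exp_pos _).le)
      fun p _ => e3 p).trans ?_
    rw [Finset.prod_mul_distrib, Finset.prod_const, Finset.card_univ, ← Real.exp_sum]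
    gcongr
    simp only [mul_pow]
    rw [← Finset.sum_div, ← Finset.mul_sum]
    gcongr
  have h2 : ((Finset.univ.filter fun s : J → Bool => τ ≤ ∑ p, bsign (s p) * w p).card : ℝ) *
      Real.exp (t * τ) ≤ ∑ s : J → Bool, Real.exp (t * ∑ p, bsign (s p) * w p) := by
    rw [← nsmul_eq_mul, ← Finset.sum_const]
    refine (Finset.sum_le_sum fun s hs => ?_).trans
      (Finset.sum_le_sum_of_subset_of_nonneg (Finset.filter_subset _ _)
        fun _ _ _ => (Real.exp_pos _).le)
    have := (Finset.mem_filter.1 hs).2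
    gcongr
  have h3 := h2.trans h1
  rw [← le_div_iff₀ (Real.exp_pos _), mul_div_assoc, ← Real.exp_sub] at h3
  refine h3.trans_eq ?_
  congr 2
  simp only [t]
  field_simp
  ring

variable {L : Type} [Fintype L] [DecidableEq L]

/-- The antisymmetric matrix with blocks `0, S, -Sᵀ, 0`, where `S` is a matrix of signs. -/
def signMatrix (s : L × L → Bool) : Matrix (L ⊕ L) (L ⊕ L) ℝ :=
  Matrix.fromBlocks 0 (Matrix.of fun l l' => bsign (s (l, l')))
    (-(Matrix.of fun l l' => bsign (s (l, l')))ᵀ) 0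

omit [Fintype L] [DecidableEq L] in
theorem signMatrix_transpose (s : L × L → Bool) : (signMatrix s)ᵀ = -signMatrix s := by
  simp [signMatrix, Matrix.fromBlocks_transpose, Matrix.fromBlocks_neg]

open scoped Matrix.Norms.L2Operator InnerProductSpace

theorem inner_signMatrix (s : L × L → Bool) (c d : EuclideanSpace ℝ (L ⊕ L)) :
    ⟪c, Matrix.toEuclideanCLM (𝕜 := ℝ) (signMatrix s) d⟫_ℝ = ∑ p : L × L, bsign (s p) *
      (c (Sum.inl p.1) * d (Sum.inr p.2) - c (Sum.inr p.2) * d (Sum.inl p.1)) := by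
  have h : ∀ i, (Matrix.toEuclideanCLM (𝕜 := ℝ) (signMatrix s) d) i =
      ∑ j, signMatrix s i j * d j := fun i => by
    rw [Matrix.ofLp_toEuclideanCLM]
    rfl
  simp only [PiLp.inner_apply, h]
  simp only [Fintype.sum_sum_type, signMatrix, Matrix.fromBlocks_apply₁₁,
    Matrix.fromBlocks_apply₁₂, Matrix.fromBlocks_apply₂₁, Matrix.fromBlocks_apply₂₂,
    Matrix.zero_apply, zero_mul, Finset.sum_const_zero, zero_add, add_zero, Matrix.of_apply,
    Matrix.neg_apply, Matrix.transpose_apply, RCLike.inner_apply, conj_trivial, mul_sub,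
    Finset.sum_sub_distrib, Fintype.sum_prod_type, Finset.sum_mul]
  rw [sub_eq_add_neg]
  congr 1
  · exact Finset.sum_congr rfl fun l _ => Finset.sum_congr rfl fun l' _ => by ring
  · rw [Finset.sum_comm, ← Finset.sum_neg_distrib]
    refine Finset.sum_congr rfl fun l _ => ?_
    rw [← Finset.sum_neg_distrib]
    exact Finset.sum_congr rfl fun l' _ => by ring

/-- At most a quarter of the sign matrices have large operator norm. -/
theorem card_signMatrix_norm_le [Nonempty L] :
    ((Finset.univ.filter fun s : L × L → Bool =>
      20 * √(2 * Fintype.card L) < ‖signMatrix s‖).card : ℝ) ≤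
      2 ^ (Fintype.card L ^ 2) / 4 := by
  classical
  obtain ⟨T, hT2, hTc, hT⟩ := exists_net (EuclideanSpace ℝ (L ⊕ L))
  rw [finrank_euclideanSpace, Fintype.card_sum, ← two_mul] at hTc
  set D := 2 * Fintype.card L
  have hD : 1 ≤ D := by
    have := Fintype.card_pos (α := L)
    omega
  set τ : ℝ := 20 * √(2 * Fintype.card L)
  have hτ : 0 ≤ τ := by positivity
  have hτ2 : τ ^ 2 = 400 * D := by
    simp only [τ, D]
    rw [mul_pow, Real.sq_sqrt (by positivity)]
    push_cast
    ring
  let w : EuclideanSpace ℝ (L ⊕ L) → EuclideanSpace ℝ (L ⊕ L) → L × L → ℝ := fun c d p =>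
    c (Sum.inl p.1) * d (Sum.inr p.2) - c (Sum.inr p.2) * d (Sum.inl p.1)
  -- 32 = 2 · 4 · 4: the square of a difference costs the factor 2, and net points have squared norm
  -- at most 4.
  have hw : ∀ c ∈ T, ∀ d ∈ T, ∑ p, w c d p ^ 2 ≤ 32 := by
    intro c hc d hd
    have hc2 : ∑ l, c (Sum.inl l) ^ 2 + ∑ l, c (Sum.inr l) ^ 2 ≤ 4 := by
      have h1 := EuclideanSpace.real_norm_sq_eq c
      rw [Fintype.sum_sum_type] at h1
      rw [← h1]
      nlinarith [hT2 c hc, norm_nonneg c]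
    have hd2 : ∑ l, d (Sum.inl l) ^ 2 + ∑ l, d (Sum.inr l) ^ 2 ≤ 4 := by
      have h1 := EuclideanSpace.real_norm_sq_eq d
      rw [Fintype.sum_sum_type] at h1
      rw [← h1]
      nlinarith [hT2 d hd, norm_nonneg d]
    have hle : ∑ p, w c d p ^ 2 ≤ 2 * ((∑ l, c (Sum.inl l) ^ 2) * ∑ l, d (Sum.inr l) ^ 2) +
        2 * ((∑ l, d (Sum.inl l) ^ 2) * ∑ l, c (Sum.inr l) ^ 2) := by
      rw [Finset.sum_mul_sum, Finset.sum_mul_sum, ← Fintype.sum_prod_type'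
        (fun l l' => c (Sum.inl l) ^ 2 * d (Sum.inr l') ^ 2), ← Fintype.sum_prod_type'
        (fun l l' => d (Sum.inl l) ^ 2 * c (Sum.inr l') ^ 2), Finset.mul_sum, Finset.mul_sum,
        ← Finset.sum_add_distrib]
      refine Finset.sum_le_sum fun p _ => ?_
      simp only [w]
      nlinarith [sq_nonneg (c (Sum.inl p.1) * d (Sum.inr p.2) +
        c (Sum.inr p.2) * d (Sum.inl p.1))]
    have n1 : 0 ≤ ∑ l, c (Sum.inl l) ^ 2 := Finset.sum_nonneg fun _ _ => sq_nonneg _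
    have n2 : 0 ≤ ∑ l, c (Sum.inr l) ^ 2 := Finset.sum_nonneg fun _ _ => sq_nonneg _
    have n3 : 0 ≤ ∑ l, d (Sum.inl l) ^ 2 := Finset.sum_nonneg fun _ _ => sq_nonneg _
    have n4 : 0 ≤ ∑ l, d (Sum.inr l) ^ 2 := Finset.sum_nonneg fun _ _ => sq_nonneg _
    have hprod := mul_le_mul hc2 hd2 (by positivity) (by norm_num)
    nlinarith [mul_nonneg n1 n3, mul_nonneg n2 n4]
  have hsub : (Finset.univ.filter fun s : L × L → Bool => τ < ‖signMatrix s‖) ⊆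
      (T ×ˢ T).biUnion fun q => Finset.univ.filter fun s : L × L → Bool =>
        τ ≤ ∑ p, bsign (s p) * w q.1 q.2 p := by
    intro s hs
    by_contra hcon
    refine (Finset.mem_filter.1 hs).2.not_ge ?_
    rw [Matrix.cstar_norm_def]
    refine norm_le_of_net hT _ hτ fun c hc d hd => ?_
    rw [inner_signMatrix]
    by_contra hlt
    exact hcon (Finset.mem_biUnion.2 ⟨(c, d), Finset.mem_product.2 ⟨hc, hd⟩,
      Finset.mem_filter.2 ⟨Finset.mem_univ _, (not_le.1 hlt).le⟩⟩)
  have hcard : ((Finset.univ.filter fun s : L × L → Bool => τ < ‖signMatrix s‖).card : ℝ) ≤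
      (T.card : ℝ) * T.card * (2 ^ Fintype.card (L × L) * Real.exp (-(τ ^ 2 / (2 * 32)))) := by
    have h1 : ((Finset.univ.filter fun s : L × L → Bool => τ < ‖signMatrix s‖).card : ℝ) ≤
        ∑ q ∈ T ×ˢ T, ((Finset.univ.filter fun s : L × L → Bool =>
          τ ≤ ∑ p, bsign (s p) * w q.1 q.2 p).card : ℝ) := by
      exact_mod_cast (Finset.card_le_card hsub).trans Finset.card_biUnion_le
    refine h1.trans ((Finset.sum_le_card_nsmul _ _
      (2 ^ Fintype.card (L × L) * Real.exp (-(τ ^ 2 / (2 * 32)))) fun q hq => ?_).trans_eq ?_)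
    · have hq' := Finset.mem_product.1 hq
      exact card_signs_le _ (by norm_num) (hw _ hq'.1 _ hq'.2) hτ
    · rw [Finset.card_product, nsmul_eq_mul]
      push_cast
      ring
  have hT' : (T.card : ℝ) ≤ 5 ^ D := by exact_mod_cast hTc
  -- The union bound runs over at most 25^D pairs, so a tail of 100^(-D) leaves 4^(-D) ≤ 1/4.
  have hexp : Real.exp (-(τ ^ 2 / (2 * 32))) ≤ (1 / 100) ^ D := by
    have h100 : (100 : ℝ) ≤ Real.exp (400 / 64) := by
      have h1 : (2.7 : ℝ) ≤ Real.exp 1 := by linarith [Real.exp_one_gt_d9]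
      have h5 : Real.exp 1 ^ 5 ≤ Real.exp (400 / 64) := by
        rw [← Real.exp_nat_mul]
        exact Real.exp_le_exp.2 (by norm_num)
      calc (100 : ℝ) ≤ 2.7 ^ 5 := by norm_num
        _ ≤ Real.exp 1 ^ 5 := pow_le_pow_left₀ (by norm_num) h1 5
        _ ≤ _ := h5
    rw [hτ2, show -(400 * (D : ℝ) / (2 * 32)) = D * -(400 / 64) by ring, Real.exp_nat_mul,
      Real.exp_neg]
    refine pow_le_pow_left₀ (by positivity) ?_ D
    rw [one_div]
    exact inv_anti₀ (by norm_num) h100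
  have hfin : (5 : ℝ) ^ D * 5 ^ D * (1 / 100) ^ D ≤ 1 / 4 := by
    rw [← mul_pow, ← mul_pow]
    calc ((5 : ℝ) * 5 * (1 / 100)) ^ D ≤ (5 * 5 * (1 / 100)) ^ 1 :=
          pow_le_pow_of_le_one (by norm_num) (by norm_num) hD
      _ = 1 / 4 := by norm_num
  rw [Fintype.card_prod, ← sq (Fintype.card L)] at hcard
  calc _ ≤ _ := hcard
    _ ≤ (5 : ℝ) ^ D * 5 ^ D * (2 ^ (Fintype.card L ^ 2) * (1 / 100) ^ D) := by gcongr
    _ = 2 ^ (Fintype.card L ^ 2) * ((5 : ℝ) ^ D * 5 ^ D * (1 / 100) ^ D) := by ring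
    _ ≤ 2 ^ (Fintype.card L ^ 2) * (1 / 4) := by gcongr
    _ = _ := by ring

/-- The number of points in a Hamming ball. -/
theorem card_hammingBall_le {J : Type} [Fintype J] [DecidableEq J] (s : J → Bool) (k : ℕ) :
    ((Finset.univ.filter fun s' : J → Bool => hammingDist s s' ≤ k).card : ℝ) ≤
      (5 / 4) ^ Fintype.card J * 4 ^ k := by
  -- The sum factorizes over coordinates into 1 + 1/4 each; every point of the ball contributes at
  -- least 4^(-k).
  have h1 : ∑ s' : J → Bool, (1 / 4 : ℝ) ^ hammingDist s s' = (5 / 4) ^ Fintype.card J := by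
    have e1 : ∀ s' : J → Bool, (1 / 4 : ℝ) ^ hammingDist s s' =
        ∏ p, if s p ≠ s' p then (1 / 4 : ℝ) else 1 := fun s' => by
      rw [Finset.prod_ite, Finset.prod_const, Finset.prod_const_one, mul_one]
      rfl
    simp only [e1]
    rw [← Fintype.piFinset_univ,
      ← Finset.prod_univ_sum (fun _ => Finset.univ) fun p (b : Bool) =>
        if s p ≠ b then (1 / 4 : ℝ) else 1]
    rw [← Finset.card_univ, ← Finset.prod_const]
    refine Finset.prod_congr rfl fun p _ => ?_
    rw [Fintype.sum_bool]
    cases s p <;> norm_num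
  have h2 : ((Finset.univ.filter fun s' : J → Bool => hammingDist s s' ≤ k).card : ℝ) *
      (1 / 4) ^ k ≤ (5 / 4) ^ Fintype.card J := by
    rw [← h1, ← nsmul_eq_mul, ← Finset.sum_const]
    refine (Finset.sum_le_sum fun s' hs => ?_).trans
      (Finset.sum_le_sum_of_subset_of_nonneg (Finset.filter_subset _ _)
        fun _ _ _ => by positivity)
    exact pow_le_pow_of_le_one (by norm_num) (by norm_num) (Finset.mem_filter.1 hs).2
  rw [one_div, inv_pow, ← div_eq_mul_inv, div_le_iff₀ (by positivity)] at h2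
  exact h2

-- Each differing sign occurs in both off-diagonal blocks and contributes 4 in each.
omit [DecidableEq L] in
theorem sum_signMatrix_sub_sq [DecidableEq L] (s s' : L × L → Bool) :
    ∑ i, ∑ j, (signMatrix s - signMatrix s') i j ^ 2 = 8 * hammingDist s s' := by
  have h : ∀ b b' : Bool, (bsign b - bsign b') ^ 2 = if b ≠ b' then 4 else 0 := by
    intro b b'
    cases b <;> cases b' <;> norm_num [bsign]
  have h2 : ∑ l, ∑ l', (bsign (s (l, l')) - bsign (s' (l, l'))) ^ 2 =
      4 * (hammingDist s s' : ℝ) := by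
    rw [← Fintype.sum_prod_type' fun l l' => (bsign (s (l, l')) - bsign (s' (l, l'))) ^ 2]
    simp only [h, Prod.mk.eta]
    rw [← Finset.sum_filter, Finset.sum_const, nsmul_eq_mul, mul_comm]
    rfl
  have h3 : ∑ l', ∑ l, (bsign (s (l, l')) - bsign (s' (l, l'))) ^ 2 =
      4 * (hammingDist s s' : ℝ) := by rw [Finset.sum_comm, h2]
  simp only [Fintype.sum_sum_type, signMatrix, Matrix.sub_apply, Matrix.fromBlocks_apply₁₁,
    Matrix.fromBlocks_apply₁₂, Matrix.fromBlocks_apply₂₁, Matrix.fromBlocks_apply₂₂,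
    Matrix.zero_apply, sub_zero, Matrix.of_apply, Matrix.neg_apply, Matrix.transpose_apply]
  have h4 : ∀ x y : ℝ, (-x - -y) ^ 2 = (x - y) ^ 2 := fun x y => by ring
  simp only [h4, ne_eq, OfNat.ofNat_ne_zero, not_false_eq_true, zero_pow, Finset.sum_const_zero,
    zero_add, add_zero, h2, h3]
  ring

theorem exists_sign_packing (L : Type) [Fintype L] [DecidableEq L] [Nonempty L] :
    ∃ P : Finset (L × L → Bool), 2 ^ (Fintype.card L ^ 2) ≤ P.card ^ 8 ∧
      (∀ s ∈ P, ‖signMatrix s‖ ≤ 20 * √(2 * Fintype.card L)) ∧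
      ∀ s ∈ P, ∀ s' ∈ P, s ≠ s' →
        ((Fintype.card L : ℝ) ^ 2) ≤ ∑ i, ∑ j, (signMatrix s - signMatrix s') i j ^ 2 := by
  classical
  set N := Fintype.card L ^ 2
  have hN : 1 ≤ N := Nat.one_le_pow _ _ Fintype.card_pos
  set k := N / 8
  let good := Finset.univ.filter fun s : L × L → Bool =>
    ¬ 20 * √(2 * Fintype.card L) < ‖signMatrix s‖
  have hgood : 3 / 4 * (2 : ℝ) ^ N ≤ good.card := by
    have h1 := Finset.card_filter_add_card_filter_not (s := (Finset.univ : Finset (L × L → Bool)))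
      (fun s => 20 * √(2 * Fintype.card L) < ‖signMatrix s‖)
    rw [Finset.card_univ, Fintype.card_fun, Fintype.card_prod, Fintype.card_bool, ← sq] at h1
    have h2 : (((Finset.univ.filter fun s : L × L → Bool =>
      20 * √(2 * Fintype.card L) < ‖signMatrix s‖).card : ℝ)) + good.card = 2 ^ N := by
      have h2 := congr_arg (Nat.cast (R := ℝ)) h1
      push_cast at h2
      exact h2
    have h3 := card_signMatrix_norm_le (L := L)
    linarith
  let cand := good.powerset.filter fun P => ∀ s ∈ P, ∀ s' ∈ P, s ≠ s' → k < hammingDist s s'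
  -- By maximality, Hamming balls of radius N/8 around a largest separated family of good sign
  -- patterns cover all of them.
  obtain ⟨P, hP, hmax⟩ := cand.exists_max_image Finset.card ⟨∅, by simp [cand]⟩
  obtain ⟨hPg, hsep⟩ := Finset.mem_filter.1 hP
  rw [Finset.mem_powerset] at hPg
  have hcover : good ⊆ P.biUnion fun s => Finset.univ.filter fun s' => hammingDist s s' ≤ k := by
    intro s hs
    by_contra hcon
    simp only [Finset.mem_biUnion, Finset.mem_filter, Finset.mem_univ, true_and, not_exists,
      not_and, not_le] at hcon
    have hsP : s ∉ P := fun h => by simpa using hcon s h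
    have hmem : insert s P ∈ cand := by
      refine Finset.mem_filter.2 ⟨Finset.mem_powerset.2 (Finset.insert_subset hs hPg), ?_⟩
      intro a ha b hb hab
      rw [Finset.mem_insert] at ha hb
      rcases ha with rfl | ha <;> rcases hb with rfl | hb
      · exact absurd rfl hab
      · rw [hammingDist_comm]; exact hcon b hb
      · exact hcon a ha
      · exact hsep a ha b hb hab
    have := hmax _ hmem
    rw [Finset.card_insert_of_notMem hsP] at this
    omega
  have hcount : 3 / 4 * (2 : ℝ) ^ N ≤ P.card * ((5 / 4) ^ N * 4 ^ k) := by
    refine hgood.trans ?_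
    have h1 : (good.card : ℝ) ≤ ∑ s ∈ P,
        ((Finset.univ.filter fun s' => hammingDist s s' ≤ k).card : ℝ) := by
      exact_mod_cast (Finset.card_le_card hcover).trans Finset.card_biUnion_le
    refine h1.trans ((Finset.sum_le_card_nsmul _ _ _ fun s _ => ?_).trans_eq (nsmul_eq_mul _ _))
    have := card_hammingBall_le s k
    rwa [Fintype.card_prod, ← sq] at this
  refine ⟨P, ?_, fun s hs => ?_, fun s hs s' hs' hne => ?_⟩
  · have h8 := pow_le_pow_left₀ (by positivity) hcount 8
    have h4 : ((4 : ℝ) ^ k) ^ 8 ≤ 4 ^ N := by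
      rw [← pow_mul]
      exact pow_le_pow_right₀ (by norm_num) (Nat.div_mul_le_self N 8)
    have h9 : (3 / 4) ^ 8 * ((2 : ℝ) ^ 8) ^ N ≤ (P.card : ℝ) ^ 8 * (((5 / 4) ^ 8 * 4) ^ N) := by
      calc (3 / 4) ^ 8 * ((2 : ℝ) ^ 8) ^ N = (3 / 4 * 2 ^ N) ^ 8 := by
            rw [mul_pow, ← pow_mul, ← pow_mul, mul_comm 8 N]
        _ ≤ _ := h8
        _ = (P.card : ℝ) ^ 8 * ((((5 / 4) ^ 8) ^ N) * (4 ^ k) ^ 8) := by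
            rw [mul_pow, mul_pow, pow_right_comm (5 / 4 : ℝ) N 8]
        _ ≤ (P.card : ℝ) ^ 8 * ((((5 / 4) ^ 8) ^ N) * 4 ^ N) := by gcongr
        _ = _ := by rw [mul_pow _ 4]
    -- The base is 10 because 2⁸ / ((5/4)⁸ · 4) > 10.
    have h10 : (3 / 4 : ℝ) ^ 8 * 10 ^ N ≤ (P.card : ℝ) ^ 8 := by
      have h11 : (10 : ℝ) ^ N * ((5 / 4) ^ 8 * 4) ^ N ≤ (2 ^ 8) ^ N := by
        rw [← mul_pow]
        exact pow_le_pow_left₀ (by norm_num) (by norm_num) N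
      have hpos : (0 : ℝ) < ((5 / 4) ^ 8 * 4) ^ N := by positivity
      refine le_of_mul_le_mul_right ?_ hpos
      calc _ = (3 / 4 : ℝ) ^ 8 * (10 ^ N * ((5 / 4) ^ 8 * 4) ^ N) := by ring
        _ ≤ (3 / 4 : ℝ) ^ 8 * (2 ^ 8) ^ N := by gcongr
        _ ≤ _ := h9
    -- For N = 1 the bound says only |P|⁸ ≥ 10 · (3/4)⁸, which barely exceeds 1 and so forces |P| ≥
    -- 2.
    rcases Nat.lt_or_ge N 2 with h | h
    · have hN1 : N = 1 := by omega
      have hP2 : 2 ≤ P.card := by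
        by_contra hlt
        have : (P.card : ℝ) ≤ 1 := by exact_mod_cast Nat.lt_succ_iff.1 (not_le.1 hlt)
        have := pow_le_pow_left₀ (by positivity) this 8
        rw [hN1] at h10
        norm_num at h10 this
        linarith
      rw [hN1]
      calc 2 ^ 1 ≤ 2 ^ 8 := by norm_num
        _ ≤ _ := Nat.pow_le_pow_left hP2 8
    · have h12 : (2 : ℝ) ^ N ≤ (3 / 4 : ℝ) ^ 8 * 10 ^ N := by
        have : (5 : ℝ) ^ 2 ≤ 5 ^ N := pow_le_pow_right₀ (by norm_num) h
        rw [show (10 : ℝ) = 5 * 2 by norm_num, mul_pow]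
        have h2 : (0 : ℝ) < 2 ^ N := by positivity
        nlinarith
      exact_mod_cast h12.trans h10
  · exact not_lt.1 (Finset.mem_filter.1 (hPg hs)).2
  · rw [sum_signMatrix_sub_sq]
    have h1 := hsep s hs s' hs' hne
    have h2 : N ≤ 8 * hammingDist s s' := by omega
    exact_mod_cast h2

end Signs

/-! ### A well-separated family of orthogonal matrices -/

section Cayley

open scoped Matrix.Norms.L2Operator

variable {I : Type} [Fintype I] [DecidableEq I]

/-- A matrix as a vector of a Euclidean space; its norm is the Frobenius norm. -/
def matVec : Matrix I I ℝ →ₗ[ℝ] EuclideanSpace ℝ (I × I) where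
  toFun X := WithLp.toLp 2 fun p => X p.1 p.2
  map_add' _ _ := rfl
  map_smul' _ _ := rfl

omit [DecidableEq I] in
theorem norm_matVec_sq (X : Matrix I I ℝ) : ‖matVec X‖ ^ 2 = ∑ i, ∑ j, X i j ^ 2 := by
  rw [EuclideanSpace.real_norm_sq_eq, Fintype.sum_prod_type]
  rfl

omit [DecidableEq I] in
theorem norm_matVec_sq_eq_trace (X : Matrix I I ℝ) : ‖matVec X‖ ^ 2 = (Xᵀ * X).trace := by
  rw [norm_matVec_sq, Finset.sum_comm, Matrix.trace]
  exact Finset.sum_congr rfl fun j _ => by simp [Matrix.mul_apply, sq]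

omit [DecidableEq I] in
theorem norm_matVec_transpose (X : Matrix I I ℝ) : ‖matVec Xᵀ‖ = ‖matVec X‖ := by
  rw [← sq_eq_sq₀ (norm_nonneg _) (norm_nonneg _), norm_matVec_sq, norm_matVec_sq,
    Finset.sum_comm]
  rfl

theorem norm_matVec_mul_le (A X : Matrix I I ℝ) : ‖matVec (A * X)‖ ≤ ‖A‖ * ‖matVec X‖ := by
  rw [← sq_le_sq₀ (norm_nonneg _) (by positivity), mul_pow, norm_matVec_sq, norm_matVec_sq,
    Finset.sum_comm, Finset.sum_comm (f := fun i j => X i j ^ 2), Finset.mul_sum]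
  refine Finset.sum_le_sum fun j _ => ?_
  have h := pow_le_pow_left₀ (norm_nonneg _)
    (Matrix.l2_opNorm_mulVec A (WithLp.toLp 2 fun i => X i j)) 2
  rw [mul_pow, EuclideanSpace.real_norm_sq_eq, EuclideanSpace.real_norm_sq_eq] at h
  exact h

theorem norm_transpose_eq (A : Matrix I I ℝ) : ‖Aᵀ‖ = ‖A‖ := by
  rw [← Matrix.conjTranspose_eq_transpose_of_trivial, Matrix.l2_opNorm_conjTranspose]

theorem norm_matVec_mul_le' (X A : Matrix I I ℝ) : ‖matVec (X * A)‖ ≤ ‖matVec X‖ * ‖A‖ := by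
  rw [← norm_matVec_transpose, Matrix.transpose_mul, ← norm_matVec_transpose X,
    ← norm_transpose_eq A, mul_comm ‖matVec _‖]
  exact norm_matVec_mul_le _ _

theorem norm_matVec_le (X : Matrix I I ℝ) : ‖matVec X‖ ≤ √(Fintype.card I) * ‖X‖ := by
  have h1 : ‖matVec (1 : Matrix I I ℝ)‖ = √(Fintype.card I) := by
    rw [eq_comm, Real.sqrt_eq_iff_mul_self_eq (by positivity) (norm_nonneg _), ← sq,
      norm_matVec_sq_eq_trace]
    simp
  have := norm_matVec_mul_le X 1
  rwa [Matrix.mul_one, h1, mul_comm] at this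

theorem norm_one_sub_le [Nonempty I] {X : Matrix I I ℝ} (hX : ‖X‖ ≤ 1 / 4) : ‖1 - X‖ ≤ 5 / 4 := by
  have := norm_sub_le 1 X
  rw [norm_one] at this
  linarith

theorem exists_inv_one_sub {X : Matrix I I ℝ} (hX : ‖X‖ ≤ 1 / 4) :
    ∃ R : Matrix I I ℝ, (1 - X) * R = 1 ∧ R * (1 - X) = 1 := by
  have : CompleteSpace (Matrix I I ℝ) := FiniteDimensional.complete ℝ _
  let u := Units.oneSub X (by linarith)
  exact ⟨_, u.mul_inv, u.inv_mul⟩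

/-- The inverse of `1 - X` (for small `X`). -/
def resolventAt (X : Matrix I I ℝ) (hX : ‖X‖ ≤ 1 / 4) : Matrix I I ℝ :=
  (exists_inv_one_sub hX).choose

/-- The Cayley transform. -/
def cayley (X : Matrix I I ℝ) (hX : ‖X‖ ≤ 1 / 4) : Matrix I I ℝ := (1 + X) * resolventAt X hX

variable {X Y : Matrix I I ℝ} (hX : ‖X‖ ≤ 1 / 4) (hY : ‖Y‖ ≤ 1 / 4)

theorem one_sub_mul_resolventAt : (1 - X) * resolventAt X hX = 1 :=
  (exists_inv_one_sub hX).choose_spec.1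

theorem resolventAt_mul_one_sub : resolventAt X hX * (1 - X) = 1 :=
  (exists_inv_one_sub hX).choose_spec.2

theorem cayley_orthogonal (h : Xᵀ = -X) : (cayley X hX)ᵀ * cayley X hX = 1 := by
  have h1 := congr_arg Matrix.transpose (one_sub_mul_resolventAt hX)
  rw [Matrix.transpose_mul, Matrix.transpose_sub, Matrix.transpose_one, h, sub_neg_eq_add] at h1
  rw [cayley, Matrix.transpose_mul, Matrix.transpose_add, Matrix.transpose_one, h,
    ← sub_eq_add_neg]
  calc (resolventAt X hX)ᵀ * (1 - X) * ((1 + X) * resolventAt X hX)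
      = (resolventAt X hX)ᵀ * ((1 - X) * (1 + X)) * resolventAt X hX := by
        simp only [Matrix.mul_assoc]
    _ = (resolventAt X hX)ᵀ * ((1 + X) * (1 - X)) * resolventAt X hX := by
        congr 2; noncomm_ring
    _ = ((resolventAt X hX)ᵀ * (1 + X)) * ((1 - X) * resolventAt X hX) := by
        simp only [Matrix.mul_assoc]
    _ = 1 := by rw [h1, one_sub_mul_resolventAt, Matrix.one_mul]

theorem mul_resolventAt : X * resolventAt X hX = resolventAt X hX - 1 := by
  have := one_sub_mul_resolventAt hX
  rw [Matrix.sub_mul, Matrix.one_mul] at this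
  rw [← this, sub_sub_cancel]

theorem norm_resolventAt_le [Nonempty I] : ‖resolventAt X hX‖ ≤ 4 / 3 := by
  have h1 : resolventAt X hX = 1 + X * resolventAt X hX := by
    rw [mul_resolventAt, add_sub_cancel]
  have h2 : ‖resolventAt X hX‖ ≤ 1 + ‖X‖ * ‖resolventAt X hX‖ := by
    conv_lhs => rw [h1]
    refine (norm_add_le _ _).trans ?_
    rw [norm_one]
    gcongr
    exact norm_mul_le _ _
  nlinarith [norm_nonneg (resolventAt X hX)]

theorem cayley_eq : cayley X hX = (2 : ℝ) • resolventAt X hX - 1 := by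
  rw [cayley, Matrix.add_mul, Matrix.one_mul, mul_resolventAt, two_smul]
  abel

theorem cayley_sub_one : cayley X hX - 1 = (2 : ℝ) • (X * resolventAt X hX) := by
  rw [cayley_eq, mul_resolventAt, two_smul, two_smul]
  abel

theorem norm_cayley_sub_one_le [Nonempty I] : ‖cayley X hX - 1‖ ≤ 2 / 3 := by
  rw [cayley_sub_one, norm_smul, Real.norm_ofNat]
  have h1 := norm_mul_le X (resolventAt X hX)
  have h2 := mul_le_mul hX (norm_resolventAt_le hX) (norm_nonneg _) (by norm_num)
  linarith

/-- The resolvent identity, since the Cayley transform is twice the resolvent minus 1. -/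
theorem sub_eq_cayley_sub :
    X - Y = (1 / 2 : ℝ) • ((1 - X) * (cayley X hX - cayley Y hY) * (1 - Y)) := by
  rw [cayley_eq, cayley_eq, sub_sub_sub_cancel_right, ← smul_sub, Matrix.mul_smul, Matrix.smul_mul,
    smul_smul, show (1 / 2 : ℝ) * 2 = 1 by norm_num, one_smul, Matrix.mul_sub (1 - X),
    Matrix.sub_mul _ _ (1 - Y),
    one_sub_mul_resolventAt, Matrix.one_mul, Matrix.mul_assoc, resolventAt_mul_one_sub]
  simp

/-- The Cayley transform does not contract Frobenius distances on this ball, because (1/2)(5/4)² <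
1. -/
theorem norm_matVec_sub_le [Nonempty I] :
    ‖matVec (X - Y)‖ ≤ ‖matVec (cayley X hX - cayley Y hY)‖ := by
  rw [sub_eq_cayley_sub hX hY, map_smul, norm_smul]
  have h1 := norm_matVec_mul_le' ((1 - X) * (cayley X hX - cayley Y hY)) (1 - Y)
  have h2 := norm_matVec_mul_le (1 - X) (cayley X hX - cayley Y hY)
  have h3 := norm_one_sub_le hX
  have h4 := norm_one_sub_le hY
  set z := ‖matVec (cayley X hX - cayley Y hY)‖
  have hz : 0 ≤ z := norm_nonneg _
  have h5 : ‖matVec ((1 - X) * (cayley X hX - cayley Y hY))‖ ≤ 5 / 4 * z :=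
    h2.trans (mul_le_mul_of_nonneg_right h3 hz)
  have h6 : ‖matVec ((1 - X) * (cayley X hX - cayley Y hY) * (1 - Y))‖ ≤ 5 / 4 * z * (5 / 4) :=
    h1.trans (mul_le_mul h5 h4 (norm_nonneg _) (by positivity))
  rw [Real.norm_of_nonneg (by norm_num)]
  linarith

theorem norm_matVec_cayley_sub_sq (h : Xᵀ = -X) (h' : Yᵀ = -Y) :
    ‖matVec (cayley X hX - cayley Y hY)‖ ^ 2 =
      2 * Fintype.card I - 2 * ((cayley X hX)ᵀ * cayley Y hY).trace := by
  have hsymm : ((cayley Y hY)ᵀ * cayley X hX).trace = ((cayley X hX)ᵀ * cayley Y hY).trace := by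
    rw [← Matrix.trace_transpose, Matrix.transpose_mul, Matrix.transpose_transpose]
  rw [norm_matVec_sq_eq_trace, Matrix.transpose_sub, Matrix.sub_mul, Matrix.mul_sub,
    Matrix.mul_sub, cayley_orthogonal hX h, cayley_orthogonal hY h', Matrix.trace_sub,
    Matrix.trace_sub, Matrix.trace_sub, hsymm, Matrix.trace_one]
  ring

/-- Both transforms are within 2/3 of the identity, so their squared Frobenius distance is at most
(16/9)·|I| < 2·|I|. Positivity lets this trace replace its absolute value later, which disposes of
global phases. -/
theorem trace_cayley_nonneg [Nonempty I] (h : Xᵀ = -X) (h' : Yᵀ = -Y) :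
    0 ≤ ((cayley X hX)ᵀ * cayley Y hY).trace := by
  have h1 := norm_matVec_le (cayley X hX - cayley Y hY)
  have h2 : ‖cayley X hX - cayley Y hY‖ ≤ 4 / 3 := by
    have := norm_sub_le (cayley X hX - 1) (cayley Y hY - 1)
    rw [sub_sub_sub_cancel_right] at this
    linarith [norm_cayley_sub_one_le hX, norm_cayley_sub_one_le hY]
  have h3 := pow_le_pow_left₀ (norm_nonneg _) (h1.trans (mul_le_mul_of_nonneg_left h2
    (Real.sqrt_nonneg _))) 2
  rw [norm_matVec_cayley_sub_sq hX hY h h', mul_pow, Real.sq_sqrt (by positivity)] at h3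
  have : (0 : ℝ) ≤ Fintype.card I := by positivity
  linarith

end Cayley

/-! ### Orthogonal matrices from base-200 expansions with matrix digits. -/

section Family

open scoped Matrix.Norms.L2Operator

variable {I P : Type} [Fintype I] [DecidableEq I]

/-- The matrix with expansion `ω` in base `200` with matrix digits `B`. -/
def digitSum (B : P → Matrix I I ℝ) (ω : ℕ → P) : Matrix I I ℝ :=
  ∑' k, ((1 / 8 : ℝ) * (1 / 200) ^ k) • B (ω k)

variable {B : P → Matrix I I ℝ} (hB : ∀ p, ‖B p‖ ≤ 1) (ω ω' : ℕ → P)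

include hB in
theorem norm_digit_le (k : ℕ) :
    ‖((1 / 8 : ℝ) * (1 / 200) ^ k) • B (ω k)‖ ≤ (1 / 8 : ℝ) * (1 / 200) ^ k := by
  rw [norm_smul, Real.norm_of_nonneg (by positivity)]
  exact mul_le_of_le_one_right (by positivity) (hB _)

omit [Fintype I] [DecidableEq I] in
theorem hasSum_digit_bound :
    HasSum (fun k : ℕ => (1 / 8 : ℝ) * (1 / 200) ^ k) (1 / 8 * (1 - 1 / 200)⁻¹) :=
  (hasSum_geometric_of_lt_one (by norm_num) (by norm_num)).mul_left _

include hB in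
theorem summable_digit : Summable fun k => ((1 / 8 : ℝ) * (1 / 200) ^ k) • B (ω k) := by
  have : CompleteSpace (Matrix I I ℝ) := FiniteDimensional.complete ℝ _
  exact Summable.of_norm_bounded hasSum_digit_bound.summable (norm_digit_le hB ω)

include hB in
theorem norm_digitSum_le : ‖digitSum B ω‖ ≤ 1 / 4 :=
  (tsum_of_norm_bounded hasSum_digit_bound (norm_digit_le hB ω)).trans (by norm_num)

omit [Fintype I] [DecidableEq I] in
theorem digitSum_transpose (hBt : ∀ p, (B p)ᵀ = -B p) : (digitSum B ω)ᵀ = -digitSum B ω := by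
  rw [digitSum, Matrix.transpose_tsum, ← tsum_neg]
  simp [hBt]

-- At the first differing position j the digit contributes at least √d/320 · 200⁻ʲ, with d = |I|,
-- and the tail at most √d/796 · 200⁻ʲ. The difference exceeds 5/16 · √d · 200^(-(j+1)), and j + 1 ≤
-- k.
include hB in
theorem norm_matVec_digitSum_sub_ge
    (hsep : ∀ p p', p ≠ p' → √(Fintype.card I) / 40 ≤ ‖matVec (B p - B p')‖) {k : ℕ}
    (hne : ∃ i < k, ω i ≠ ω' i) :
    5 / 16 * √(Fintype.card I) * (1 / 200) ^ k ≤ ‖matVec (digitSum B ω - digitSum B ω')‖ := by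
  classical
  have : CompleteSpace (Matrix I I ℝ) := FiniteDimensional.complete ℝ _
  have hne' : ∃ i, ω i ≠ ω' i := hne.imp fun i h => h.2
  set j := Nat.find hne'
  have hj : ω j ≠ ω' j := Nat.find_spec hne'
  have hjk : j + 1 ≤ k := by
    obtain ⟨i, hi, h⟩ := hne
    exact (Nat.find_min' hne' h).trans_lt hi
  have hlt : ∀ i < j, ω i = ω' i := fun i hi => not_not.1 (Nat.find_min hne' hi)
  set f : ℕ → Matrix I I ℝ := fun k =>
    ((1 / 8 : ℝ) * (1 / 200) ^ k) • B (ω k) - ((1 / 8 : ℝ) * (1 / 200) ^ k) • B (ω' k)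
  have hf : Summable f := (summable_digit hB ω).sub (summable_digit hB ω')
  have hsplit : digitSum B ω - digitSum B ω' = f j + ∑' i, f (i + (j + 1)) := by
    rw [digitSum, digitSum, ← (summable_digit hB ω).tsum_sub (summable_digit hB ω')]
    change ∑' i, f i = _
    rw [← hf.sum_add_tsum_nat_add (j + 1), Finset.sum_range_succ,
      Finset.sum_eq_zero fun i hi => ?_, zero_add]
    simp only [f, hlt i (Finset.mem_range.1 hi), sub_self]
  have htail : ‖∑' i, f (i + (j + 1))‖ ≤ 1 / 796 * (1 / 200) ^ j := by
    have hs := (hasSum_digit_bound.mul_left (2 * (1 / 200) ^ (j + 1)))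
    refine (tsum_of_norm_bounded hs fun i => ?_).trans ?_
    · refine (norm_sub_le _ _).trans
        ((add_le_add (norm_digit_le hB ω _) (norm_digit_le hB ω' _)).trans_eq ?_)
      rw [pow_add]
      ring
    · rw [pow_succ]
      have : (0 : ℝ) < (1 / 200) ^ j := by positivity
      norm_num
      linarith
  have hhead : √(Fintype.card I) / 40 * (1 / 8 * (1 / 200) ^ j) ≤ ‖matVec (f j)‖ := by
    simp only [f]
    rw [← smul_sub, map_smul, norm_smul, Real.norm_of_nonneg (by positivity), mul_comm]
    exact mul_le_mul_of_nonneg_left (hsep _ _ hj) (by positivity)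
  have htail' := (norm_matVec_le (∑' i, f (i + (j + 1)))).trans
    (mul_le_mul_of_nonneg_left htail (Real.sqrt_nonneg _))
  have hpow : (1 / 200 : ℝ) ^ k ≤ (1 / 200) ^ j * (1 / 200) := by
    rw [← pow_succ]
    exact pow_le_pow_of_le_one (by norm_num) (by norm_num) hjk
  rw [hsplit, map_add]
  have htri := norm_sub_le (matVec (f j) + matVec (∑' i, f (i + (j + 1))))
    (matVec (∑' i, f (i + (j + 1))))
  rw [add_sub_cancel_right] at htri
  have hd := Real.sqrt_nonneg (Fintype.card I)
  have h1 := mul_le_mul_of_nonneg_left hpow hd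
  have h2 : 0 ≤ √(Fintype.card I) * (1 / 200) ^ j := by positivity
  linarith

/-- For orthogonal matrices the squared distance is 2d - 2tr, with d = |I|. Squaring the separation
turns 200 into 40000 and 5/16 into 25/256, and half of the latter is 25/512. -/
theorem exists_orthogonal_family [Nonempty I] (hB : ∀ p, ‖B p‖ ≤ 1)
    (hBt : ∀ p, (B p)ᵀ = -B p)
    (hsep : ∀ p p', p ≠ p' → √(Fintype.card I) / 40 ≤ ‖matVec (B p - B p')‖) :
    ∃ U : (ℕ → P) → Matrix I I ℝ, (∀ ω, (U ω)ᵀ * U ω = 1) ∧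
      (∀ ω ω', 0 ≤ ((U ω)ᵀ * U ω').trace) ∧
      ∀ k ω ω', (∃ i < k, ω i ≠ ω' i) →
        ((U ω)ᵀ * U ω').trace ≤ Fintype.card I * (1 - 25 / 512 * (1 / 40000) ^ k) := by
  have hn := norm_digitSum_le hB
  have ht := fun ω => digitSum_transpose ω hBt
  refine ⟨fun ω => cayley (digitSum B ω) (hn ω), fun ω => cayley_orthogonal _ (ht ω),
    fun ω ω' => trace_cayley_nonneg _ _ (ht ω) (ht ω'), fun k ω ω' hne => ?_⟩
  have h1 := (norm_matVec_digitSum_sub_ge hB ω ω' hsep hne).trans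
    (norm_matVec_sub_le (hn ω) (hn ω'))
  have h2 := pow_le_pow_left₀ (by positivity) h1 2
  rw [norm_matVec_cayley_sub_sq _ _ (ht ω) (ht ω'), mul_pow, mul_pow,
    Real.sq_sqrt (by positivity), pow_right_comm] at h2
  norm_num at h2 ⊢
  linarith

end Family

/-! ### Two unitaries close to one operator -/

section Close

variable {n : ℕ}

theorem frobSq_of_mem_unitaryGroup {U : Op (Fin n)}
    (hU : U ∈ Matrix.unitaryGroup (Fin n → Fin 2) ℂ) : frobSq U = 2 ^ n := by
  have := trace_conjTranspose_mul_self U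
  rw [show Uᴴ * U = 1 from (Matrix.mem_unitaryGroup_iff').1 hU, Matrix.trace_one] at this
  have h2 := congr_arg Complex.re this
  rw [Complex.ofReal_re] at h2
  rw [← h2]
  simp only [Fintype.card_fun, Fintype.card_fin]
  exact_mod_cast Complex.ofReal_re (2 ^ n)

theorem IsClose.mono {U G : Op (Fin n)} {ε ε' : ℝ} (h : IsClose U G ε) (hε : ε ≤ ε') :
    IsClose U G ε' := by
  refine lt_of_le_of_lt ?_ h
  have := frobSq_nonneg G
  gcongr

theorem frobSq_smul (c : ℂ) (G : Op (Fin n)) : frobSq (c • G) = ‖c‖ ^ 2 * frobSq G := by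
  simp only [frobSq, Finset.mul_sum, Matrix.smul_apply, smul_eq_mul, norm_mul, mul_pow]

theorem IsClose.of_smul {U G : Op (Fin n)} {ε : ℝ} {c : ℂ} (h : IsClose U (c • G) ε) :
    IsClose U G ε := by
  rw [IsClose, frobSq_smul, Matrix.mul_smul, Matrix.trace_smul, norm_smul, mul_pow,
    mul_left_comm] at h
  exact lt_of_mul_lt_mul_left h (sq_nonneg _)

theorem trace_conjTranspose_mul_comm (X Y : Op (Fin n)) :
    (Xᴴ * Y).trace = star (Yᴴ * X).trace := by
  rw [← Matrix.trace_conjTranspose, Matrix.conjTranspose_mul, Matrix.conjTranspose_conjTranspose]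

/-- The residuals are ‖G‖² times the components of U and U' orthogonal to G, in a form without
division. -/
theorem trace_residual (U U' G : Op (Fin n)) :
    (((frobSq G : ℂ) • U - (Gᴴ * U).trace • G)ᴴ *
      ((frobSq G : ℂ) • U' - (Gᴴ * U').trace • G)).trace =
      frobSq G * (frobSq G * (Uᴴ * U').trace - (Uᴴ * G).trace * (Gᴴ * U').trace) := by
  simp only [Matrix.conjTranspose_sub, Matrix.conjTranspose_smul, Matrix.sub_mul, Matrix.mul_sub,
    Matrix.smul_mul, Matrix.mul_smul, Matrix.trace_sub, Matrix.trace_smul, smul_eq_mul,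
    trace_conjTranspose_mul_self, ← trace_conjTranspose_mul_comm, Complex.star_def,
    Complex.conj_ofReal]
  ring

theorem IsClose.frobSq_residual_le {U G : Op (Fin n)} {ε : ℝ}
    (hU : U ∈ Matrix.unitaryGroup (Fin n → Fin 2) ℂ) (h : IsClose U G ε) :
    frobSq ((frobSq G : ℂ) • U - (Gᴴ * U).trace • G) ≤ frobSq G ^ 2 * (2 * ε * 2 ^ n) := by
  have h1 := trace_residual U U G
  rw [trace_conjTranspose_mul_self, trace_conjTranspose_mul_self, trace_conjTranspose_mul_comm G U,
    Complex.star_def, Complex.mul_conj', frobSq_of_mem_unitaryGroup hU] at h1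
  have h2 : frobSq ((frobSq G : ℂ) • U - (Gᴴ * U).trace • G) =
      frobSq G * (frobSq G * 2 ^ n - ‖(Uᴴ * G).trace‖ ^ 2) := by
    rw [trace_conjTranspose_mul_comm G U, Complex.star_def]
    exact_mod_cast h1
  rw [h2]
  unfold IsClose at h
  nlinarith [mul_le_mul_of_nonneg_left h.le (frobSq_nonneg G)]

/-- Split U and U' along G and its orthogonal complement. The parallel parts contribute at least
(1-2ε)2ⁿ to the trace and the orthogonal ones at most 2ε·2ⁿ by Cauchy–Schwarz. The loss is linear in
ε, whereas the triangle inequality would lose √ε. -/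
theorem IsClose.le_norm_trace {U U' G : Op (Fin n)} {ε : ℝ} (hε : ε ≤ 1 / 2) (hε0 : 0 ≤ ε)
    (hU : U ∈ Matrix.unitaryGroup (Fin n → Fin 2) ℂ)
    (hU' : U' ∈ Matrix.unitaryGroup (Fin n → Fin 2) ℂ) (h : IsClose U G ε)
    (h' : IsClose U' G ε) : (1 - 4 * ε) * 2 ^ n ≤ ‖(Uᴴ * U').trace‖ := by
  set F := frobSq G with hF
  have hFpos : 0 < F := by
    refine (frobSq_nonneg G).lt_of_ne fun h0 => ?_
    have h1 := norm_trace_conjTranspose_mul_sq_le U G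
    unfold IsClose at h
    rw [← h0] at h h1
    simp at h h1
    simp [h1] at h
  set N : ℝ := 2 ^ n
  have hN : 0 < N := by positivity
  set x := ‖(Uᴴ * G).trace‖
  set y := ‖(U'ᴴ * G).trace‖
  have hx : 0 ≤ x := norm_nonneg _
  have hy : 0 ≤ y := norm_nonneg _
  have hxy : (1 - 2 * ε) * N * F ≤ x * y := by
    refine le_of_abs_le (abs_le_of_sq_le_sq ?_ (by positivity))
    have h0 : 0 ≤ (1 - 2 * ε) * N * F :=
      mul_nonneg (mul_nonneg (by linarith) hN.le) hFpos.le
    rw [mul_pow x, sq]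
    exact mul_le_mul h.le h'.le h0 (by positivity)
  have hres : F * ‖F * (Uᴴ * U').trace - (Uᴴ * G).trace * (Gᴴ * U').trace‖ ≤
      F ^ 2 * (2 * ε * N) := by
    have h1 := norm_trace_conjTranspose_mul_sq_le ((frobSq G : ℂ) • U - (Gᴴ * U).trace • G)
      ((frobSq G : ℂ) • U' - (Gᴴ * U').trace • G)
    rw [trace_residual, norm_mul, Complex.norm_of_nonneg hFpos.le] at h1
    refine le_of_abs_le (abs_le_of_sq_le_sq (h1.trans ?_) (by positivity))
    rw [sq (F ^ 2 * _)]
    exact mul_le_mul (h.frobSq_residual_le hU) (h'.frobSq_residual_le hU') (frobSq_nonneg _)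
      (by positivity)
  have h1 : ‖F * (Uᴴ * U').trace - (Uᴴ * G).trace * (Gᴴ * U').trace‖ ≤ F * (2 * ε * N) :=
    le_of_mul_le_mul_left (by linarith) hFpos
  have h2 : ‖(Uᴴ * G).trace * (Gᴴ * U').trace‖ = x * y := by
    rw [norm_mul, trace_conjTranspose_mul_comm G U', norm_star]
  have h3 : ‖(F : ℂ) * (Uᴴ * U').trace‖ = F * ‖(Uᴴ * U').trace‖ := by
    rw [norm_mul, Complex.norm_of_nonneg hFpos.le]
  have h4 := norm_sub_norm_le ((Uᴴ * G).trace * (Gᴴ * U').trace) ((F : ℂ) * (Uᴴ * U').trace)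
  rw [norm_sub_rev, h2, h3] at h4
  refine le_of_mul_le_mul_left ?_ hFpos
  linarith

end Close

/-! ### The family of unitaries indexed by words -/

-- With l = |L|, the normalized squared distance is l²/(800 l) = 2l/1600, which is the square of
-- √(2l)/40.
open scoped Matrix.Norms.L2Operator in
theorem exists_antisymm_packing (L : Type) [Fintype L] [DecidableEq L] [Nonempty L] :
    ∃ (P : Type) (_ : Fintype P) (B : P → Matrix (L ⊕ L) (L ⊕ L) ℝ),
      2 ^ (Fintype.card L ^ 2) ≤ Fintype.card P ^ 8 ∧ (∀ p, ‖B p‖ ≤ 1) ∧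
      (∀ p, (B p)ᵀ = -B p) ∧
      ∀ p p', p ≠ p' → √(Fintype.card (L ⊕ L)) / 40 ≤ ‖matVec (B p - B p')‖ := by
  obtain ⟨P, hcard, hnorm, hsep⟩ := exists_sign_packing L
  have hL : (0 : ℝ) < Fintype.card L := by exact_mod_cast Fintype.card_pos
  have hs : 0 < 20 * √(2 * Fintype.card L) := by positivity
  refine ⟨P, inferInstance, fun s => (20 * √(2 * Fintype.card L))⁻¹ • signMatrix s.1, ?_,
    fun s => ?_, fun s => ?_, fun s s' hss => ?_⟩
  · simpa using hcard
  · rw [norm_smul, Real.norm_of_nonneg (by positivity), inv_mul_le_iff₀ hs, mul_one]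
    exact hnorm s s.2
  · rw [Matrix.transpose_smul, signMatrix_transpose, smul_neg]
  · have h := hsep s s.2 s' s'.2 fun h => hss (Subtype.ext h)
    rw [← norm_matVec_sq] at h
    refine le_of_abs_le (abs_le_of_sq_le_sq ?_ (norm_nonneg _))
    rw [← smul_sub, map_smul, norm_smul, Real.norm_of_nonneg (by positivity), mul_pow, div_pow,
      inv_pow, mul_pow, Real.sq_sqrt (by positivity), Real.sq_sqrt (by positivity),
      Fintype.card_sum, ← div_eq_inv_mul, le_div_iff₀ (by positivity)]
    push_cast
    linarith

/-- The sign blocks have side 2^(n-1), hence the exponent 32 = 8 · 4. The scale 40000⁻ᵏ/100 works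
because 4/100 < 25/512, which contradicts the trace bound for words that differ among their first k
letters. -/
theorem exists_unitary_family {n : ℕ} (hn : 1 ≤ n) :
    ∃ (P : Type) (_ : Fintype P) (U : (ℕ → P) → Op (Fin n)),
      2 ^ (2 ^ n * 2 ^ n) ≤ Fintype.card P ^ 32 ∧
      (∀ ω, U ω ∈ Matrix.unitaryGroup (Fin n → Fin 2) ℂ) ∧
      ∀ k ω ω' G, IsClose (U ω) G ((1 / 40000) ^ k / 100) →
        IsClose (U ω') G ((1 / 40000) ^ k / 100) → ∀ i < k, ω i = ω' i := by
  obtain ⟨P, hP, B, hcard, hB, hBt, hsep⟩ := exists_antisymm_packing (Fin (n - 1) → Fin 2)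
  obtain ⟨U, hU, hU0, hUk⟩ := exists_orthogonal_family hB hBt hsep
  have hd : 2 ^ n = 2 * 2 ^ (n - 1) := by rw [← pow_succ', Nat.sub_add_cancel hn]
  have e : (Fin n → Fin 2) ≃ (Fin (n - 1) → Fin 2) ⊕ (Fin (n - 1) → Fin 2) :=
    Fintype.equivOfCardEq (by simp [hd, two_mul])
  let W : (ℕ → P) → Op (Fin n) := fun ω => ((U ω).submatrix e e).map Complex.ofReal
  have hW : ∀ ω ω', (W ω)ᴴ * W ω' = (((U ω)ᵀ * U ω').submatrix e e).map Complex.ofReal := by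
    intro ω ω'
    ext i j
    simp only [W, Matrix.mul_apply, Matrix.map_apply, Matrix.submatrix_apply,
      Matrix.conjTranspose_apply, Matrix.transpose_apply, Complex.ofReal_sum, Complex.ofReal_mul,
      Complex.star_def, Complex.conj_ofReal]
    exact e.sum_comp fun x => (U ω x (e i) : ℂ) * U ω' x (e j)
  have hWtr : ∀ ω ω', ‖((W ω)ᴴ * W ω').trace‖ = ((U ω)ᵀ * U ω').trace := by
    intro ω ω'
    have : ((W ω)ᴴ * W ω').trace = (((U ω)ᵀ * U ω').trace : ℂ) := by
      rw [hW]
      simp only [Matrix.trace, Matrix.diag_apply, Matrix.map_apply, Matrix.submatrix_apply,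
        Complex.ofReal_sum]
      exact e.sum_comp fun x => ((((U ω)ᵀ * U ω') x x : ℝ) : ℂ)
    rw [this, Complex.norm_of_nonneg (hU0 ω ω')]
  have hWu : ∀ ω, W ω ∈ Matrix.unitaryGroup (Fin n → Fin 2) ℂ := by
    intro ω
    refine Matrix.mem_unitaryGroup_iff'.2 ?_
    rw [Matrix.star_eq_conjTranspose, hW, hU, Matrix.submatrix_one_equiv]
    exact Matrix.map_one _ Complex.ofReal_zero Complex.ofReal_one
  refine ⟨P, hP, W, ?_, hWu, fun k ω ω' G h h' => ?_⟩
  · calc 2 ^ (2 ^ n * 2 ^ n) = (2 ^ (Fintype.card (Fin (n - 1) → Fin 2) ^ 2)) ^ 4 := by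
          rw [← pow_mul, hd]; congr 1; simp; ring
      _ ≤ (Fintype.card P ^ 8) ^ 4 := Nat.pow_le_pow_left hcard 4
      _ = _ := by rw [← pow_mul]
  · by_contra! hne
    have hk : (0 : ℝ) < (1 / 40000) ^ k := by positivity
    have hk1 : (1 / 40000 : ℝ) ^ k ≤ 1 := pow_le_one₀ (by norm_num) (by norm_num)
    have h1 := h.le_norm_trace (by linarith) (by positivity) (hWu ω) (hWu ω') h'
    have h2 := hUk k ω ω' hne
    rw [hWtr] at h1
    have hcd : (Fintype.card ((Fin (n - 1) → Fin 2) ⊕ (Fin (n - 1) → Fin 2)) : ℝ) = 2 ^ n := by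
      rw [← Fintype.card_congr e]; simp
    rw [hcd] at h2
    have h3 := h1.trans h2
    rw [mul_comm] at h3
    have h4 := le_of_mul_le_mul_left h3 (by positivity)
    linarith

/-! ### Avoiding rare words -/

section Avoid

open MeasureTheory ProbabilityTheory

/-- A sequence of letters avoids forbidden initial words if these are rare enough. -/
theorem exists_forall_prefix_notMem {P : Type} [Fintype P] [Nonempty P]
    (F : (k : ℕ) → Set (Fin k → P)) [∀ k, Fintype (F k)]
    (hF : ∑' k, (Fintype.card (F k) : ℝ≥0∞) * (Fintype.card P : ℝ≥0∞)⁻¹ ^ k < 1) :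
    ∃ ω : ℕ → P, ∀ k, (fun i : Fin k => ω i) ∉ F k := by
  classical
  let : MeasurableSpace P := ⊤
  let μ : Measure P := (PMF.uniformOfFintype P).toMeasure
  -- With independent uniform letters each word of length k has probability |P|⁻ᵏ, and the union
  -- bound runs over all lengths at once.
  let ν : Measure (ℕ → P) := Measure.infinitePi fun _ => μ
  have hcyl : ∀ k (w : Fin k → P),
      ν {ω | (fun i : Fin k => ω i) = w} = (Fintype.card P : ℝ≥0∞)⁻¹ ^ k := by
    intro k w
    have hset : {ω : ℕ → P | (fun i : Fin k => ω i) = w} = Set.pi (Finset.range k)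
        (fun i => if h : i < k then {w ⟨i, h⟩} else Set.univ) := by
      ext ω
      simp only [Set.mem_ofPred_eq, Set.mem_pi, Finset.coe_range, Set.mem_Iio]
      refine ⟨fun h i hi => ?_, fun h => funext fun i => ?_⟩
      · rw [dif_pos hi, ← h]
        rfl
      · have := h i i.2
        rwa [dif_pos i.2] at this
    rw [hset, Measure.infinitePi_pi _ fun i _ => MeasurableSpace.measurableSet_top,
      Finset.prod_congr rfl fun i hi => ?_, Finset.prod_const, Finset.card_range]
    rw [dif_pos (Finset.mem_range.1 hi)]
    simp only [μ]
    rw [PMF.toMeasure_apply_singleton _ _ MeasurableSpace.measurableSet_top,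
      PMF.uniformOfFintype_apply]
  have hle : ν (⋃ k, ⋃ w : F k, {ω | (fun i : Fin k => ω i) = w.1}) < 1 := by
    refine ((measure_iUnion_le _).trans (ENNReal.tsum_le_tsum fun k => ?_)).trans_lt hF
    refine (measure_iUnion_fintype_le _ _).trans (le_of_eq ?_)
    simp only [hcyl, Finset.sum_const, Finset.card_univ, nsmul_eq_mul]
  by_contra! hall
  have huniv : (⋃ k, ⋃ w : F k, {ω : ℕ → P | (fun i : Fin k => ω i) = w.1}) = Set.univ := by
    refine Set.eq_univ_of_forall fun ω => ?_
    obtain ⟨k, hk⟩ := hall ω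
    exact Set.mem_iUnion.2 ⟨k, Set.mem_iUnion.2 ⟨⟨_, hk⟩, rfl⟩⟩
  rw [huniv, measure_univ] at hle
  exact lt_irrefl _ hle

end Avoid

/-! ### Counting the operators with few `T` gates -/

section Counting

/-- The union over t costs the factor T + 1 ≤ 2^T. -/
theorem exists_finset_represents_of_le {n T E : ℕ}
    (h : ∀ t ≤ T, ∃ S : Finset (Op (Fin n)), S.card ≤ 2 ^ E ∧
      ∀ G, Represents G t → ∃ V ∈ S, ∃ c : ℂ, G = c • V) :
    ∃ S : Finset (Op (Fin n)), S.card ≤ 2 ^ (T + E) ∧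
      ∀ t ≤ T, ∀ G, Represents G t → ∃ V ∈ S, ∃ c : ℂ, G = c • V := by
  classical
  choose! S hS hG using h
  refine ⟨(Finset.range (T + 1)).biUnion S, ?_, fun t ht G h => ?_⟩
  · refine (Finset.card_biUnion_le_card_mul _ _ (2 ^ E) fun t ht => hS t ?_).trans ?_
    · have := Finset.mem_range.1 ht
      omega
    · rw [Finset.card_range, pow_add]
      exact Nat.mul_le_mul_right _ Nat.lt_two_pow_self
  · obtain ⟨V, hV, h⟩ := hG t ht G h
    exact ⟨V, Finset.mem_biUnion.2 ⟨t, Finset.mem_range.2 (by omega), hV⟩, h⟩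

/-- Few operators have a `T`-count at most `√(k * max (4 ^ n) k) / 1000`. -/
theorem exists_finset_represents_sq_le {n k : ℕ} (hn : 1 ≤ n) (hk : 10000 ≤ k) :
    ∃ S : Finset (Op (Fin n)), S.card ^ 50 ≤ 2 ^ (2 ^ n * 2 ^ n * k) ∧
      ∀ t, 1000000 * t ^ 2 ≤ k * max (2 ^ n * 2 ^ n) k →
        ∀ G, Represents G t → ∃ V ∈ S, ∃ c : ℂ, G = c • V := by
  set D := 2 ^ n with hD
  have hnD : n + 1 ≤ D := Nat.lt_two_pow_self
  have hD1 : 1 ≤ D * D := by nlinarith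
  set T := Nat.sqrt (k * max (D * D) k / 1000000) with hT
  have hTt : ∀ t, 1000000 * t ^ 2 ≤ k * max (D * D) k → t ≤ T := fun t ht => by
    rw [hT, Nat.le_sqrt', Nat.le_div_iff_mul_le (by norm_num)]
    omega
  have hT2 : 1000000 * T ^ 2 ≤ k * max (D * D) k := by
    have h1 : T ^ 2 ≤ k * max (D * D) k / 1000000 := Nat.sqrt_le' _
    omega
  suffices h : ∃ E, 50 * (T + E) ≤ D * D * k ∧ ∀ t ≤ T, ∃ S : Finset (Op (Fin n)),
      S.card ≤ 2 ^ E ∧ ∀ G, Represents G t → ∃ V ∈ S, ∃ c : ℂ, G = c • V by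
    obtain ⟨E, hE, h⟩ := h
    obtain ⟨S, hS, hG⟩ := exists_finset_represents_of_le h
    refine ⟨S, ?_, fun t ht => hG t (hTt t ht)⟩
    calc S.card ^ 50 ≤ (2 ^ (T + E)) ^ 50 := Nat.pow_le_pow_left hS 50
      _ = 2 ^ (50 * (T + E)) := by rw [← pow_mul, mul_comm]
      _ ≤ _ := Nat.pow_le_pow_right (by norm_num) hE
  -- For k ≤ 4ⁿ the bound is T² ≲ k·4ⁿ and the quadratic stabilizer count suffices. For k ≥ 4ⁿ it is
  -- T ≤ k/1000 and the cyclotomic count, linear in T, is needed.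
  rcases le_total k (D * D) with hkD | hkD
  · rw [max_eq_left hkD] at hT2
    refine ⟨4 * (2 * n + T + 2) ^ 2, ?_, fun t ht => ?_⟩
    · have h1 : (2 * n + T + 2) ^ 2 ≤ 8 * (D * D) + 2 * T ^ 2 := by
        have : 2 * n + T + 2 ≤ 2 * D + T := by omega
        calc _ ≤ (2 * D + T) ^ 2 := Nat.pow_le_pow_left this 2
          _ ≤ _ := by
            zify
            nlinarith [sq_nonneg (2 * (D : ℤ) - T)]
      have h2 : T ≤ T ^ 2 := Nat.le_self_pow (by norm_num) T
      have h3 : 10000 * (D * D) ≤ k * (D * D) := Nat.mul_le_mul_right _ hk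
      rw [mul_comm (D * D) k]
      omega
    · obtain ⟨S, hS, hG⟩ := exists_finset_represents n t
      exact ⟨S, hS.trans (Nat.pow_le_pow_right (by norm_num) (by gcongr)), hG⟩
  · rw [max_eq_right hkD] at hT2
    have hTk : 1000 * T ≤ k := by nlinarith
    refine ⟨(2 * T + 2) * 4 * (D * D), ?_, fun t ht => ?_⟩
    · have h1 : 1000 * T * (D * D) ≤ k * (D * D) := Nat.mul_le_mul_right _ hTk
      have h2 : T ≤ T * (D * D) := Nat.le_mul_of_pos_right _ hD1
      have h3 : 10000 * (D * D) ≤ k * (D * D) := Nat.mul_le_mul_right _ hk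
      have h4 : (2 * T + 2) * 4 * (D * D) = 8 * (T * (D * D)) + 8 * (D * D) := by ring
      have h5 : 1000 * T * (D * D) = 1000 * (T * (D * D)) := by ring
      rw [mul_comm (D * D) k, h4]
      omega
    · obtain ⟨S, hS, hG⟩ := exists_finset_represents_cyclotomic n t
      refine ⟨S, hS.trans ?_, hG⟩
      rw [pow_mul 2 _ (D * D), pow_mul 2 _ 4]
      refine Nat.pow_le_pow_left (Nat.pow_le_pow_left ?_ 4) _
      calc 2 * 4 ^ t + 1 ≤ 4 * 4 ^ t := by have := Nat.one_le_pow t 4 (by norm_num); omega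
        _ = 2 ^ (2 * (t + 1)) := by rw [pow_mul, pow_succ]; norm_num; ring
        _ ≤ _ := Nat.pow_le_pow_right (by norm_num) (by omega)

/-- The ratio is at most 2^(Dk/50 - Dk/32). The power 1600 = 50 · 32 clears both denominators,
leaving the exponent -18Dk ≤ -32k. -/
theorem card_mul_inv_pow_le {D k s q : ℕ} (hD : 2 ≤ D) (hq : 2 ^ D ≤ q ^ 32)
    (hs : s ^ 50 ≤ 2 ^ (D * k)) :
    (s : ℝ) * (q : ℝ)⁻¹ ^ k ≤ (99 / 100) ^ k := by
  have hq' : (2 : ℝ) ^ D ≤ (q : ℝ) ^ 32 := by exact_mod_cast hq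
  have hs' : (s : ℝ) ^ 50 ≤ 2 ^ (D * k) := by exact_mod_cast hs
  have hq0 : (0 : ℝ) < q := by
    rcases Nat.eq_zero_or_pos q with rfl | h
    · simp at hq
    · exact_mod_cast h
  refine le_of_pow_le_pow_left₀ (n := 1600) (by norm_num) (by positivity) ?_
  have h1 : (s : ℝ) ^ 1600 ≤ 2 ^ (32 * (D * k)) := by
    calc (s : ℝ) ^ 1600 = ((s : ℝ) ^ 50) ^ 32 := by rw [← pow_mul]
      _ ≤ (2 ^ (D * k)) ^ 32 := by gcongr
      _ = _ := by rw [← pow_mul, mul_comm]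
  have h2 : (2 : ℝ) ^ (50 * (D * k)) ≤ ((q : ℝ) ^ k) ^ 1600 := by
    calc (2 : ℝ) ^ (50 * (D * k)) = (2 ^ D) ^ (50 * k) := by rw [← pow_mul]; congr 1; ring
      _ ≤ ((q : ℝ) ^ 32) ^ (50 * k) := by gcongr
      _ = _ := by rw [← pow_mul, ← pow_mul]; congr 1; ring
  have h3 : (1 / 2 : ℝ) ≤ (99 / 100) ^ 50 := by norm_num
  calc ((s : ℝ) * (q : ℝ)⁻¹ ^ k) ^ 1600 = (s : ℝ) ^ 1600 / ((q : ℝ) ^ k) ^ 1600 := by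
        rw [mul_pow, inv_pow, inv_pow, div_eq_mul_inv]
    _ ≤ 2 ^ (32 * (D * k)) / 2 ^ (50 * (D * k)) := by gcongr
    _ = (1 / 2) ^ (18 * (D * k)) := by
      rw [one_div, inv_pow, div_eq_iff (by positivity), ← div_eq_inv_mul,
        eq_div_iff (by positivity), ← pow_add]
      congr 1
      ring
    _ ≤ (1 / 2) ^ (32 * k) := pow_le_pow_of_le_one (by norm_num) (by norm_num) (by nlinarith)
    _ ≤ ((99 / 100) ^ 50) ^ (32 * k) := by gcongr
    _ = _ := by rw [← pow_mul, ← pow_mul]; congr 1; ring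

end Counting

/-! ### The lower bound -/

section LowerBound

variable {n : ℕ}

/-- There is a unitary that, for all large `k`, is not `40000⁻ᵏ / 100`-close to an operator with
few `T` gates. -/
theorem exists_unitary_forall_not_isClose (hn : 1 ≤ n) :
    ∃ U ∈ Matrix.unitaryGroup (Fin n → Fin 2) ℂ, ∀ k, 10000 ≤ k → ∀ t,
      1000000 * t ^ 2 ≤ k * max (2 ^ n * 2 ^ n) k → ∀ G, Represents G t →
        ¬ IsClose U G ((1 / 40000) ^ k / 100) := by
  classical
  obtain ⟨P, hP, U, hq, hU, hclose⟩ := exists_unitary_family hn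
  have hP0 : Nonempty P := by
    by_contra h
    rw [not_nonempty_iff] at h
    simp at hq
  choose! S hS hG using fun k (hk : 10000 ≤ k) => exists_finset_represents_sq_le hn hk
  -- Nothing is forbidden at lengths below 10000, so that the total fraction is small.
  let F : (k : ℕ) → Set (Fin k → P) := fun k =>
    {w | 10000 ≤ k ∧ ∃ ω, (fun i : Fin k => ω i) = w ∧
      ∃ V ∈ S k, IsClose (U ω) V ((1 / 40000) ^ k / 100)}
  let : ∀ k, Fintype (F k) := fun k => Fintype.ofFinite _
  -- Words with a common close operator coincide, so choosing an operator for each forbidden word is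
  -- injective.
  have hcard : ∀ k, 10000 ≤ k → Fintype.card (F k) ≤ (S k).card := by
    intro k hk
    have hF : ∀ w : F k, ∃ V : S k, ∃ ω, (fun i : Fin k => ω i) = w.1 ∧
        IsClose (U ω) V.1 ((1 / 40000) ^ k / 100) := by
      rintro ⟨w, -, ω, h, V, hV, hω⟩
      exact ⟨⟨V, hV⟩, ω, h, hω⟩
    choose V hV using hF
    rw [← Fintype.card_coe (S k)]
    refine Fintype.card_le_of_injective V fun w w' hww => Subtype.ext ?_
    obtain ⟨ω, h, hω⟩ := hV w
    obtain ⟨ω', h', hω'⟩ := hV w'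
    rw [hww] at hω
    rw [← h, ← h']
    exact funext fun i => hclose k ω ω' _ hω hω' i i.2
  have hsum : ∑' k, (Fintype.card (F k) : ℝ≥0∞) * (Fintype.card P : ℝ≥0∞)⁻¹ ^ k < 1 := by
    have hD : 2 ≤ 2 ^ n * 2 ^ n := by
      have := Nat.pow_le_pow_right (show 0 < 2 by norm_num) hn
      nlinarith
    have hterm : ∀ k, (Fintype.card (F k) : ℝ≥0∞) * (Fintype.card P : ℝ≥0∞)⁻¹ ^ k ≤
        ENNReal.ofReal (1 / 400 * (199 / 200) ^ k) := by
      intro k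
      by_cases hk : 10000 ≤ k
      -- One of two factors (199/200)ᵏ is spent on the constant 1/400; the remaining geometric
      -- series has sum 200, for a total of 1/2.
      · have h1 : ((S k).card : ℝ) * (Fintype.card P : ℝ)⁻¹ ^ k ≤ 1 / 400 * (199 / 200) ^ k := by
          calc _ ≤ (99 / 100 : ℝ) ^ k := card_mul_inv_pow_le hD hq (hS k hk)
            _ ≤ ((199 / 200) ^ 2) ^ k := by gcongr; norm_num
            _ = (199 / 200) ^ k * (199 / 200) ^ k := by rw [pow_right_comm, sq]
            _ ≤ (199 / 200) ^ 1400 * (199 / 200) ^ k :=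
              mul_le_mul_of_nonneg_right
                (pow_le_pow_of_le_one (by norm_num) (by norm_num) (by omega)) (by positivity)
            _ ≤ 1 / 400 * (199 / 200) ^ k := by
              have h2 : (199 / 200 : ℝ) ^ 100 ≤ 61 / 100 := by norm_num
              have h3 := pow_le_pow_left₀ (by norm_num) h2 14
              rw [← pow_mul] at h3
              exact mul_le_mul_of_nonneg_right (h3.trans (by norm_num)) (by positivity)
        have hq0 : (0 : ℝ) < Fintype.card P := by exact_mod_cast Fintype.card_pos
        refine le_trans ?_ (ENNReal.ofReal_le_ofReal h1)
        rw [ENNReal.ofReal_mul (by positivity), ENNReal.ofReal_pow (by positivity),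
          ENNReal.ofReal_inv_of_pos hq0, ENNReal.ofReal_natCast, ENNReal.ofReal_natCast]
        gcongr
        exact hcard k hk
      · have : IsEmpty (F k) := ⟨fun w => hk w.2.1⟩
        simp
    have hgeom : HasSum (fun k : ℕ => (1 / 400 : ℝ) * (199 / 200) ^ k)
        (1 / 400 * (1 - 199 / 200)⁻¹) :=
      (hasSum_geometric_of_lt_one (by norm_num) (by norm_num)).mul_left _
    refine (ENNReal.tsum_le_tsum hterm).trans_lt ?_
    rw [← ENNReal.ofReal_tsum_of_nonneg (fun k => by positivity) hgeom.summable, hgeom.tsum_eq,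
      ENNReal.ofReal_lt_one]
    norm_num
  obtain ⟨ω, hω⟩ := exists_forall_prefix_notMem F hsum
  refine ⟨U ω, hU ω, fun k hk t ht G hGt hGc => hω k ⟨hk, ω, rfl, ?_⟩⟩
  obtain ⟨V, hV, c, rfl⟩ := hG k hk t ht G hGt
  exact ⟨V, hV, hGc.of_smul⟩

/-- Here k is determined by 40000^(-(k+1)) < 100ε ≤ 40000⁻ᵏ. The logarithm is bounded through 40000
< 2¹⁶ and 100 · 40000 ≤ 2³² ≤ 2^(16k), which needs k ≥ 2. -/
theorem exists_nat_scale {K : ℕ} (hK : 2 ≤ K) {ε : ℝ} (hε : 0 < ε)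
    (hε' : ε ≤ (1 / 40000) ^ K / 100) :
    ∃ k : ℕ, K ≤ k ∧ ε ≤ (1 / 40000) ^ k / 100 ∧ Real.log (1 / ε) ≤ 32 * k := by
  have h1 : (1 / 40000 : ℝ) ^ K ≤ 1 := pow_le_one₀ (by norm_num) (by norm_num)
  obtain ⟨k, hk, hk'⟩ := exists_nat_pow_near_of_lt_one (x := 100 * ε) (y := 1 / 40000)
    (by positivity) (by linarith) (by norm_num) (by norm_num)
  have h10 : K ≤ k := by
    have h2 : (1 / 40000 : ℝ) ^ (k + 1) < (1 / 40000) ^ K := by linarith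
    have := (pow_lt_pow_iff_right_of_lt_one₀ (by norm_num) (by norm_num)).1 h2
    omega
  refine ⟨k, h10, by linarith, ?_⟩
  have h3 : 1 / ε ≤ 100 * 40000 ^ (k + 1) := by
    rw [div_le_iff₀ hε]
    rw [one_div, inv_pow, inv_lt_iff_one_lt_mul₀ (by positivity)] at hk
    linarith
  have h4 : (100 : ℝ) * 40000 ^ (k + 1) ≤ Real.exp (32 * k) := by
    have he : (2 : ℝ) ≤ Real.exp 1 := by have := Real.add_one_le_exp (1 : ℝ); linarith
    have h6 : (100 * 40000 : ℝ) ≤ 65536 ^ k :=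
      (show (100 * 40000 : ℝ) ≤ 65536 ^ 2 by norm_num).trans
        (pow_le_pow_right₀ (by norm_num) (by omega))
    calc (100 : ℝ) * 40000 ^ (k + 1) = 100 * 40000 * 40000 ^ k := by ring
      _ ≤ 65536 ^ k * 65536 ^ k := by gcongr; norm_num
      _ = 2 ^ (32 * k) := by rw [← mul_pow, pow_mul]; norm_num
      _ ≤ Real.exp 1 ^ (32 * k) := by gcongr
      _ = _ := by rw [← Real.exp_nat_mul]; simp
  rw [Real.log_le_iff_le_exp (by positivity)]
  exact h3.trans h4

/-- With `M` the maximum, (D√l + l)² ≤ 2(32 + 1024)kM, and 4 · 2112 / 10¹⁰ < 10⁻⁶; this fixes the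
constant 1/100000. -/
theorem sq_le_of_le_two_mul {D t k : ℕ} {l : ℝ} (hl0 : 0 ≤ l) (hl : l ≤ 32 * k)
    (ht : (t : ℝ) ≤ 2 * (1 / 100000 * (D * √l + l))) :
    1000000 * t ^ 2 ≤ k * max (D * D) k := by
  set M := max (D * D) k
  have hk : (k : ℝ) ≤ M := by exact_mod_cast le_max_right _ _
  have hD : (D : ℝ) * D ≤ M := by exact_mod_cast le_max_left _ _
  have h1 : (D * √l + l) ^ 2 ≤ 2 * (D * D * l + l * l) := by
    have := Real.sq_sqrt hl0
    nlinarith [sq_nonneg (D * √l - l)]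
  have hkM : 0 ≤ (k : ℝ) * M := by positivity
  have h2 : D * D * l ≤ 32 * (k * M) := by
    calc D * D * l ≤ M * (32 * k) := by gcongr
      _ = _ := by ring
  have h3 : l * l ≤ 1024 * (k * M) := by
    calc l * l ≤ (32 * k) * (32 * k) := by gcongr
      _ = 1024 * (k * k) := by ring
      _ ≤ _ := by gcongr
  have h4 : (t : ℝ) ^ 2 ≤ (2 * (1 / 100000 * (D * √l + l))) ^ 2 := by gcongr
  have h5 : (1000000 : ℝ) * t ^ 2 ≤ k * M := by nlinarith
  exact_mod_cast h5

end LowerBound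

end CliffordT

end

theorem theorem4p3 :
    ∃ c : ℝ, 0 < c ∧ ∃ ε₀ : ℝ, 0 < ε₀ ∧ ε₀ < 1 ∧
      ∀ n : ℕ, 1 ≤ n →
        ∃ U : CliffordT.Op (Fin n), U ∈ Matrix.unitaryGroup (Fin n → Fin 2) ℂ ∧
          ∀ ε : ℝ, 0 < ε → ε ≤ ε₀ →
            ∀ (a : ℕ) (A : CliffordT.AdaptiveCircuit n a), A.Implements U ε →
              ENNReal.ofReal
                  (c * ((2 : ℝ) ^ n * √(Real.log (1 / ε)) + Real.log (1 / ε)))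
                ≤ A.expectedTCount := by
  -- Only K ≥ 10000 is retained, so the power of 1/40000 stays symbolic.
  obtain ⟨K, hK⟩ : ∃ K : ℕ, 10000 ≤ K := ⟨_, le_rfl⟩
  have h1 : (1 / 40000 : ℝ) ^ K ≤ 1 := pow_le_one₀ (by norm_num) (by norm_num)
  refine ⟨1 / 100000, by norm_num, (1 / 40000) ^ K / 100,
    div_pos (pow_pos (by norm_num) _) (by norm_num), by linarith, fun n hn => ?_⟩
  obtain ⟨U, hU, hfar⟩ := CliffordT.exists_unitary_forall_not_isClose hn
  refine ⟨U, hU, fun ε hε hε' a A hA => not_lt.1 fun hT => ?_⟩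
  obtain ⟨k, hk, hεk, hlog⟩ := CliffordT.exists_nat_scale (by omega) hε hε'
  obtain ⟨r, hr, hclose⟩ := CliffordT.Implements.exists_isClose hU hε (by linarith) hA hT
  refine hfar k (hK.trans hk) _ (CliffordT.sq_le_of_le_two_mul (l := Real.log (1 / ε)) ?_ hlog ?_) _
    (CliffordT.represents_reducedKraus A.toProgram r) (hclose.mono hεk)
  · refine Real.log_nonneg ?_
    rw [le_div_iff₀ hε]
    linarith
  · push_cast
    exact hr
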